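/- Let $k$ be a perfect field and let $Sm/k$ be the category of smooth $k$-schemes of finite type with the Nisnevich topology. For a Nisnevich sheaf of sets $\mathcal F$ on $Sm/k$, let $\mathcal S(\mathcal F)$ be the Nisnevich sheaf associated to the presheaf $$U \longmapsto \mathcal F(U)/\!\sim,$$ where $\sim$ is the equivalence relation generated by $\sigma_0^*(h)\sim\sigma_1^*(h)$ for $h\in\mathcal F(U\times\mathbb A^1)$, and $\sigma_0,\sigma_1\colon U\to U\times\mathbb A^1$ are the sections $u\mapsto(u,0)$ and $u\mapsto(u,1)$. There is a canonical morphism $\mathcal F\to\mathcal S(\mathcal F)$; put $\mathcal S^1(\mathcal F)=\mathcal S(\mathcal F)$ and $\mathcal S^{n+1}(\mathcal F)=\mathcal S(\mathcal S^n(\mathcal F))$ for $n\ge 1$. Let $X$ be a reduced, separated, proper $1$-dimensional scheme over $k$ (possibly singular), regarded as the Nisnevich sheaf $U\mapsto \mathrm{Hom}_k(U,X)$ on $Sm/k$. Then $\mathcal S(X)=\mathcal S^2(X)$, that is, the canonical morphism $\mathcal S(X)\to\mathcal S(\mathcal S(X))=\mathcal S^2(X)$ is an isomorphism of sheaves. 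-/

import Mathlib

open CategoryTheory Limits Opposite AlgebraicGeometry

universe u

noncomputable section

namespace A1Chain

/-! ### The category of smooth schemes of finite type over a field -/

/-- Morphisms that are smooth and of finite type (smooth morphisms are locally of finite type). -/
abbrev smoothFT : MorphismProperty Scheme.{u} := @Smooth ⊓ @QuasiCompact

/-- `Sm k`: the full subcategory of `k`-schemes consisting of the smooth `k`-schemes of
finite type. -/
abbrev Sm (k : Type u) [Field k] : Type (u + 1) :=
  smoothFT.{u}.Over ⊤ (Spec (CommRingCat.of k))

variable {k : Type u} [Field k]

instance smooth_hom (U : Sm k) : Smooth U.hom := U.prop.1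

instance quasiCompact_hom (U : Sm k) : QuasiCompact U.hom := U.prop.2

instance isNoetherian_left (U : Sm k) : IsNoetherian U.left := by
  have h1 : IsLocallyNoetherian U.left :=
    LocallyOfFiniteType.isLocallyNoetherian (Y := Spec (CommRingCat.of k)) U.hom
  have h2 : CompactSpace U.left :=
    QuasiCompact.compactSpace_of_compactSpace (Y := Spec (CommRingCat.of k)) U.hom
  exact {}

/-! ### The Nisnevich topology -/

/-- `f : Y ⟶ X` is completely decomposed at `x`: some point `y` of `Y` lies over `x` and has
the same residue field. -/
def SplitAt {X Y : Scheme.{u}} (f : Y ⟶ X) (x : X) : Prop :=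
  ∃ y : Y, f y = x ∧ IsIso (f.residueFieldMap y)

/-- Equivalently, `Spec κ(x) ⟶ X` lifts along `f`. -/
theorem splitAt_iff {X Y : Scheme.{u}} (f : Y ⟶ X) (x : X) :
    SplitAt f x ↔ ∃ l : Spec (X.residueField x) ⟶ Y, l ≫ f = X.fromSpecResidueField x := by
  constructor
  · rintro ⟨y, rfl, hy⟩
    refine ⟨inv (Spec.map (f.residueFieldMap y)) ≫ Y.fromSpecResidueField y, ?_⟩
    rw [Category.assoc, ← Scheme.Hom.SpecMap_residueFieldMap_fromSpecResidueField,
      IsIso.inv_hom_id_assoc]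
  · rintro ⟨l, hl⟩
    obtain ⟨⟨y, φ⟩, rfl⟩ := (Scheme.SpecToEquivOfField (X.residueField x) Y).symm.surjective l
    replace hl : (Spec.map φ ≫ Y.fromSpecResidueField y) ≫ f = X.fromSpecResidueField x := hl
    have hy : f y = x := by
      have h := congr($hl (default : Spec (X.residueField x)))
      simpa using h
    refine ⟨y, hy, ?_⟩
    subst hy
    rw [Category.assoc, ← Scheme.Hom.SpecMap_residueFieldMap_fromSpecResidueField,
      ← Category.assoc, ← Spec.map_comp] at hl
    have h1 : Spec.map (f.residueFieldMap y ≫ φ) = 𝟙 _ := by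
      rw [← cancel_mono (X.fromSpecResidueField (f y)), hl, Category.id_comp]
    have h2 : f.residueFieldMap y ≫ φ = 𝟙 _ := by
      rw [← Spec.map_id] at h1
      exact Spec.map_injective h1
    have h3 : Function.Bijective φ := by
      refine ⟨RingHom.injective φ.hom, fun a ↦ ⟨f.residueFieldMap y a, ?_⟩⟩
      exact congr($h2 a)
    have : IsIso φ := (ConcreteCategory.isIso_iff_bijective φ).mpr h3
    rw [← IsIso.eq_comp_inv, Category.id_comp] at h2
    rw [h2]
    infer_instance

/-- The fibre product of an étale morphism with an arbitrary one in `Sm k`. -/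
def etalePullback {U V W : Sm k} (f : V ⟶ U) (g : W ⟶ U) [Etale f.left] : Sm k :=
  MorphismProperty.Over.mk ⊤ (pullback.snd f.left g.left ≫ W.hom)
    ⟨inferInstance, inferInstance⟩

def etalePullbackFst {U V W : Sm k} (f : V ⟶ U) (g : W ⟶ U) [Etale f.left] :
    etalePullback f g ⟶ V :=
  MorphismProperty.Over.homMk (pullback.fst f.left g.left) (by
    change pullback.fst f.left g.left ≫ V.hom = pullback.snd f.left g.left ≫ W.hom
    rw [← MorphismProperty.Over.w f, ← MorphismProperty.Over.w g, pullback.condition_assoc])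

def etalePullbackSnd {U V W : Sm k} (f : V ⟶ U) (g : W ⟶ U) [Etale f.left] :
    etalePullback f g ⟶ W :=
  MorphismProperty.Over.homMk (pullback.snd f.left g.left) rfl

theorem etalePullback_condition {U V W : Sm k} (f : V ⟶ U) (g : W ⟶ U) [Etale f.left] :
    etalePullbackFst f g ≫ f = etalePullbackSnd f g ≫ g :=
  MorphismProperty.Over.Hom.ext pullback.condition

/-- The Nisnevich topology on `Sm k`: a sieve on `U` is covering iff it contains a family of étale
morphisms such that every point `x` of `U` is the image, under some member of the family, of a
point with the same residue field as `x`. -/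
def nisnevich (k : Type u) [Field k] : GrothendieckTopology (Sm k) where
  sieves U := {S | ∀ x : U.left, ∃ (V : Sm k) (f : V ⟶ U), S f ∧ Etale f.left ∧ SplitAt f.left x}
  top_mem' U x := by
    refine ⟨U, 𝟙 U, trivial, ?_, (splitAt_iff _ _).mpr ⟨U.left.fromSpecResidueField x, ?_⟩⟩
    · change Etale (𝟙 U.left)
      infer_instance
    · exact Category.comp_id _
  pullback_stable' := by
    intro U W S g hS x
    obtain ⟨V, f, hf, hfe, hx⟩ := hS (g.left x)
    obtain ⟨l, hl⟩ := (splitAt_iff _ _).mp hx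
    refine ⟨etalePullback f g, etalePullbackSnd f g, ?_, ?_, (splitAt_iff _ _).mpr ?_⟩
    · change S (etalePullbackSnd f g ≫ g)
      rw [← etalePullback_condition]
      exact S.downward_closed hf _
    · change Etale (pullback.snd f.left g.left)
      infer_instance
    · refine ⟨pullback.lift (Spec.map (g.left.residueFieldMap x) ≫ l)
        (W.left.fromSpecResidueField x) ?_, pullback.lift_snd _ _ _⟩
      rw [Category.assoc, hl, Scheme.Hom.SpecMap_residueFieldMap_fromSpecResidueField]
  transitive' := by
    intro U S hS R hR x
    obtain ⟨V, f, hf, hfe, y, rfl, hy⟩ := hS x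
    obtain ⟨W, g, hg, hge, z, rfl, hz⟩ := hR hf y
    refine ⟨W, g ≫ f, hg, ?_, z, rfl, ?_⟩
    · change Etale (g.left ≫ f.left)
      infer_instance
    · change IsIso ((g.left ≫ f.left).residueFieldMap z)
      rw [Scheme.residueFieldMap_comp]
      exact IsIso.comp_isIso' hy hz

/-! ### Sheaves of sets

Since the objects of `Sm k` form a type in `Type (u + 1)`, sheaves take values in
`Type (u + 1)`, so that sheafification is available; `ULift` is harmless. -/

/-- Nisnevich sheaves of sets on `Sm k`. -/
abbrev Shv (k : Type u) [Field k] := Sheaf (nisnevich k) (Type (u + 1))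

/-- The functor of points `U ↦ Hom_k(U, X)` on `Sm k` of an arbitrary `k`-scheme `X`. -/
abbrev points (X : Over (Spec (CommRingCat.of k))) : (Sm k)ᵒᵖ ⥤ Type u :=
  (MorphismProperty.Over.forget smoothFT.{u} ⊤ (Spec (CommRingCat.of k))).op ⋙ yoneda.obj X

theorem pullback_glue {A B U X Z : Scheme.{u}} (f : A ⟶ U) (g : B ⟶ U) (a : A ⟶ X) (b : B ⟶ X)
    (h : pullback.fst f g ≫ a = pullback.snd f g ≫ b) (p : Z ⟶ A) (q : Z ⟶ B)
    (w : p ≫ f = q ≫ g) : p ≫ a = q ≫ b := by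
  have h' := congrArg (fun c ↦ pullback.lift p q w ≫ c) h
  rwa [pullback.lift_fst_assoc, pullback.lift_snd_assoc] at h'

theorem fppf_of_covers {U : Sm k} {I : Type*} (V : I → Sm k) (f : ∀ i, V i ⟶ U)
    (he : ∀ i, Etale (f i).left) (hs : ∀ x : U.left, ∃ i, ∃ y, (f i).left y = x) :
    Presieve.ofArrows (fun i ↦ (V i).left) (fun i ↦ (f i).left) ∈
      Scheme.fppfPrecoverage U.left := by
  refine (Scheme.ofArrows_mem_precoverage_iff _).mpr ⟨hs, fun i ↦ ?_⟩
  have := he i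
  exact ⟨inferInstance, inferInstance⟩

theorem sheafFor_scheme {U : Sm k} {I : Type*} (V : I → Sm k) (f : ∀ i, V i ⟶ U)
    (he : ∀ i, Etale (f i).left) (hs : ∀ x : U.left, ∃ i, ∃ y, (f i).left y = x)
    (X : Scheme.{u}) :
    (Presieve.ofArrows (fun i ↦ (V i).left) (fun i ↦ (f i).left)).IsSheafFor (yoneda.obj X) := by
  have h := fppf_of_covers V f he hs
  exact (GrothendieckTopology.Subcanonical.isSheaf_of_isRepresentable
    (J := Scheme.fppfTopology) (yoneda.obj X)).isSheafFor _
    (Precoverage.generate_mem_toGrothendieck h)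

theorem scheme_hom_ext {U : Sm k} {I : Type*} (V : I → Sm k) (f : ∀ i, V i ⟶ U)
    (he : ∀ i, Etale (f i).left) (hs : ∀ x : U.left, ∃ i, ∃ y, (f i).left y = x)
    {X : Scheme.{u}} {a b : U.left ⟶ X} (h : ∀ i, (f i).left ≫ a = (f i).left ≫ b) : a = b := by
  refine (sheafFor_scheme V f he hs X).isSeparatedFor.ext ?_
  rintro _ _ ⟨i⟩
  exact h i

theorem sheafFor_points (X : Over (Spec (CommRingCat.of k))) {U : Sm k} {I : Type*} (V : I → Sm k)
    (f : ∀ i, V i ⟶ U) (he : ∀ i, Etale (f i).left)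
    (hs : ∀ x : U.left, ∃ i, ∃ y, (f i).left y = x) :
    (Presieve.ofArrows V f).IsSheafFor (points X) := by
  rw [Presieve.isSheafFor_arrows_iff]
  intro s hc
  obtain ⟨t, ht, -⟩ := (Presieve.isSheafFor_arrows_iff _ _).mp (sheafFor_scheme V f he hs X.left)
    (fun i ↦ (s i).left) (by
      intro i j Z gi gj hg
      have := he i
      have h := congrArg CommaMorphism.left (hc i j (etalePullback (f i) (f j))
        (etalePullbackFst (f i) (f j)) (etalePullbackSnd (f i) (f j))
        (etalePullback_condition (f i) (f j)))
      replace h : pullback.fst (f i).left (f j).left ≫ (s i).left =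
        pullback.snd (f i).left (f j).left ≫ (s j).left := h
      change gi ≫ (s i).left = gj ≫ (s j).left
      exact pullback_glue (f i).left (f j).left (s i).left (s j).left h gi gj hg)
  replace ht : ∀ i, (f i).left ≫ t = (s i).left := ht
  have hw : t ≫ X.hom = U.hom := by
    refine scheme_hom_ext V f he hs fun i ↦ ?_
    rw [← Category.assoc, ht i, MorphismProperty.Over.w (f i)]
    exact Over.w (s i)
  refine ⟨Over.homMk t hw, fun i ↦ Over.OverMorphism.ext (ht i), fun t' ht' ↦ ?_⟩
  refine Over.OverMorphism.ext (scheme_hom_ext V f he hs fun i ↦ ?_)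
  have h := congrArg CommaMorphism.left (ht' i)
  exact Eq.trans h (ht i).symm

theorem isSheaf_points (X : Over (Spec (CommRingCat.of k))) :
    Presieve.IsSheaf (nisnevich k) (points X) := by
  have key : ∀ {U : Sm k} (S : Sieve U), S ∈ nisnevich k U →
      ∃ (V : U.left → Sm k) (f : ∀ i, V i ⟶ U), (∀ i, S (f i)) ∧ (∀ i, Etale (f i).left) ∧
        ∀ x : U.left, SplitAt (f x).left x := by
    intro U S hS
    choose V f hf he hx using hS
    exact ⟨V, f, hf, he, hx⟩
  intro U S hS
  obtain ⟨V, f, hf, he, hs⟩ := key S hS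
  refine Presieve.isSheafFor_subsieve_aux _ (S := Sieve.generate (Presieve.ofArrows V f)) ?_
    ((Presieve.isSheafFor_iff_generate _).mp (sheafFor_points X V f he
      fun x ↦ ⟨x, (hs x).choose, (hs x).choose_spec.1⟩)) ?_
  · rintro W _ ⟨Z, a, _, ⟨i⟩, rfl⟩
    exact S.downward_closed (hf i) a
  · intro W g _
    have hT : (Sieve.generate (Presieve.ofArrows V f)).pullback g ∈ nisnevich k W :=
      (nisnevich k).pullback_stable g fun x ↦
        ⟨V x, f x, Sieve.le_generate _ _ _ ⟨x⟩, he x, hs x⟩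
    obtain ⟨V', f', hf', he', hs'⟩ := key _ hT
    intro x t₁ t₂ h₁ h₂
    refine (sheafFor_points X V' f' he'
      fun x ↦ ⟨x, (hs' x).choose, (hs' x).choose_spec.1⟩).isSeparatedFor.ext ?_
    rintro _ _ ⟨i⟩
    rw [h₁ _ (hf' i), h₂ _ (hf' i)]

/-- A `k`-scheme `X`, not necessarily smooth, viewed as a Nisnevich sheaf on `Sm k` through its
functor of points. -/
def schemeSheaf (X : Over (Spec (CommRingCat.of k))) : Shv k where
  obj := points X ⋙ uliftFunctor.{u + 1}
  property := (isSheaf_iff_isSheaf_of_type _ _).mpr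
    ((Presieve.isSheaf_comp_uliftFunctor_iff (J := nisnevich k)).mpr (isSheaf_points X))

/-! ### The affine line and `𝔸¹`-chain connected components -/

instance smooth_affineLine (U : Scheme.{u}) : Smooth (𝔸(PUnit.{u + 1}; U) ↘ U) := by
  have h : Algebra.Smooth (ULift.{u} ℤ) (MvPolynomial PUnit.{u + 1} (ULift.{u} ℤ)) := {}
  have hs : Smooth (Spec.map (CommRingCat.ofHom
      (MvPolynomial.C : ULift.{u} ℤ →+* MvPolynomial PUnit.{u + 1} (ULift.{u} ℤ)))) := by
    rw [HasRingHomProperty.Spec_iff (P := @Smooth), RingHom.Smooth]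
    convert! h
    exact Algebra.algebra_ext _ _ fun _ ↦ rfl
  suffices h' : Smooth (terminal.from (Spec (CommRingCat.of
      (MvPolynomial PUnit.{u + 1} (ULift.{u} ℤ))))) from
    inferInstanceAs (Smooth (pullback.fst (terminal.from U) _))
  have := isIso_of_isTerminal specULiftZIsTerminal.{u} terminalIsTerminal (terminal.from _)
  rw [← terminal.comp_from (Spec.map (CommRingCat.ofHom MvPolynomial.C))]
  infer_instance

/-- `U × 𝔸¹`, constructed as the affine line over `U`. -/
def lineOver (U : Sm k) : Sm k :=
  MorphismProperty.Over.mk ⊤ ((𝔸(PUnit.{u + 1}; U.left) ↘ U.left) ≫ U.hom)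
    ⟨inferInstance, inferInstance⟩

/-- `g × 𝔸¹ : U × 𝔸¹ ⟶ V × 𝔸¹`. -/
def lineMap {U V : Sm k} (g : U ⟶ V) : lineOver U ⟶ lineOver V :=
  MorphismProperty.Over.homMk (AffineSpace.map PUnit.{u + 1} g.left) (by
    change AffineSpace.map PUnit.{u + 1} g.left ≫ (𝔸(PUnit.{u + 1}; V.left) ↘ V.left) ≫ V.hom =
      (𝔸(PUnit.{u + 1}; U.left) ↘ U.left) ≫ U.hom
    rw [AffineSpace.map_over_assoc, MorphismProperty.Over.w])

/-- For a global function `c` on `U`, the section `u ↦ (u, c(u))` of `U × 𝔸¹ ⟶ U`. -/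
def lineSection (U : Sm k) (c : Γ(U.left, ⊤)) : U ⟶ lineOver U :=
  MorphismProperty.Over.homMk (AffineSpace.homOfVector (𝟙 U.left) fun _ ↦ c) (by
    change AffineSpace.homOfVector (𝟙 U.left) (fun _ ↦ c) ≫
      (𝔸(PUnit.{u + 1}; U.left) ↘ U.left) ≫ U.hom = U.hom
    rw [AffineSpace.homOfVector_over_assoc, Category.id_comp])

/-- The `0`-section `σ₀ : U ⟶ U × 𝔸¹`. -/
def zeroSection (U : Sm k) : U ⟶ lineOver U := lineSection U 0

/-- The `1`-section `σ₁ : U ⟶ U × 𝔸¹`. -/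
def oneSection (U : Sm k) : U ⟶ lineOver U := lineSection U 1

theorem zeroSection_naturality {U V : Sm k} (g : U ⟶ V) :
    zeroSection U ≫ lineMap g = g ≫ zeroSection V := by
  refine MorphismProperty.Over.Hom.ext ?_
  change AffineSpace.homOfVector (𝟙 U.left) (fun _ ↦ 0) ≫ AffineSpace.map PUnit.{u + 1} g.left =
    g.left ≫ AffineSpace.homOfVector (𝟙 V.left) (fun _ ↦ 0)
  ext i
  · simp
  · rw [Scheme.Hom.comp_appTop, Scheme.Hom.comp_appTop, CommRingCat.comp_apply,
      CommRingCat.comp_apply, AffineSpace.map_appTop_coord, AffineSpace.homOfVector_appTop_coord,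
      AffineSpace.homOfVector_appTop_coord]
    simp

theorem oneSection_naturality {U V : Sm k} (g : U ⟶ V) :
    oneSection U ≫ lineMap g = g ≫ oneSection V := by
  refine MorphismProperty.Over.Hom.ext ?_
  change AffineSpace.homOfVector (𝟙 U.left) (fun _ ↦ 1) ≫ AffineSpace.map PUnit.{u + 1} g.left =
    g.left ≫ AffineSpace.homOfVector (𝟙 V.left) (fun _ ↦ 1)
  ext i
  · simp
  · rw [Scheme.Hom.comp_appTop, Scheme.Hom.comp_appTop, CommRingCat.comp_apply,
      CommRingCat.comp_apply, AffineSpace.map_appTop_coord, AffineSpace.homOfVector_appTop_coord,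
      AffineSpace.homOfVector_appTop_coord]
    simp

/-- `a, b ∈ F(U)` are `𝔸¹`-homotopic: there is `h ∈ F(U × 𝔸¹)` with `σ₀^* h = a` and
`σ₁^* h = b`. -/
def Homotopic (F : (Sm k)ᵒᵖ ⥤ Type (u + 1)) (U : (Sm k)ᵒᵖ) (a b : F.obj U) : Prop :=
  ∃ h : F.obj (op (lineOver U.unop)),
    F.map (zeroSection U.unop).op h = a ∧ F.map (oneSection U.unop).op h = b

theorem Homotopic.map {F : (Sm k)ᵒᵖ ⥤ Type (u + 1)} {U V : (Sm k)ᵒᵖ} (g : U ⟶ V)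
    {a b : F.obj U} (hab : Homotopic F U a b) : Homotopic F V (F.map g a) (F.map g b) := by
  obtain ⟨h, rfl, rfl⟩ := hab
  refine ⟨F.map (lineMap g.unop).op h, ?_, ?_⟩
  · rw [← Functor.map_comp_apply, ← Functor.map_comp_apply, ← op_comp,
      zeroSection_naturality]
    rfl
  · rw [← Functor.map_comp_apply, ← Functor.map_comp_apply, ← op_comp,
      oneSection_naturality]
    rfl

/-- The presheaf `U ↦ F(U) / ~`, where `~` is the equivalence relation generated by
`σ₀^* h ~ σ₁^* h` for `h ∈ F(U × 𝔸¹)`. -/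
def preS (F : (Sm k)ᵒᵖ ⥤ Type (u + 1)) : (Sm k)ᵒᵖ ⥤ Type (u + 1) where
  obj U := Quot (Homotopic F U)
  map g := ↾(Quot.map (F.map g) fun _ _ h ↦ h.map g)
  map_id U := by
    ext a
    induction a using Quot.ind
    simp [Quot.map]
  map_comp g g' := by
    ext a
    induction a using Quot.ind
    simp [Quot.map]

/-- The quotient map from `F` to `preS F`. -/
def toPreS (F : (Sm k)ᵒᵖ ⥤ Type (u + 1)) : F ⟶ preS F where
  app U := ↾(Quot.mk (Homotopic F U))

/-- The sheaf `S(F)` of `𝔸¹`-chain connected components of `F`. -/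
def S (F : Shv k) : Shv k :=
  (presheafToSheaf (nisnevich k) (Type (u + 1))).obj (preS F.obj)

/-- The canonical morphism `F ⟶ S(F)`. -/
def toS (F : Shv k) : F ⟶ S F :=
  ⟨toPreS F.obj ≫ toSheafify (nisnevich k) (preS F.obj)⟩

/-- `S^n(F)`, with `S^0(F) = F`. -/
def iterS (F : Shv k) : ℕ → Shv k
  | 0 => F
  | n + 1 => S (iterS F n)

end A1Chain

end

noncomputable section

namespace A1Chain

/-! ### Morphisms that hit a closed point, and rigidity of algebraic constants -/

section

/-! A sheaf in which every section over `U × 𝔸¹` has equal restrictions at `0` and `1` is not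
changed by `S` (`isIso_toS`). So the claim is that every `h ∈ S(X)(U × 𝔸¹)` has this property
(`map_zeroSection_eq`). Such an `h` is only Nisnevich-locally a morphism to `X`, so one has to know
when two morphisms from an integral smooth scheme become equal in `S(X)`.

The points of `X` are of three kinds: closed, rational (the generic value of an affine line over a
finite extension of `k`), and the rest. A closed point `z` has the chart `Spec κ(z)`. A non-closed
rational point `ζ` has as chart the normalization of `X` in `κ(ζ)`. Each chart maps to `Spec L` for
a field `L` of constants algebraic over `k`. A vertex over `T` is a chart with a `T`-point of `Spec
L`, and a morphism has this vertex as a class if it lifts to the chart with these constants.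
Vertices are joined by an edge when they arise from algebraic points of two charts with the same
image in `X`. Two facts make connected classes the right invariant.

Homotopic morphisms are equal or have connected classes (`rel_of_line`). A homotopy whose generic
value is of the third kind is constant. Any other one lifts to a chart, and its constants do not
vary along `𝔸¹`, because an algebraic extension of a perfect field is separable (`hom_spec_ext`).

Morphisms with connected classes agree in `S(X)` (`classOf_eq_of_conn`). By Lüroth's theorem a
rational chart is parametrized by the projective line over a finite Galois extension `K` of its
constants. Two morphisms with the same constants become Galois-equivariant points of a twisted
projective line. One of them gives, locally, a Galois-invariant coordinate system, in which a
straight line joins it to the other (`Adm.exists_local_homotopy`).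

Now let `h` be a section over `Y = U × 𝔸¹` with `U` integral, and take a representative at the
generic point of `Y`. If its generic value is of the third kind, all representatives agree
generically and glue to a morphism `Y ⟶ X`, which is a homotopy between the two restrictions
(`exists_classOf_of_rigid`). Otherwise its vertex extends from the function field to the normal
scheme `Y`, and every representative has a class connected to the pullback of that vertex
(`exists_vert_of_not_rigid`). A vertex over `U × 𝔸¹` restricts equally to `0` and `1`, so the
representatives at the two ends have connected classes. -/

theorem exists_fac_of_forall_apply_eq {T X : Scheme.{u}} [IsReduced T] (f : T ⟶ X) {x : X}
    (hx : IsClosed {x}) (h : ∀ t, f t = x) :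
    ∃ b : T ⟶ Spec (X.residueField x), b ≫ X.fromSpecResidueField x = f := by
  have := isClosed_singleton_iff_isClosedImmersion.mp hx
  -- The projection is a base change of the closed immersion of the point. It is onto because `f` is
  -- constant on points, hence an isomorphism as `T` is reduced.
  have hs : Surjective (pullback.fst f (X.fromSpecResidueField x)) := by
    refine ⟨fun t ↦ ?_⟩
    obtain ⟨z, hz, -⟩ := Scheme.Pullback.exists_preimage_pullback (f := f)
      (g := X.fromSpecResidueField x) t (IsLocalRing.closedPoint _) (by
        rw [h t]; exact (Scheme.fromSpecResidueField_apply _ _).symm)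
    exact ⟨z, hz⟩
  have := isIso_of_isClosedImmersion_of_surjective (pullback.fst f (X.fromSpecResidueField x))
  refine ⟨inv (pullback.fst f (X.fromSpecResidueField x)) ≫ pullback.snd _ _, ?_⟩
  rw [Category.assoc, ← pullback.condition, IsIso.inv_hom_id_assoc]

theorem apply_eq_of_genericPoint {T X : Scheme.{u}} [IrreducibleSpace T] (f : T ⟶ X) {x : X}
    (hx : IsClosed {x}) (h : f (genericPoint T) = x) (t : T) : f t = x := by
  have h1 := (genericPoint_specializes t).map f.continuous
  rw [h] at h1
  exact h1.mem_closed hx rfl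

theorem exists_fac_of_genericPoint {T X : Scheme.{u}} [IsIntegral T] (f : T ⟶ X) {x : X}
    (hx : IsClosed {x}) (h : f (genericPoint T) = x) :
    ∃ b : T ⟶ Spec (X.residueField x), b ≫ X.fromSpecResidueField x = f :=
  exists_fac_of_forall_apply_eq f hx (apply_eq_of_genericPoint f hx h)

instance mono_fromSpecResidueField {X : Scheme.{u}} (x : X) : Mono (X.fromSpecResidueField x) :=
  inferInstance

open Polynomial in
-- The elements `a x` and `b x` are roots of the separable polynomial `p = minpoly k x`. Write `p =
-- (X - a x) q` over `B`. If `a x ≠ b x`, then `q` vanishes at `b x`, and `φ` carries this to `φ (q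
-- (a x)) = 0`. But `q (a x) = p' (a x)` is a unit.
theorem ringHom_ext_of_separable {k L B B' : Type*} [Field k] [PerfectField k] [Field L]
    [CommRing B] [IsDomain B] [CommRing B'] [Nontrivial B'] (i : k →+* L) (hi : i.IsIntegral)
    (a b : L →+* B) (hab : a.comp i = b.comp i) (φ : B →+* B') (h : φ.comp a = φ.comp b) :
    a = b := by
  let := i.toAlgebra
  have : Algebra.IsIntegral k L := ⟨hi⟩
  have : Algebra.IsSeparable k L := inferInstance
  ext x
  have hsep := (Algebra.IsSeparable.isSeparable k x : (minpoly k x).Separable)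
  set p := minpoly k x
  have hr : ∀ c : L →+* B, c.comp i = a.comp i → (p.map (a.comp i)).eval (c x) = 0 := by
    intro c hc
    rw [← hc, Polynomial.eval_map, ← hom_eval₂]
    have : eval₂ i x p = 0 := minpoly.aeval k x
    rw [this, map_zero]
  obtain ⟨q, hq⟩ := dvd_iff_isRoot.mpr (hr a rfl)
  by_contra hne
  have h1 := hr b hab.symm
  rw [hq, eval_mul] at h1
  have h2 : q.eval (b x) = 0 := by
    refine (mul_eq_zero.mp h1).resolve_left ?_
    simpa using sub_ne_zero.mpr (Ne.symm hne)
  have h3 : φ (q.eval (a x)) = 0 := by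
    have : φ (a x) = φ (b x) := congr($h x)
    rw [← eval₂_at_apply, this, eval₂_at_apply, h2, map_zero]
  have h4 : (p.map (a.comp i)).derivative.eval (a x) = q.eval (a x) := by
    rw [hq, derivative_mul]; simp
  have h5 : IsUnit ((p.map (a.comp i)).derivative.eval (a x)) := by
    rw [derivative_map, Polynomial.eval_map, ← hom_eval₂]
    refine (IsUnit.mk0 _ ?_).map a
    exact hsep.aeval_derivative_ne_zero (minpoly.aeval k x)
  rw [h4] at h5
  exact (h5.map φ).ne_zero h3

/-- Translation of `ringHom_ext_of_separable` to global sections: a `T`-point of an algebraic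
extension is determined on any nonempty scheme over `T`. It is applied both to sections of affine
lines and to generic points. -/
theorem hom_spec_ext {k : Type u} [Field k] [PerfectField k] {L : Type u} [Field L]
    (π : Spec (.of L) ⟶ Spec (.of k)) [IsIntegralHom π] {T T₀ : Scheme.{u}} [IsIntegral T]
    [Nonempty T₀] (a b : T ⟶ Spec (.of L)) (hab : a ≫ π = b ≫ π) (t : T₀ ⟶ T)
    (h : t ≫ a = t ≫ b) : a = b := by
  obtain ⟨i, rfl⟩ := Spec.map_surjective π
  have hi : i.hom.IsIntegral := IsIntegralHom.SpecMap_iff.mp ‹_›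
  let e := fun (T : Scheme.{u}) (a : T ⟶ Spec (.of L)) ↦
    (Scheme.ΓSpecIso (.of L)).inv ≫ a.appTop
  have he : ∀ (T : Scheme.{u}) (a b : T ⟶ Spec (.of L)), e T a = e T b → a = b := by
    intro T a b hab
    refine ext_of_isAffine ?_
    exact (cancel_epi _).mp hab
  have hT0 : Nontrivial Γ(T₀, ⊤) :=
    have : Nonempty (⊤ : T₀.Opens) := Nonempty.map (fun x ↦ ⟨x, trivial⟩) ‹_›
    inferInstance
  apply he
  ext1
  refine ringHom_ext_of_separable i.hom hi _ _ ?_ t.appTop.hom ?_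
  · have h1 := congr((Scheme.ΓSpecIso (.of k)).inv ≫ Scheme.Hom.appTop $hab)
    simp only [Scheme.Hom.comp_appTop] at h1
    rw [← Scheme.ΓSpecIso_inv_naturality_assoc, ← Scheme.ΓSpecIso_inv_naturality_assoc] at h1
    exact congr(CommRingCat.Hom.hom $h1)
  · have h1 := congr((Scheme.ΓSpecIso (.of L)).inv ≫ Scheme.Hom.appTop $h)
    simp only [Scheme.Hom.comp_appTop] at h1
    exact congr(CommRingCat.Hom.hom $h1)

section Points

variable {k : Type u} [Field k] {X : Scheme.{u}} (s : X ⟶ Spec (.of k))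

theorem isFinite_of_isClosed_singleton [LocallyOfFiniteType s] {x : X} (hx : IsClosed {x}) :
    IsFinite (X.fromSpecResidueField x ≫ s) := by
  have := isClosed_singleton_iff_isClosedImmersion.mp hx
  exact isFinite_iff_locallyOfFiniteType_of_jacobsonSpace.mpr inferInstance

theorem isClosed_singleton_of_isIntegralHom [IsSeparated s] {x : X}
    [IsIntegralHom (X.fromSpecResidueField x ≫ s)] : IsClosed {x} := by
  have : IsIntegralHom (X.fromSpecResidueField x) := .of_comp _ s
  rw [← Scheme.range_fromSpecResidueField]
  exact (X.fromSpecResidueField x).isClosedMap.isClosed_range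

/-- Otherwise `x` has a proper specialization `z`, and the closures of `z`, `x`, `y` form a chain of
length `2`. All uses of the dimension of `X` pass through this lemma. -/
theorem eq_of_specializes_of_not_isClosed (hX : topologicalKrullDim X = 1) {x y : X}
    (hx : ¬ IsClosed {x}) (h : y ⤳ x) : y = x := by
  by_contra hne
  obtain ⟨z, hz, hzx⟩ : ∃ z, x ⤳ z ∧ z ≠ x := by
    by_contra! H
    refine hx ?_
    have : closure {x} = {x} := by
      ext z
      simp only [Set.mem_singleton_iff]
      exact ⟨fun hz ↦ H z (specializes_iff_mem_closure.mpr hz), fun hz ↦ hz ▸ subset_closure rfl⟩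
    rw [← this]; exact isClosed_closure
  let c : X → TopologicalSpace.IrreducibleCloseds X :=
    fun x ↦ ⟨closure {x}, isIrreducible_singleton.closure, isClosed_closure⟩
  have hlt : ∀ a b : X, a ⤳ b → b ≠ a → c b < c a := by
    intro a b hab hne
    refine lt_of_le_of_ne hab.closure_subset fun heq ↦ hne ?_
    have h1 : closure {b} = closure {a} := congrArg (fun s ↦ s.carrier) heq
    exact (Inseparable.eq (inseparable_iff_closure_eq.mpr h1))
  let p : LTSeries (TopologicalSpace.IrreducibleCloseds X) :=
    ⟨2, ![c z, c x, c y], by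
      intro i
      fin_cases i
      · exact hlt _ _ hz hzx
      · exact hlt _ _ h (Ne.symm hne)⟩
  have h2 := Order.LTSeries.length_le_krullDim p
  rw [show Order.krullDim _ = topologicalKrullDim X from rfl, hX] at h2
  exact absurd h2 (by norm_num [p])

end Points

end

/-! ### Smooth schemes are normal; lifting along integral morphisms -/

section

section SmoothNormal

open TensorProduct

theorem isIntegrallyClosed_of_forall_isIntegralElem {A F : Type*} [CommRing A] [IsDomain A]
    [Field F] (ρ : A →+* F) (hρ : Function.Injective ρ)
    (h : ∀ y : F, ρ.IsIntegralElem y → y ∈ ρ.range) : IsIntegrallyClosed A := by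
  refine (isIntegrallyClosed_iff (FractionRing A)).mpr fun {x} hx ↦ ?_
  obtain ⟨a, ha⟩ := h (IsFractionRing.lift hρ x) (by
    obtain ⟨p, hp, hpx⟩ := hx
    refine ⟨p, hp, ?_⟩
    have := congrArg (IsFractionRing.lift hρ) hpx
    rw [Polynomial.hom_eval₂, map_zero] at this
    have h2 : (IsFractionRing.lift hρ).comp (algebraMap A (FractionRing A)) = ρ := by
      ext; simp
    rwa [h2] at this)
  refine ⟨a, (IsFractionRing.lift hρ).injective ?_⟩
  rw [← ha]; simp

/-- The idempotents of the product satisfy `X ^ 2 - X`, so they come from elements `a i` of `A` with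
sum `1`. One of these lies outside `p`, and inverting it projects `A` to a single factor. -/
theorem exists_notMem_away_of_forall_isIntegralElem {A I : Type*} [CommRing A] [Finite I]
    {F : I → Type*} [∀ i, Field (F i)] (ρ : A →+* ∀ i, F i) (hρ : Function.Injective ρ)
    (h : ∀ y, ρ.IsIntegralElem y → y ∈ ρ.range) (p : Ideal A) [p.IsPrime] :
    ∃ a ∉ p, IsDomain (Localization.Away a) ∧ IsIntegrallyClosed (Localization.Away a) := by
  classical
  have := Fintype.ofFinite I
  have : Nontrivial A := ⟨0, 1, fun h ↦ Ideal.IsPrime.one_notMem ‹_› (h ▸ p.zero_mem)⟩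
  have hs : ∀ i, ∃ a, ρ a = Pi.single i 1 := fun i ↦ h _
    ⟨Polynomial.X ^ 2 - Polynomial.X, Polynomial.monic_X_pow_sub (by rw [Polynomial.degree_X]; norm_num), by
      rw [Polynomial.eval₂_sub, Polynomial.eval₂_X, Polynomial.eval₂_X_pow, pow_two, ← Pi.single_mul]
      simp⟩
  choose a ha using hs
  have hsum : ∑ i, a i = 1 := hρ (by
    rw [map_sum, map_one]
    simp_rw [ha]
    exact Finset.univ_sum_single (1 : ∀ i, F i))
  obtain ⟨i, hi⟩ : ∃ i, a i ∉ p := by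
    by_contra! H
    exact p.one_notMem (hsum ▸ p.sum_mem fun i _ ↦ H i)
  let ρi : A →+* F i := (Pi.evalRingHom F i).comp ρ
  have hρi : ρi (a i) = 1 := by simp [ρi, ha]
  let σ : Localization.Away (a i) →+* F i := IsLocalization.Away.lift (a i) (g := ρi) (by simp [hρi])
  have hσ' : ∀ x, ∃ b, σ x = ρi b ∧ (ρi b = 0 → x = 0) := by
    intro x
    obtain ⟨n, b, hb⟩ := IsLocalization.Away.surj (a i) x
    have h1 : σ x = ρi b := by
      have := congrArg σ hb
      rw [map_mul, map_pow, IsLocalization.Away.lift_eq, IsLocalization.Away.lift_eq, hρi] at this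
      simpa using this
    refine ⟨b, h1, fun h2 ↦ ?_⟩
    have h3 : a i * b = 0 := hρ (by
      rw [map_mul, ha, map_zero]
      ext j
      by_cases hj : j = i
      · subst hj; simpa [ρi] using h2
      · simp [hj])
    have hu := (IsLocalization.Away.algebraMap_isUnit (S := Localization.Away (a i)) (a i))
    have h4 := congrArg (algebraMap A (Localization.Away (a i))) h3
    rw [map_mul, map_zero, hu.mul_right_eq_zero, ← hb, (hu.pow n).mul_left_eq_zero] at h4
    exact h4
  have hσ : Function.Injective σ := by
    rw [injective_iff_map_eq_zero]
    intro x hx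
    obtain ⟨b, hb, hb'⟩ := hσ' x
    exact hb' (hb ▸ hx)
  have hd : IsDomain (Localization.Away (a i)) := hσ.isDomain σ
  refine ⟨a i, hi, hd, isIntegrallyClosed_of_forall_isIntegralElem σ hσ fun y hy ↦ ?_⟩
  have hy' : ρi.IsIntegralElem y := by
    obtain ⟨q, hq, hqy⟩ := hy
    have hr : ∀ c ∈ Set.range q.coeff, True := fun _ _ ↦ trivial
    have hlift : q.map σ ∈ Polynomial.lifts ρi := by
      rw [Polynomial.lifts_iff_coeff_lifts]
      intro n
      obtain ⟨b, hb, -⟩ := hσ' (q.coeff n)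
      exact ⟨b, by rw [Polynomial.coeff_map, hb]⟩
    obtain ⟨q', hq', -, hq'm⟩ := Polynomial.lifts_and_natDegree_eq_and_monic hlift (hq.map σ)
    refine ⟨q', hq'm, ?_⟩
    rw [← Polynomial.eval_map, hq', Polynomial.eval_map, hqy]
  -- The extra factor `X` makes the equation hold in the other coordinates, where `Pi.single i y` is
  -- `0`.
  obtain ⟨b, hb⟩ := h (Pi.single i y) (by
    obtain ⟨q, hq, hqy⟩ := hy'
    refine ⟨Polynomial.X * q, Polynomial.monic_X.mul hq, ?_⟩
    ext j
    have h1 := Polynomial.hom_eval₂ (Polynomial.X * q) ρ (Pi.evalRingHom F j) (Pi.single i y)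
    rw [Pi.evalRingHom_apply, Pi.evalRingHom_apply] at h1
    rw [h1, Polynomial.eval₂_mul, Polynomial.eval₂_X]
    by_cases hj : j = i
    · subst hj; simp [ρi] at hqy; simp [hqy]
    · simp [hj])
  exact ⟨algebraMap _ _ b, by rw [IsLocalization.Away.lift_eq]; simp [ρi, hb]⟩

/-- Over the fraction field of `P` the étale algebra `A` becomes a finite product of fields.
Integral closure commutes with smooth base change and `P` is integrally closed, so the elements of
this product integral over `A` lie in `A`. -/
theorem exists_notMem_away_isIntegrallyClosed_of_etale {P A : Type u} [CommRing P] [IsDomain P]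
    [IsIntegrallyClosed P] [CommRing A] [Algebra P A] [Algebra.Etale P A] (p : Ideal A)
    [p.IsPrime] :
    ∃ a ∉ p, IsDomain (Localization.Away a) ∧ IsIntegrallyClosed (Localization.Away a) := by
  let Fr := FractionRing P
  obtain ⟨I, _, F, _, _, e, -⟩ := (Algebra.Etale.iff_exists_algEquiv_prod Fr (Fr ⊗[P] A)).mp
    inferInstance
  let e' : A ⊗[P] Fr ≃+* ∀ i, F i :=
    RingEquiv.trans (Algebra.TensorProduct.comm P A Fr : A ⊗[P] Fr ≃ₐ[P] Fr ⊗[P] A).toRingEquiv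
      e.toRingEquiv
  have hflat : Module.Flat P A := inferInstance
  have hinj : Function.Injective (algebraMap A (A ⊗[P] Fr)) :=
    Algebra.TensorProduct.includeLeft_injective (S := P) (IsFractionRing.injective P Fr)
  refine exists_notMem_away_of_forall_isIntegralElem
    ((e' : A ⊗[P] Fr →+* ∀ i, F i).comp (algebraMap A (A ⊗[P] Fr))) ?_ ?_ p
  · exact e'.injective.comp hinj
  · intro y hy
    have hy' : IsIntegral A (e'.symm y) := by
      obtain ⟨q, hq, hqy⟩ := hy
      refine ⟨q, hq, e'.injective ?_⟩
      have := Polynomial.hom_eval₂ q (algebraMap A (A ⊗[P] Fr)) (e' : A ⊗[P] Fr →+* ∀ i, F i)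
        (e'.symm y)
      simp only [RingEquiv.coe_toRingHom, RingEquiv.apply_symm_apply] at this
      rw [this, hqy, map_zero]
    obtain ⟨t, ht⟩ := (TensorProduct.toIntegralClosure_bijective_of_smooth (R := P) (S := A)
      (B := Fr)).2 ⟨_, hy'⟩
    suffices h : ∀ t, ∃ a, (TensorProduct.toIntegralClosure P A Fr t).1 = algebraMap A _ a by
      obtain ⟨a, ha⟩ := h t
      rw [ht] at ha
      exact ⟨a, by
        rw [RingHom.comp_apply, ← ha]
        exact e'.apply_symm_apply y⟩
    intro t
    induction t with
    | zero => exact ⟨0, by simp⟩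
    | add x y hx hy =>
      obtain ⟨a, ha⟩ := hx
      obtain ⟨b, hb⟩ := hy
      exact ⟨a + b, by rw [map_add, map_add, Subalgebra.coe_add, ha, hb]⟩
    | tmul x y =>
      obtain ⟨c, hc⟩ := IsIntegrallyClosed.isIntegral_iff.mp y.2
      refine ⟨c • x, ?_⟩
      change x ⊗ₜ[P] y.1 = (c • x) ⊗ₜ[P] 1
      rw [TensorProduct.smul_tmul, ← hc, Algebra.algebraMap_eq_smul_one]

/-- Near `p` a smooth algebra is standard étale over a polynomial ring, which is integrally closed;
this reduces to the étale case. -/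
theorem exists_notMem_away_isIntegrallyClosed {K S : Type u} [Field K] [CommRing S] [Algebra K S]
    [Algebra.Smooth K S] (p : Ideal S) [p.IsPrime] :
    ∃ f ∉ p, IsDomain (Localization.Away f) ∧ IsIntegrallyClosed (Localization.Away f) := by
  obtain ⟨f, hf, n, _, _, _⟩ := Algebra.IsSmoothAt.exists_isStandardEtale_mvPolynomial
    (R := K) (p := p)
  have hdis := (p.disjoint_powers_iff_notMem f ‹p.IsPrime›.isRadical).mpr hf
  have : (p.map (algebraMap S (Localization.Away f))).IsPrime :=
    IsLocalization.isPrime_of_isPrime_disjoint (.powers f) _ _ ‹_› hdis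
  obtain ⟨a, ha, hd, hi⟩ := exists_notMem_away_isIntegrallyClosed_of_etale
    (P := MvPolynomial (Fin n) K) (p.map (algebraMap S (Localization.Away f)))
  -- Clearing the denominator of `a` turns the iterated localization into one at `b * f`.
  obtain ⟨m, b, hb⟩ := IsLocalization.Away.surj f a
  have hu := (IsLocalization.Away.algebraMap_isUnit (S := Localization.Away f) f).pow m
  have : IsLocalization.Away (algebraMap S (Localization.Away f) b) (Localization.Away a) := by
    rw [← hb]
    exact IsLocalization.Away.mul_of_isUnit _ _ (hu.map _)
  have : IsLocalization.Away (b * f) (Localization.Away a) :=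
    IsLocalization.Away.mul (Localization.Away f) _ _ _
  let e : Localization.Away a ≃ₐ[S] Localization.Away (b * f) :=
    IsLocalization.algEquiv (.powers (b * f)) _ _
  refine ⟨b * f, fun h ↦ ?_, e.symm.toMulEquiv.isDomain _, .of_equiv e.toRingEquiv⟩
  refine ha ?_
  have h1 : b ∈ p := (Ideal.IsPrime.mem_or_mem ‹_› h).resolve_right hf
  have h2 := Ideal.mem_map_of_mem (algebraMap S (Localization.Away f)) h1
  rw [← hb] at h2
  exact (Ideal.mul_unit_mem_iff_mem _ hu).mp h2

end SmoothNormal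

/-- Every point has an affine open neighbourhood whose ring of functions is an integrally closed
domain. -/
def LocallyNormal (Y : Scheme.{u}) : Prop :=
  ∀ y : Y, ∃ W : Y.Opens, IsAffineOpen W ∧ y ∈ W ∧ IsDomain Γ(Y, W) ∧ IsIntegrallyClosed Γ(Y, W)

theorem locallyNormal_of_smooth {K : Type u} [Field K] {Y : Scheme.{u}} (f : Y ⟶ Spec (.of K))
    [Smooth f] : LocallyNormal Y := by
  intro y
  obtain ⟨_, ⟨W, hW, rfl⟩, hy, -⟩ :=
    Y.isBasis_affineOpens.exists_subset_of_mem_open (Set.mem_univ y) isOpen_univ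
  let φ : CommRingCat.of K ⟶ Γ(Y, W) :=
    (Scheme.ΓSpecIso (.of K)).inv ≫ f.appLE ⊤ W le_top
  have hφ : φ.hom.Smooth := by
    refine RingHom.Smooth.comp (.of_bijective ?_)
      (HasRingHomProperty.appLE @Smooth f inferInstance ⟨⊤, isAffineOpen_top _⟩ ⟨W, hW⟩ le_top)
    exact ConcreteCategory.bijective_of_isIso (Scheme.ΓSpecIso (.of K)).inv
  algebraize [φ.hom]
  obtain ⟨g, hg, hd, hi⟩ := exists_notMem_away_isIntegrallyClosed (K := K) (S := Γ(Y, W))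
    (hW.primeIdealOf ⟨y, hy⟩).asIdeal
  have := hW.isLocalization_basicOpen g
  let e : Localization.Away g ≃ₐ[Γ(Y, W)] Γ(Y, Y.basicOpen g) :=
    IsLocalization.algEquiv (.powers g) _ _
  refine ⟨Y.basicOpen g, hW.basicOpen g, ?_, e.symm.toMulEquiv.isDomain _, .of_equiv e.toRingEquiv⟩
  have h1 : hW.primeIdealOf ⟨y, hy⟩ ∈ PrimeSpectrum.basicOpen g := hg
  rw [← hW.fromSpec_preimage_basicOpen] at h1
  have h2 : hW.fromSpec (hW.primeIdealOf ⟨y, hy⟩) ∈ Y.basicOpen g := h1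
  rwa [hW.fromSpec_primeIdealOf] at h2

/-- The inclusion of the generic point. -/
def genericInclusion (Y : Scheme.{u}) [IrreducibleSpace Y] : Spec Y.functionField ⟶ Y :=
  Y.fromSpecStalk (genericPoint Y)

theorem LocallyNormal.exists_isIntegral {Y : Scheme.{u}} (hY : LocallyNormal Y) (y : Y) :
    ∃ W : Y.Opens, IsAffineOpen W ∧ y ∈ W ∧ IsIntegral W := by
  obtain ⟨W, hW, hy, hd, -⟩ := hY y
  refine ⟨W, hW, hy, ?_⟩
  have : IsAffine W := hW
  have : Nonempty W := ⟨⟨y, hy⟩⟩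
  have : IsDomain Γ(W, ⊤) := W.topIso.commRingCatIsoToRingEquiv.toMulEquiv.isDomain _
  have : IsIntegral (Spec Γ(W, ⊤)) := inferInstance
  exact isIntegral_of_isOpenImmersion (Scheme.isoSpec W).hom

section

variable {Y : Scheme.{u}} [IsIntegral Y]

instance : QuasiCompact (genericInclusion Y) := quasiCompact_of_noetherianSpace_source _

instance : QuasiSeparated (genericInclusion Y) :=
  have : QuasiSeparated (genericInclusion Y ≫ terminal.from _) := inferInstance
  .of_comp _ (terminal.from Y)

theorem genericInclusion_apply (x) : genericInclusion Y x = genericPoint Y := by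
  have h : Subsingleton (Spec (.of Y.functionField)) := inferInstance
  have : x = IsLocalRing.closedPoint Y.functionField := h.elim _ _
  rw [this]
  exact Scheme.fromSpecStalk_closedPoint

instance : IsDominant (genericInclusion Y) := by
  refine ⟨dense_iff_closure_eq.mpr ?_⟩
  rw [Set.eq_univ_iff_forall]
  intro y
  refine (genericPoint_specializes y).mem_closed isClosed_closure (subset_closure ?_)
  exact ⟨IsLocalRing.closedPoint Y.functionField, genericInclusion_apply _⟩

/-- On an affine open with integrally closed ring of functions, the integral closure in the function
field adds nothing. -/
theorem isIso_fromNormalization_genericInclusion (hY : LocallyNormal Y) :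
    IsIso (genericInclusion Y).fromNormalization := by
  let g := genericInclusion Y
  choose W hW hmem hd hi using hY
  refine (IsZariskiLocalAtTarget.iff_of_iSup_eq_top (P := MorphismProperty.isomorphisms Scheme) W
    ?_).mpr fun y ↦ ?_
  · exact TopologicalSpace.Opens.ext
      (Set.eq_univ_of_forall fun y ↦ by simpa using ⟨y, hmem y⟩)
  refine (isIso_morphismRestrict_iff_isIso_app _ (hW y)).mpr ?_
  rw [Scheme.Hom.fromNormalization_app _ (hW y)]
  let := (g.app (W y)).hom.toAlgebra
  suffices Function.Bijective (algebraMap Γ(Y, W y)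
      (integralClosure Γ(Y, W y) Γ(Spec Y.functionField, g ⁻¹ᵁ W y))) by
    have := (ConcreteCategory.isIso_iff_bijective (CommRingCat.ofHom (algebraMap Γ(Y, W y)
      (integralClosure Γ(Y, W y) Γ(Spec Y.functionField, g ⁻¹ᵁ W y))))).mpr this
    exact IsIso.comp_isIso' this inferInstance
  have : Nonempty (W y) := ⟨⟨y, hmem y⟩⟩
  have hgen : genericPoint Y ∈ W y :=
    ((genericPoint_spec Y).mem_open_set_iff (W y).isOpen).mpr ⟨y, trivial, hmem y⟩
  have htop : g ⁻¹ᵁ W y = ⊤ := by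
    ext x
    simp [g, genericInclusion_apply, hgen]
  have happ : g.app (W y) = Y.germToFunctionField (W y) ≫ (Scheme.ΓSpecIso Y.functionField).inv ≫
      (Spec Y.functionField).presheaf.map (homOfLE le_top).op := Scheme.fromSpecStalk_app hgen
  have hiso : IsIso ((Scheme.ΓSpecIso Y.functionField).inv ≫
      (Spec Y.functionField).presheaf.map (homOfLE (le_top : g ⁻¹ᵁ W y ≤ ⊤)).op) := by
    have : IsIso (homOfLE (le_top : g ⁻¹ᵁ W y ≤ ⊤)) := by
      rw [show homOfLE (le_top : g ⁻¹ᵁ W y ≤ ⊤) = eqToHom htop from rfl]; infer_instance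
    infer_instance
  let θ := (asIso ((Scheme.ΓSpecIso Y.functionField).inv ≫
      (Spec Y.functionField).presheaf.map
        (homOfLE (le_top : g ⁻¹ᵁ W y ≤ ⊤)).op)).commRingCatIsoToRingEquiv
  have hθ : ∀ a, algebraMap Γ(Y, W y) Γ(Spec Y.functionField, g ⁻¹ᵁ W y) a =
      θ (algebraMap _ Y.functionField a) := fun a ↦ congr($happ a)
  have := functionField_isFractionRing_of_isAffineOpen Y (W y) (hW y)
  have := hi y
  constructor
  · intro a b hab
    have h1 : algebraMap Γ(Y, W y) Γ(Spec Y.functionField, g ⁻¹ᵁ W y) a = algebraMap _ _ b :=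
      congrArg Subtype.val hab
    rw [hθ, hθ] at h1
    exact IsFractionRing.injective _ Y.functionField (θ.injective h1)
  · rintro ⟨x, p, hp, hpx⟩
    obtain ⟨a, ha⟩ := (IsIntegrallyClosed.isIntegral_iff (R := Γ(Y, W y)) (x := θ.symm x)).mp (by
      refine ⟨p, hp, θ.injective ?_⟩
      have := Polynomial.hom_eval₂ p (algebraMap Γ(Y, W y) Y.functionField) (RingHomClass.toRingHom θ)
        (θ.symm x)
      simp only [RingHom.coe_coe, RingEquiv.apply_symm_apply] at this
      rw [this, map_zero, ← hpx]
      congr 1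
      ext a
      exact (hθ a).symm)
    refine ⟨a, Subtype.ext ?_⟩
    change algebraMap _ _ a = x
    rw [hθ, ha, RingEquiv.apply_symm_apply]

/-- The pullback of `p` to `Y` is integral and has a section over the generic point. The universal
property of relative normalization extends that section to the normalization of `Y` in its function
field, which is `Y`. -/
theorem exists_lift_of_locallyNormal (hY : LocallyNormal Y) {Z B : Scheme.{u}} (p : Z ⟶ B)
    [IsIntegralHom p] (f : Y ⟶ B) (s : Spec Y.functionField ⟶ Z)
    (h : s ≫ p = genericInclusion Y ≫ f) :
    ∃ σ : Y ⟶ Z, σ ≫ p = f ∧ genericInclusion Y ≫ σ = s := by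
  have := isIso_fromNormalization_genericInclusion hY
  let g := genericInclusion Y
  let d := g.normalizationDesc (pullback.lift g s h.symm) (pullback.fst f p)
    (by rw [pullback.lift_fst])
  have h1 : d ≫ pullback.fst f p = g.fromNormalization := Scheme.Hom.normalizationDesc_comp ..
  have h2 : g.toNormalization ≫ d = pullback.lift g s h.symm :=
    Scheme.Hom.toNormalization_normalizationDesc ..
  have h3 : g = g.toNormalization ≫ g.fromNormalization :=
    (Scheme.Hom.toNormalization_fromNormalization _).symm
  refine ⟨inv g.fromNormalization ≫ d ≫ pullback.snd _ _, ?_, ?_⟩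
  · rw [Category.assoc, Category.assoc, ← pullback.condition, reassoc_of% h1,
      IsIso.inv_hom_id_assoc]
  · change g ≫ _ = s
    refine (congrArg (· ≫ _) h3).trans ?_
    rw [Category.assoc, IsIso.hom_inv_id_assoc, reassoc_of% h2, pullback.lift_snd]

end

end

/-! ### Extending generic maps to proper schemes -/

section

section Extension

variable {k : Type u} [Field k]

theorem specMap_stalkSpecializes_fromSpecStalkOfMem {X Y : Scheme.{u}} (f : X.PartialMap Y)
    {x y : X} (h : x ⤳ y) (hy : y ∈ f.domain) :
    Spec.map (X.presheaf.stalkSpecializes h) ≫ f.fromSpecStalkOfMem hy =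
      f.fromSpecStalkOfMem (h.mem_open f.domain.2 hy) := by
  unfold Scheme.PartialMap.fromSpecStalkOfMem
  rw [← Category.assoc]
  congr 1
  rw [← cancel_mono f.domain.ι, Category.assoc, Scheme.Opens.fromSpecStalkOfMem_ι,
    Scheme.Opens.fromSpecStalkOfMem_ι, Scheme.SpecMap_stalkSpecializes_fromSpecStalk]

theorem exists_lift_of_valuationRing {X S : Scheme.{u}} {R K : Type u} [CommRing R] [IsDomain R]
    [ValuationRing R] [Field K] [Algebra R K] [IsFractionRing R K] (sX : X ⟶ S) [IsProper sX]
    (x : Spec (.of K) ⟶ X) (b : Spec (.of R) ⟶ S)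
    (h : x ≫ sX = Spec.map (CommRingCat.ofHom (algebraMap R K)) ≫ b) :
    ∃ φ : Spec (.of R) ⟶ X, Spec.map (CommRingCat.ofHom (algebraMap R K)) ≫ φ = x ∧
      φ ≫ sX = b := by
  have hex := (UniversallyClosed.eq_valuativeCriterion.le _ _ sX inferInstance).1
  obtain ⟨⟨φ, hφ₁, hφ₂⟩⟩ := (hex ⟨R, K, x, b, ⟨h⟩⟩).exists_lift
  exact ⟨φ, hφ₁, hφ₂⟩

theorem exists_lift_of_valuationRing' {X S : Scheme.{u}} {R K : CommRingCat.{u}} [IsDomain R]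
    [ValuationRing R] (hK : IsField K) (i : R ⟶ K)
    (hi : @IsFractionRing R _ K _ i.hom.toAlgebra) (sX : X ⟶ S) [IsProper sX]
    (x : Spec K ⟶ X) (b : Spec R ⟶ S) (h : x ≫ sX = Spec.map i ≫ b) :
    ∃ φ : Spec R ⟶ X, Spec.map i ≫ φ = x ∧ φ ≫ sX = b :=
  let _ : Field K := hK.toField
  let _ : Algebra R K := i.hom.toAlgebra
  exists_lift_of_valuationRing (R := R) (K := K) sX x b h

/-- A rational map from a scheme whose local rings are valuation rings to a proper scheme is
everywhere defined. -/
theorem exists_extension_of_valuationRing_stalk {X Y : Scheme.{u}} [IsIntegral Y]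
    (hY : ∀ y : Y, ValuationRing (Y.presheaf.stalk y)) (sY : Y ⟶ Spec (.of k))
    (sX : X ⟶ Spec (.of k)) [IsProper sX] (x : Spec Y.functionField ⟶ X)
    (h : x ≫ sX = genericInclusion Y ≫ sY) : ∃ φ : Y ⟶ X, genericInclusion Y ≫ φ = x := by
  have hsep : X.IsSeparated := by
    have : IsSeparated (sX ≫ terminal.from _) := inferInstance
    rw [terminal.comp_from] at this
    exact ⟨this⟩
  let r : Y.RationalMap X := .ofFunctionField sY sX x h
  have hr : r.fromFunctionField = x := Scheme.RationalMap.fromFunctionField_ofFunctionField ..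
  have hdom : r.domain = ⊤ := by
    refine TopologicalSpace.Opens.ext (Set.eq_univ_of_forall fun y ↦ ?_)
    have hgy := genericPoint_specializes y
    have hv := hY y
    have hd : IsDomain (Y.presheaf.stalk y) := inferInstance
    have hx : x ≫ sX = Spec.map (Y.presheaf.stalkSpecializes hgy) ≫ Y.fromSpecStalk y ≫ sY := by
      rw [h, Scheme.SpecMap_stalkSpecializes_fromSpecStalk_assoc]
      rfl
    have hfr : IsFractionRing (Y.presheaf.stalk y) Y.functionField := inferInstance
    obtain ⟨φ, hφ₁, hφ₂⟩ := exists_lift_of_valuationRing' (Field.toIsField Y.functionField)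
      (Y.presheaf.stalkSpecializes hgy) hfr sX x (Y.fromSpecStalk y ≫ sY) hx
    replace hφ₁ : Spec.map (Y.presheaf.stalkSpecializes hgy) ≫ φ = x := hφ₁
    -- The map from the local ring at `y` spreads out to a partial map defined at `y`; it represents
    -- `r` because it has the same generic value.
    refine Scheme.RationalMap.mem_domain.mpr ⟨.ofFromSpecStalk sY sX φ hφ₂,
      Scheme.PartialMap.mem_domain_ofFromSpecStalk .., ?_⟩
    refine Scheme.RationalMap.eq_of_fromFunctionField_eq _ _ (Eq.trans ?_ hr.symm)
    rw [Scheme.RationalMap.fromFunctionField_toRationalMap, Scheme.PartialMap.fromFunctionField,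
      ← specMap_stalkSpecializes_fromSpecStalkOfMem _ hgy
        (Scheme.PartialMap.mem_domain_ofFromSpecStalk ..),
      Scheme.PartialMap.fromSpecStalkOfMem_ofFromSpecStalk, hφ₁]
  let p := r.toPartialMap
  have hp : p.domain = ⊤ := hdom
  let φ : Y ⟶ X := Y.topIso.inv ≫ (Y.isoOfEq hp).inv ≫ p.hom
  refine ⟨φ, ?_⟩
  rw [← hr, ← r.toRationalMap_toPartialMap, Scheme.RationalMap.fromFunctionField_toRationalMap]
  change _ = Scheme.Opens.fromSpecStalkOfMem _ _ _ ≫ p.hom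
  change genericInclusion Y ≫ Y.topIso.inv ≫ (Y.isoOfEq hp).inv ≫ p.hom = _
  simp only [← Category.assoc]
  congr 1
  rw [← cancel_mono p.domain.ι, Scheme.Opens.fromSpecStalkOfMem_ι]
  simp [genericInclusion]

theorem isPrincipalIdealRing_of_isLocalization {R S : Type*} [CommRing R] [CommRing S]
    [Algebra R S] (M : Submonoid R) [IsLocalization M S] [IsPrincipalIdealRing R] :
    IsPrincipalIdealRing S := by
  refine ⟨fun I ↦ ?_⟩
  obtain ⟨a, ha⟩ := IsPrincipalIdealRing.principal (Ideal.under R I)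
  rw [← IsLocalization.map_under M S I, ha]
  change (Ideal.map _ (Ideal.span {a})).IsPrincipal
  rw [Ideal.map_span, Set.image_singleton]
  exact ⟨_, rfl⟩

/-- Local rings of a principal ideal domain are valuation rings. The lemma extends a map from `Spec
K(t)` to the affine line. -/
theorem exists_extension_of_isPrincipalIdealRing {R : CommRingCat.{u}} [IsDomain R]
    [IsPrincipalIdealRing R] {E : Type u} [Field E] [Algebra R E] [IsFractionRing R E]
    {X : Scheme.{u}} (sR : Spec R ⟶ Spec (.of k)) (sX : X ⟶ Spec (.of k)) [IsProper sX]
    (x : Spec (.of E) ⟶ X)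
    (h : x ≫ sX = Spec.map (CommRingCat.ofHom (algebraMap R E)) ≫ sR) :
    ∃ φ : Spec R ⟶ X, Spec.map (CommRingCat.ofHom (algebraMap R E)) ≫ φ = x := by
  have hval (p : Spec R) : ValuationRing ((Spec R).presheaf.stalk p) := by
    have h0 := StructureSheaf.IsLocalization.to_stalk R p
    have h1 : IsPrincipalIdealRing ((Spec R).presheaf.stalk p) :=
      @isPrincipalIdealRing_of_isLocalization _ _ _ _ (_) _ h0 _
    have h2 : IsDomain ((Spec R).presheaf.stalk p) := inferInstance
    infer_instance
  let e : (Spec R).functionField ≃ₐ[R] E := IsLocalization.algEquiv (nonZeroDivisors R) _ _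
  let ε : (Spec R).functionField ⟶ .of E := CommRingCat.ofHom e.toRingHom
  let ε' : .of E ⟶ (Spec R).functionField := CommRingCat.ofHom e.symm.toRingHom
  have h1 : ε ≫ ε' = 𝟙 _ := by
    ext a; exact e.symm_apply_apply a
  have h2 : ε' ≫ ε = 𝟙 _ := by
    ext a; exact e.apply_symm_apply a
  have h3 : Spec.map ε ≫ genericInclusion (Spec R) =
      Spec.map (CommRingCat.ofHom (algebraMap R E)) := by
    refine (congrArg (Spec.map ε ≫ ·) (Spec.fromSpecStalk_eq R (genericPoint (Spec R)))).trans ?_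
    refine (Spec.map_comp _ _).symm.trans (congrArg Spec.map ?_)
    ext a
    exact e.commutes a
  obtain ⟨φ, hφ⟩ := exists_extension_of_valuationRing_stalk hval sR sX (Spec.map ε' ≫ x) (by
    rw [Category.assoc, h, ← h3, ← Category.assoc, ← Category.assoc, ← Spec.map_comp, h1,
      Spec.map_id, Category.id_comp])
  refine ⟨φ, ?_⟩
  rw [← h3, Category.assoc, hφ, ← Category.assoc, ← Spec.map_comp, h2, Spec.map_id,
    Category.id_comp]

end Extension

end

/-! ### The normalization of a scheme at a point -/

section

theorem exists_fac_of_field {K : Type u} [Field K] {X : Scheme.{u}} (g : Spec (.of K) ⟶ X) {x : X}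
    (h : ∀ t, g t = x) :
    ∃ b : X.residueField x ⟶ .of K, Spec.map b ≫ X.fromSpecResidueField x = g := by
  obtain ⟨⟨y, φ⟩, rfl⟩ := (Scheme.SpecToEquivOfField K X).symm.surjective g
  obtain rfl : y = x := by
    rw [← h (IsLocalRing.closedPoint K)]
    exact (Scheme.fromSpecResidueField_apply _ _).symm
  exact ⟨φ, rfl⟩

/-- A specialization of `e` lies over the same closed point, hence over the same affine open. There
`e` corresponds to a prime over a maximal ideal in an integral extension, and such a prime is
maximal. -/
theorem isClosed_singleton_of_isClosed_apply {C X : Scheme.{u}} (ν : C ⟶ X) [IsIntegralHom ν]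
    {e : C} (h : IsClosed {ν e}) : IsClosed {e} := by
  obtain ⟨_, ⟨W, hW, rfl⟩, hy, -⟩ :=
    X.isBasis_affineOpens.exists_subset_of_mem_open (Set.mem_univ (ν e)) isOpen_univ
  have hW' : IsAffineOpen (ν ⁻¹ᵁ W) := hW.preimage ν
  have hm : (hW'.primeIdealOf ⟨e, hy⟩).asIdeal.IsMaximal := by
    have h1 := hW.primeIdealOf_isMaximal_of_isClosed ⟨ν e, hy⟩ h
    refine Ideal.isMaximal_of_isIntegral_of_isMaximal_comap' (ν.app W).hom ?_ _ ?_
    · exact IsIntegralHom.isIntegral_app _ _ hW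
    · rw [Scheme.Hom.app_eq_appLE]
      have h2 := congr($(IsAffineOpen.comap_primeIdealOf_appLE W hW _ hW' le_rfl hy).asIdeal)
      rw [← h2] at h1
      exact h1
  have hcl : closure {e} ⊆ {e} := by
    intro y hy'
    have hs : e ⤳ y := specializes_iff_mem_closure.mpr hy'
    have hνy : ν y = ν e := (hs.map ν.continuous).mem_closed h rfl
    have hyW : y ∈ ν ⁻¹ᵁ W := by
      change ν y ∈ W
      rw [hνy]; exact hy
    have h3 : hW'.primeIdealOf ⟨e, hy⟩ ⤳ hW'.primeIdealOf ⟨y, hyW⟩ := by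
      refine (hW'.fromSpec.isOpenEmbedding.isInducing.specializes_iff).mp ?_
      have h7 := hW'.fromSpec_primeIdealOf ⟨e, hy⟩
      have h8 := hW'.fromSpec_primeIdealOf ⟨y, hyW⟩
      exact h7 ▸ h8 ▸ hs
    have h4 := hm.eq_of_le (hW'.primeIdealOf ⟨y, hyW⟩).2.ne_top
      ((PrimeSpectrum.le_iff_specializes _ _).mpr h3)
    have h5 : hW'.primeIdealOf ⟨e, hy⟩ = hW'.primeIdealOf ⟨y, hyW⟩ := PrimeSpectrum.ext h4
    have h6 := congrArg hW'.fromSpec h5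
    rw [hW'.fromSpec_primeIdealOf, hW'.fromSpec_primeIdealOf] at h6
    exact h6.symm
  rw [← Set.Subset.antisymm hcl subset_closure]
  exact isClosed_closure

theorem exists_evaluation_mul_eq {X : Scheme.{u}} {W : X.Opens} (hW : IsAffineOpen W) {ζ : X}
    (hζ : ζ ∈ W) (x : X.residueField ζ) :
    ∃ a b, X.evaluation W ζ hζ b ≠ 0 ∧ x * X.evaluation W ζ hζ b = X.evaluation W ζ hζ a := by
  obtain ⟨y, rfl⟩ := X.residue_surjective ζ x
  let := X.presheaf.algebra_section_stalk ⟨ζ, hζ⟩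
  have := hW.isLocalization_stalk ⟨ζ, hζ⟩
  obtain ⟨⟨a, b⟩, hab⟩ := IsLocalization.surj (hW.primeIdealOf ⟨ζ, hζ⟩).asIdeal.primeCompl y
  refine ⟨a, b, ?_, ?_⟩
  · have hu := IsLocalization.map_units (X.presheaf.stalk ζ) b
    exact (hu.map (X.residue ζ).hom).ne_zero
  · have := congrArg (X.residue ζ) hab
    rw [map_mul] at this
    exact this

section Normalization

variable {X : Scheme.{u}} (ζ : X)

instance : QuasiCompact (X.fromSpecResidueField ζ) := quasiCompact_of_noetherianSpace_source _

instance : QuasiSeparated (X.fromSpecResidueField ζ) :=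
  have : QuasiSeparated (X.fromSpecResidueField ζ ≫ terminal.from _) := inferInstance
  .of_comp _ (terminal.from X)

/-- The normalization of `X` in the residue field of a point `ζ`. -/
abbrev normalizationAt : Scheme.{u} := (X.fromSpecResidueField ζ).normalization

/-- The structure morphism of the normalization of `X` in the residue field of `ζ`. -/
abbrev normalizationAtHom : normalizationAt ζ ⟶ X := (X.fromSpecResidueField ζ).fromNormalization

variable {ζ}

theorem exists_lift_normalizationAt {Y : Scheme.{u}} [IsIntegral Y] (hY : LocallyNormal Y)
    (f : Y ⟶ X) (hf : f (genericPoint Y) = ζ) :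
    ∃ g : Y ⟶ normalizationAt ζ, g ≫ normalizationAtHom ζ = f := by
  obtain ⟨b, hb⟩ := exists_fac_of_field (K := Y.functionField) (genericInclusion Y ≫ f)
    (x := ζ) (fun t ↦ by
      rw [Scheme.Hom.comp_apply]
      exact (congrArg f (genericInclusion_apply t)).trans hf)
  obtain ⟨g, hg, -⟩ := exists_lift_of_locallyNormal hY (normalizationAtHom ζ) f
    (Spec.map b ≫ (X.fromSpecResidueField ζ).toNormalization) (by
      rw [Category.assoc, Scheme.Hom.toNormalization_fromNormalization]
      exact hb)
  exact ⟨g, hg⟩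

theorem specMap_evaluation_fromSpec {W : X.Opens} (hW : IsAffineOpen W) (hζ : ζ ∈ W) :
    Spec.map (X.evaluation W ζ hζ) ≫ hW.fromSpec = X.fromSpecResidueField ζ := by
  rw [Scheme.evaluation, Spec.map_comp, Category.assoc, Scheme.fromSpecResidueField,
    ← hW.fromSpecStalk_eq_fromSpecStalk hζ]
  rfl

/-- Sections of the normalization embed in `κ(ζ)`, whose elements are fractions of values at `ζ` of
functions on `X`. This is the birationality behind the uniqueness of lifts. -/
theorem exists_fraction_normalizationAt {W : X.Opens} (hW : IsAffineOpen W) (hζ : ζ ∈ W)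
    (x : Γ(normalizationAt ζ, normalizationAtHom ζ ⁻¹ᵁ W)) :
    ∃ a b : Γ(X, W), X.evaluation W ζ hζ b ≠ 0 ∧
      x * (normalizationAtHom ζ).app W b = (normalizationAtHom ζ).app W a := by
  let r := X.fromSpecResidueField ζ
  let := (r.app W).hom.toAlgebra
  have htop : r ⁻¹ᵁ W = ⊤ := by
    ext x
    simp [r, Scheme.fromSpecResidueField_apply, hζ]
  let j := r.toNormalization.appLE (normalizationAtHom ζ ⁻¹ᵁ W) (r ⁻¹ᵁ W)
    (by simp [r, ← Scheme.Hom.comp_preimage])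
  have hj : Function.Injective j := by
    have h1 := r.normalizationObjIso_hom_val hW
    have h2 : ∀ a, j a = ((r.normalizationObjIso hW).hom a).1 := fun a ↦ congr($h1.symm a)
    intro a b hab
    rw [h2, h2] at hab
    exact (ConcreteCategory.bijective_of_isIso (r.normalizationObjIso hW).hom).1
      (Subtype.val_injective hab)
  let ψ : Γ(Spec (X.residueField ζ), r ⁻¹ᵁ W) ⟶ X.residueField ζ :=
    (Spec (X.residueField ζ)).presheaf.map (eqToHom htop.symm).op ≫
      (Scheme.ΓSpecIso (X.residueField ζ)).hom
  have hψ : Function.Injective ψ := (ConcreteCategory.bijective_of_isIso ψ).1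
  have hev : ∀ a, ψ (r.app W a) = X.evaluation W ζ hζ a := by
    have h0 : r.app W = X.evaluation W ζ hζ ≫ (Scheme.ΓSpecIso (X.residueField ζ)).inv ≫
        (Spec (X.residueField ζ)).presheaf.map (homOfLE le_top).op := by
      rw [show r = Spec.map (X.residue ζ) ≫ X.fromSpecStalk ζ from rfl, Scheme.Hom.comp_app,
        Scheme.fromSpecStalk_app hζ, Category.assoc, Category.assoc,
        (Spec.map (X.residue ζ)).naturality]
      rw [Scheme.evaluation, Category.assoc, ← Category.assoc (X.residue ζ),
        Scheme.ΓSpecIso_inv_naturality]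
      rfl
    intro a
    have h1 : r.app W ≫ ψ = X.evaluation W ζ hζ := by
      rw [h0]
      simp only [ψ, Category.assoc]
      rw [← Functor.map_comp_assoc,
        Subsingleton.elim ((homOfLE le_top).op ≫ (eqToHom htop.symm).op) (𝟙 _),
        CategoryTheory.Functor.map_id, Category.id_comp, Iso.inv_hom_id, Category.comp_id]
    exact congr($h1 a)
  have hjr : ∀ a, j ((normalizationAtHom ζ).app W a) = r.app W a := by
    intro a
    have h1 : ∀ r' (_ : r' = r) h', r'.appLE W (r ⁻¹ᵁ W) h' = r.app W := by
      rintro _ rfl _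
      exact Scheme.Hom.appLE_eq_app _
    have h2 : (normalizationAtHom ζ).app W ≫ j = r.app W := by
      rw [Scheme.Hom.app_eq_appLE, Scheme.Hom.appLE_comp_appLE]
      exact h1 _ r.toNormalization_fromNormalization _
    exact congr($h2 a)
  obtain ⟨a, b, hb, hab⟩ := exists_evaluation_mul_eq hW hζ (ψ (j x))
  refine ⟨a, b, hb, hj (hψ ?_)⟩
  rw [map_mul, map_mul, hjr, hjr, hev, hev, hab]

/-- At the generic point of `T` both maps are ring homomorphisms on sections over an affine
neighbourhood of `ζ`. They agree on functions from `X`, hence on fractions with denominator nonzero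
at `ζ`, which are all sections. Separatedness over `X` carries the equality to `T`. -/
theorem normalizationAt_hom_ext {T : Scheme.{u}} [IsIntegral T] (f g : T ⟶ normalizationAt ζ)
    (h : f ≫ normalizationAtHom ζ = g ≫ normalizationAtHom ζ)
    (hf : (f ≫ normalizationAtHom ζ) (genericPoint T) = ζ) : f = g := by
  refine ext_of_isDominant_of_isSeparated (normalizationAtHom ζ) h (genericInclusion T) ?_
  obtain ⟨_, ⟨W, hW, rfl⟩, hy, -⟩ :=
    X.isBasis_affineOpens.exists_subset_of_mem_open (Set.mem_univ ζ) isOpen_univ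
  replace hW : IsAffineOpen W := hW
  have hW' : IsAffineOpen (normalizationAtHom ζ ⁻¹ᵁ W) := hW.preimage _
  obtain ⟨b, hb⟩ := exists_fac_of_field (K := T.functionField)
    (genericInclusion T ≫ f ≫ normalizationAtHom ζ) (x := ζ) (fun t ↦ by
      rw [Scheme.Hom.comp_apply]
      exact (congrArg _ (genericInclusion_apply t)).trans hf)
  have key : ∀ q : Spec T.functionField ⟶ normalizationAt ζ,
      q ≫ normalizationAtHom ζ = Spec.map b ≫ X.fromSpecResidueField ζ →
      ∃ γ, Spec.map γ ≫ hW'.fromSpec = q ∧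
        (normalizationAtHom ζ).app W ≫ γ = X.evaluation W ζ hy ≫ b := by
    intro q hq
    have hrange : Set.range q ⊆ Set.range hW'.fromSpec := by
      rw [hW'.range_fromSpec]
      rintro _ ⟨t, rfl⟩
      change normalizationAtHom ζ (q t) ∈ W
      rw [← Scheme.Hom.comp_apply, hq, Scheme.Hom.comp_apply, Scheme.fromSpecResidueField_apply]
      exact hy
    obtain ⟨γ, hγ⟩ := Spec.map_surjective (IsOpenImmersion.lift hW'.fromSpec q hrange)
    have h1 : Spec.map γ ≫ hW'.fromSpec = q := by
      rw [hγ, IsOpenImmersion.lift_fac]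
    refine ⟨γ, h1, ?_⟩
    rw [← specMap_evaluation_fromSpec hW hy, ← h1, Category.assoc,
      ← IsAffineOpen.SpecMap_appLE_fromSpec _ hW hW' le_rfl, ← Category.assoc, ← Category.assoc,
      cancel_mono, ← Spec.map_comp, ← Spec.map_comp] at hq
    rw [Scheme.Hom.app_eq_appLE]
    exact Spec.map_injective hq
  obtain ⟨γ, h1, h2⟩ := key (genericInclusion T ≫ f) (by rw [hb, Category.assoc])
  obtain ⟨γ', h1', h2'⟩ := key (genericInclusion T ≫ g) (by rw [hb, Category.assoc, h])
  rw [← h1, ← h1']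
  congr 2
  ext x
  obtain ⟨c, d, hd, hcd⟩ := exists_fraction_normalizationAt hW hy x
  have e1 := congrArg γ hcd
  have e2 := congrArg γ' hcd
  have f1 : ∀ a, γ ((normalizationAtHom ζ).app W a) = b (X.evaluation W ζ hy a) :=
    fun a ↦ congr($h2 a)
  have f2 : ∀ a, γ' ((normalizationAtHom ζ).app W a) = b (X.evaluation W ζ hy a) :=
    fun a ↦ congr($h2' a)
  rw [map_mul, f1, f1] at e1
  rw [map_mul, f2, f2, ← e1] at e2
  have hne : b (X.evaluation W ζ hy d) ≠ 0 := fun h0 ↦ hd (b.hom.injective (h0.trans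
    (map_zero _).symm))
  exact (mul_right_cancel₀ hne e2).symm

end Normalization

end

/-! ### Charts, vertices and connected classes -/

section

variable {k : Type u} [Field k] {X : Scheme.{u}} (s : X ⟶ Spec (.of k))

/-- An integral `X`-scheme together with a map to the spectrum of an algebraic field extension. -/
structure Chart where
  C : Scheme.{u}
  ν : C ⟶ X
  L : Type u
  [field : Field L]
  p : C ⟶ Spec (.of L)
  π : Spec (.of L) ⟶ Spec (.of k)
  comm : p ≫ π = ν ≫ s
  [integral_ν : IsIntegralHom ν]
  [integral_π : IsIntegralHom π]

attribute [instance] Chart.field Chart.integral_ν Chart.integral_π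

/-- A point hit by the generic point of an affine line over a finite extension of `k`. -/
def IsRationalPoint (ζ : X) : Prop :=
  ∃ (K : Type u) (_ : Field K) (ψ : Spec (.of K) ⟶ Spec (.of k)) (_ : IsFinite ψ)
    (φ : 𝔸(PUnit.{u + 1}; Spec (.of K)) ⟶ X),
    φ ≫ s = (𝔸(PUnit.{u + 1}; Spec (.of K)) ↘ Spec (.of K)) ≫ ψ ∧ φ (genericPoint _) = ζ

section RationalChart

variable (ζ : X)

/-- The structure map from `k` to the residue field of `ζ`. -/
def residueFieldHom : CommRingCat.of k ⟶ X.residueField ζ :=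
  Spec.preimage (X.fromSpecResidueField ζ ≫ s)

theorem specMap_residueFieldHom :
    Spec.map (residueFieldHom s ζ) = X.fromSpecResidueField ζ ≫ s := Spec.map_preimage _

/-- The residue field of `ζ` as a `k`-algebra. -/
abbrev residueFieldAlgebra : Algebra k (X.residueField ζ) := (residueFieldHom s ζ).hom.toAlgebra

/-- The algebraic closure of `k` in the residue field of `ζ`. -/
abbrev constants : Type u :=
  letI := residueFieldAlgebra s ζ
  algebraicClosure k (X.residueField ζ)

/-- The structure morphism of the field of constants. -/
def constantsHom : Spec (.of (constants s ζ)) ⟶ Spec (.of k) :=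
  letI := residueFieldAlgebra s ζ
  Spec.map (CommRingCat.ofHom (algebraMap k (algebraicClosure k (X.residueField ζ))))

instance : IsIntegralHom (constantsHom s ζ) := by
  let := residueFieldAlgebra s ζ
  rw [constantsHom, IsIntegralHom.SpecMap_iff]
  have : Algebra.IsIntegral k (algebraicClosure k (X.residueField ζ)) := inferInstance
  exact this.isIntegral

/-- The inclusion of the field of constants in the residue field. -/
def toConstants : Spec (X.residueField ζ) ⟶ Spec (.of (constants s ζ)) :=
  letI := residueFieldAlgebra s ζ
  Spec.map (CommRingCat.ofHom
    (algebraMap (algebraicClosure k (X.residueField ζ)) (X.residueField ζ)))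

theorem toConstants_comp : toConstants s ζ ≫ constantsHom s ζ = X.fromSpecResidueField ζ ≫ s := by
  rw [← specMap_residueFieldHom]
  exact (Spec.map_comp _ _).symm.trans rfl

theorem toConstants_factorization : X.fromSpecResidueField ζ =
    pullback.lift (X.fromSpecResidueField ζ) (toConstants s ζ) (toConstants_comp s ζ).symm ≫
      pullback.fst s (constantsHom s ζ) :=
  (pullback.lift_fst _ _ _).symm

/-- The normalization at `ζ` maps to the spectrum of the field of constants. -/
def normalizationAtConstants : normalizationAt ζ ⟶ Spec (.of (constants s ζ)) :=
  (X.fromSpecResidueField ζ).normalizationDesc _ _ (toConstants_factorization s ζ) ≫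
    pullback.snd s (constantsHom s ζ)

theorem toNormalization_normalizationAtConstants :
    (X.fromSpecResidueField ζ).toNormalization ≫ normalizationAtConstants s ζ =
      toConstants s ζ := by
  rw [normalizationAtConstants, Scheme.Hom.toNormalization_normalizationDesc_assoc,
    pullback.lift_snd]

/-- The chart given by the normalization at a point. -/
def normalizationChart : Chart s where
  C := normalizationAt ζ
  ν := normalizationAtHom ζ
  L := constants s ζ
  p := normalizationAtConstants s ζ
  π := constantsHom s ζ
  comm := by
    rw [normalizationAtConstants, Category.assoc, ← pullback.condition, ← Category.assoc,
      Scheme.Hom.normalizationDesc_comp]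

/-- The point `Spec κ(ζ)` is dense in the normalization and maps to `ζ`. -/
theorem normalizationAtHom_specializes (c : normalizationAt ζ) :
    ζ ⤳ normalizationAtHom ζ c := by
  have h : DenseRange (X.fromSpecResidueField ζ).toNormalization :=
    (X.fromSpecResidueField ζ).toNormalization.denseRange
  refine specializes_iff_mem_closure.mpr ?_
  have h1 := image_closure_subset_closure_image (normalizationAtHom ζ).continuous
    (s := Set.range (X.fromSpecResidueField ζ).toNormalization) ⟨c, h c, rfl⟩
  refine closure_mono ?_ h1
  rintro _ ⟨_, ⟨e, rfl⟩, rfl⟩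
  rw [← Scheme.Hom.comp_apply, Scheme.Hom.toNormalization_fromNormalization,
    Scheme.fromSpecResidueField_apply]
  rfl

end RationalChart

/-- The chart of a closed point. -/
def closedChart [IsProper s] (z : X) (hz : IsClosed {z}) : Chart s where
  C := Spec (X.residueField z)
  ν := X.fromSpecResidueField z
  L := X.residueField z
  p := 𝟙 _
  π := X.fromSpecResidueField z ≫ s
  comm := Category.id_comp _
  integral_ν := by
    have := isClosed_singleton_iff_isClosedImmersion.mp hz
    infer_instance
  integral_π := by
    have := isFinite_of_isClosed_singleton s hz
    infer_instance

/-- The indices of the admissible charts. -/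
inductive Adm where
  | closed (z : X) (hz : IsClosed {z})
  | rational (ζ : X) (hζ : ¬ IsClosed {ζ}) (hr : IsRationalPoint s ζ)

/-- The chart of an index. -/
def Adm.chart [IsProper s] : Adm s → Chart s
  | .closed z hz => closedChart s z hz
  | .rational ζ _ _ => normalizationChart s ζ

variable {s} [IsProper s] {T T' : Scheme.{u}}

/-- A vertex over `T`: an admissible chart and a `T`-point of its field of constants. -/
structure Vert (s : X ⟶ Spec (.of k)) [IsProper s] (t : T ⟶ Spec (.of k)) where
  c : Adm s
  a : T ⟶ Spec (.of c.chart.L)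
  w : a ≫ c.chart.π = t

/-- Pullback of vertices. -/
def Vert.map {t : T ⟶ Spec (.of k)} (v : Vert s t) (g : T' ⟶ T) : Vert s (g ≫ t) where
  c := v.c
  a := g ≫ v.a
  w := by rw [Category.assoc, v.w]

/-- Two vertices are adjacent if they come from a common algebraic point of their charts. -/
def Edge {t : T ⟶ Spec (.of k)} (v v' : Vert s t) : Prop :=
  ∃ (M : Type u) (_ : Field M) (m : Spec (.of M) ⟶ v.c.chart.C) (m' : Spec (.of M) ⟶ v'.c.chart.C)
    (j : T ⟶ Spec (.of M)), m ≫ v.c.chart.ν = m' ≫ v'.c.chart.ν ∧ v.a = j ≫ m ≫ v.c.chart.p ∧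
      v'.a = j ≫ m' ≫ v'.c.chart.p ∧ IsIntegralHom (m ≫ v.c.chart.ν ≫ s)

/-- The equivalence relation generated by adjacency. -/
def Conn {t : T ⟶ Spec (.of k)} : Vert s t → Vert s t → Prop := Relation.EqvGen Edge

/-- `f` lifts to the chart of `v`, compatibly with the maps to the field of constants. -/
def HasClass {t : T ⟶ Spec (.of k)} (f : T ⟶ X) (v : Vert s t) : Prop :=
  ∃ g : T ⟶ v.c.chart.C, g ≫ v.c.chart.ν = f ∧ g ≫ v.c.chart.p = v.a

theorem Conn.map {t : T ⟶ Spec (.of k)} {v v' : Vert s t} (h : Conn v v') (g : T' ⟶ T) :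
    Conn (v.map g) (v'.map g) := by
  induction h with
  | rel v v' h =>
    obtain ⟨M, _, m, m', j, h1, h2, h3, h4⟩ := h
    exact .rel _ _ ⟨M, _, m, m', g ≫ j, h1,
      (congrArg (g ≫ ·) h2).trans (Category.assoc _ _ _).symm,
      (congrArg (g ≫ ·) h3).trans (Category.assoc _ _ _).symm, h4⟩
  | refl => exact .refl _
  | symm _ _ _ ih => exact .symm _ _ ih
  | trans _ _ _ _ _ ih ih' => exact .trans _ _ _ ih ih'

theorem HasClass.map {t : T ⟶ Spec (.of k)} {f : T ⟶ X} {v : Vert s t} (h : HasClass f v)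
    (g : T' ⟶ T) : HasClass (g ≫ f) (v.map g) := by
  obtain ⟨a, h1, h2⟩ := h
  exact ⟨g ≫ a, (Category.assoc _ _ _).trans (congrArg (g ≫ ·) h1),
    (Category.assoc _ _ _).trans (congrArg (g ≫ ·) h2)⟩

theorem HasClass.comp_eq {t : T ⟶ Spec (.of k)} {f : T ⟶ X} {v : Vert s t} (h : HasClass f v) :
    f ≫ s = t := by
  obtain ⟨a, h1, h2⟩ := h
  refine Eq.trans ?_ v.w
  rw [← h1, ← h2, Category.assoc, Category.assoc, ← Chart.comm]

/-- Vertices over the generic point of a locally normal scheme extend. -/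
theorem Vert.exists_extension [IsIntegral T] (hT : LocallyNormal T) {t : T ⟶ Spec (.of k)}
    (v : Vert s (genericInclusion T ≫ t)) : ∃ w : Vert s t, w.map (genericInclusion T) = v := by
  obtain ⟨c, a, h⟩ := v
  obtain ⟨σ, h1, h2⟩ := exists_lift_of_locallyNormal hT c.chart.π t a h
  subst h2
  exact ⟨⟨c, σ, h1⟩, rfl⟩

theorem Vert.map_injective [PerfectField k] [IsIntegral T] [Nonempty T'] {t : T ⟶ Spec (.of k)}
    (g : T' ⟶ T) {v w : Vert s t} (h : v.map g = w.map g) : v = w := by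
  obtain ⟨c, a, ha⟩ := v
  obtain ⟨c', a', ha'⟩ := w
  obtain rfl : c = c' := congrArg (·.c) h
  have h2 : g ≫ a = g ≫ a' := by
    injection h with _ h
  obtain rfl := hom_spec_ext c.chart.π a a' (ha.trans ha'.symm) g h2
  rfl

/-- Each intermediate vertex extends because `T` is normal. For an edge, `Spec M` is integral over
`k`, so the generic map to `Spec M` extends as well. The identities between constants hold
generically and therefore on `T`, by `hom_spec_ext`. -/
theorem Conn.of_map_genericInclusion [PerfectField k] [IsIntegral T] (hT : LocallyNormal T)
    {t : T ⟶ Spec (.of k)} {v w : Vert s t}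
    (h : Conn (v.map (genericInclusion T)) (w.map (genericInclusion T))) : Conn v w := by
  obtain ⟨v', hv⟩ : ∃ v', v' = v.map (genericInclusion T) := ⟨_, rfl⟩
  obtain ⟨w', hw⟩ : ∃ w', w' = w.map (genericInclusion T) := ⟨_, rfl⟩
  rw [← hv, ← hw] at h
  induction h generalizing v w with
  | rel v' w' h =>
    subst hv hw
    obtain ⟨c, a, ha⟩ := v
    obtain ⟨c', a', ha'⟩ := w
    obtain ⟨M, _, (m : _ ⟶ c.chart.C), (m' : _ ⟶ c'.chart.C), j, h1, h2, h3, h4⟩ := h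
    replace h1 : m ≫ c.chart.ν = m' ≫ c'.chart.ν := h1
    replace h2 : genericInclusion T ≫ a = j ≫ m ≫ c.chart.p := h2
    replace h3 : genericInclusion T ≫ a' = j ≫ m' ≫ c'.chart.p := h3
    replace h4 : IsIntegralHom (m ≫ c.chart.ν ≫ s) := h4
    have e1 : (m ≫ c.chart.p) ≫ c.chart.π = m ≫ c.chart.ν ≫ s := by
      rw [Category.assoc, Chart.comm]
    have e2 : (m' ≫ c'.chart.p) ≫ c'.chart.π = m ≫ c.chart.ν ≫ s := by
      rw [Category.assoc, Chart.comm, ← Category.assoc, ← Category.assoc, h1]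
    obtain ⟨σ, h5, h6⟩ := exists_lift_of_locallyNormal hT (m ≫ c.chart.ν ≫ s) t j (by
      rw [← e1, ← Category.assoc, ← h2, Category.assoc, ha])
    refine .rel _ _ ⟨M, _, m, m', σ, h1, ?_, ?_, h4⟩
    · refine hom_spec_ext c.chart.π _ _ ?_ (genericInclusion T) ?_
      · rw [Category.assoc, e1, h5, ha]
      · rw [reassoc_of% h6, h2]
    · refine hom_spec_ext c'.chart.π _ _ ?_ (genericInclusion T) ?_
      · rw [Category.assoc, e2, h5, ha']
      · rw [reassoc_of% h6, h3]
  | refl =>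
    rw [Vert.map_injective _ (hv.symm.trans hw)]
    exact .refl _
  | symm _ _ _ ih => exact .symm _ _ (ih hw hv)
  | trans _ x _ _ _ ih ih' =>
    obtain ⟨y, hy⟩ := Vert.exists_extension hT x
    exact .trans _ _ _ (ih hv hy.symm) (ih' hy.symm hw)

/-- If the generic value `z` of `f` is closed, a lift of `f` to a chart factors through the residue
field of a closed point over `z`, and this field gives an edge to the vertex of the chart of `z`. If
not, the chart is forced to be the normalization at the generic value, and the lift to it is unique.
-/
theorem HasClass.conn [IsIntegral T] (hX : topologicalKrullDim X = 1) {t : T ⟶ Spec (.of k)}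
    {f : T ⟶ X} {v w : Vert s t} (hv : HasClass f v) (hw : HasClass f w) : Conn v w := by
  by_cases hz : IsClosed {f (genericPoint T)}
  · have hft := hv.comp_eq
    obtain ⟨b, hb⟩ := exists_fac_of_genericPoint f hz rfl
    let x : Vert s t := ⟨.closed _ hz, b,
      (Category.assoc _ _ _).symm.trans ((congrArg (· ≫ s) hb).trans hft)⟩
    have key : ∀ v : Vert s t, HasClass f v → Conn v x := by
      rintro ⟨c, a, ha⟩ ⟨g, hg, hga⟩
      replace hg : g ≫ c.chart.ν = f := hg
      replace hga : g ≫ c.chart.p = a := hga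
      let e := g (genericPoint T)
      have he : c.chart.ν e = f (genericPoint T) := by
        rw [← hg]
        rfl
      have hec : IsClosed {e} := isClosed_singleton_of_isClosed_apply c.chart.ν (he ▸ hz)
      obtain ⟨j, hj⟩ := exists_fac_of_genericPoint g hec rfl
      have := isClosed_singleton_iff_isClosedImmersion.mp hec
      obtain ⟨m', hm'⟩ := exists_fac_of_forall_apply_eq
        (c.chart.C.fromSpecResidueField e ≫ c.chart.ν) hz (fun y ↦ by
          rw [Scheme.Hom.comp_apply, Scheme.fromSpecResidueField_apply]
          exact he)
      have hfin := isFinite_of_isClosed_singleton s hz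
      have hint : IsIntegralHom m' := by
        have : IsIntegralHom (m' ≫ X.fromSpecResidueField (f (genericPoint T))) := by
          rw [hm']
          infer_instance
        exact .of_comp m' (X.fromSpecResidueField (f (genericPoint T)))
      refine .rel _ _ ⟨c.chart.C.residueField e, inferInstance, c.chart.C.fromSpecResidueField e,
        m', j, hm'.symm, ?_, ?_, ?_⟩
      · exact hga.symm.trans ((congrArg (· ≫ c.chart.p) hj.symm).trans (Category.assoc _ _ _))
      · change b = j ≫ m' ≫ 𝟙 _
        rw [Category.comp_id, ← cancel_mono (X.fromSpecResidueField (f (genericPoint T))), hb,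
          Category.assoc, hm', ← Category.assoc, hj, hg]
      · change IsIntegralHom (c.chart.C.fromSpecResidueField e ≫ c.chart.ν ≫ s)
        rw [← Category.assoc, ← hm', Category.assoc]
        infer_instance
    exact .trans _ _ _ (key v hv) (.symm _ _ (key w hw))
  · obtain ⟨c, a, ha⟩ := v
    obtain ⟨c', a', ha'⟩ := w
    obtain ⟨g, hg, hga⟩ := hv
    obtain ⟨g', hg', hga'⟩ := hw
    -- A closed chart takes only closed values. A rational chart takes only specializations of its
    -- point `ζ`, and a non-closed one is `ζ` itself.
    have key : ∀ (c : Adm s) (g : T ⟶ c.chart.C), g ≫ c.chart.ν = f →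
        ∃ hr, c = .rational (f (genericPoint T)) hz hr := by
      intro c g hg
      cases c with
      | closed z hz' =>
        refine absurd ?_ hz
        rw [← hg, Scheme.Hom.comp_apply]
        have : (Adm.chart s (.closed z hz')).ν (g (genericPoint T)) = z :=
          Scheme.fromSpecResidueField_apply _ _
        rwa [this]
      | rational ζ hζ hr =>
        have : ζ = f (genericPoint T) := by
          refine eq_of_specializes_of_not_isClosed hX hz ?_
          rw [← hg]
          exact normalizationAtHom_specializes ζ (g (genericPoint T))
        subst this
        exact ⟨hr, rfl⟩
    obtain ⟨hr, rfl⟩ := key c g hg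
    obtain ⟨_, rfl⟩ := key c' g' hg'
    obtain rfl : g = g' := normalizationAt_hom_ext g g' (hg.trans hg'.symm)
      (congr($hg (genericPoint T)))
    obtain rfl : a = a' := hga.symm.trans hga'
    exact .refl _

/-- Maps whose generic value is closed or rational have a class. -/
theorem exists_hasClass [IsIntegral T] (hT : LocallyNormal T) (f : T ⟶ X)
    (h : IsClosed {f (genericPoint T)} ∨ IsRationalPoint s (f (genericPoint T))) :
    ∃ v : Vert s (f ≫ s), HasClass f v := by
  by_cases hz : IsClosed {f (genericPoint T)}
  · obtain ⟨b, hb⟩ := exists_fac_of_genericPoint f hz rfl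
    exact ⟨⟨.closed _ hz, b, (Category.assoc _ _ _).symm.trans
      (congrArg (· ≫ s) hb)⟩, b, hb, Category.comp_id _⟩
  · obtain ⟨g, hg⟩ := exists_lift_normalizationAt hT f rfl
    refine ⟨⟨.rational _ hz (h.resolve_left hz), g ≫ normalizationAtConstants s _, ?_⟩, g, hg, rfl⟩
    have := (normalizationChart s (f (genericPoint T))).comm
    refine (Category.assoc _ _ _).trans ((congrArg (g ≫ ·) this).trans
      ((Category.assoc _ _ _).symm.trans (congrArg (· ≫ s) hg)))

/-- Values in a rational chart are specializations of its point, so a non-closed value is that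
rational point. In contrapositive form this says that a map of the third kind has no class. -/
theorem HasClass.isClosed_or_isRationalPoint [Nonempty T] (hX : topologicalKrullDim X = 1)
    {t : T ⟶ Spec (.of k)} {f : T ⟶ X} {v : Vert s t} (hv : HasClass f v) (y : T) :
    IsClosed {f y} ∨ IsRationalPoint s (f y) := by
  obtain ⟨c, a, ha⟩ := v
  obtain ⟨g, hg, hga⟩ := hv
  by_cases hz : IsClosed {f y}
  · exact .inl hz
  refine .inr ?_
  cases c with
  | closed z hz' =>
    refine absurd ?_ hz
    rw [← hg, Scheme.Hom.comp_apply]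
    have : (Adm.chart s (.closed z hz')).ν (g y) = z := Scheme.fromSpecResidueField_apply _ _
    rwa [this]
  | rational ζ hζ hr =>
    have : ζ = f y := by
      refine eq_of_specializes_of_not_isClosed hX hz ?_
      rw [← hg]
      exact normalizationAtHom_specializes ζ (g y)
    rwa [← this]

end

/-! ### Morphisms out of an affine line -/

section

variable {k : Type u} [Field k] {X : Scheme.{u}} {s : X ⟶ Spec (.of k)}

/-- The affine line over a scheme. -/
abbrev Line (V : Scheme.{u}) : Scheme.{u} := 𝔸(PUnit.{u + 1}; V)

/-- Both sides agree along the section `σ`, which suffices by `hom_spec_ext`: algebraic constants do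
not move along `𝔸¹`. -/
theorem eq_comp_of_line [PerfectField k] {L : Type u} [Field L] {V : Scheme.{u}} [IsIntegral V]
    (π : Spec (.of L) ⟶ Spec (.of k)) [IsIntegralHom π] {t : V ⟶ Spec (.of k)}
    (a : (Line V) ⟶ Spec (.of L)) (ha : a ≫ π = ((Line V) ↘ V) ≫ t) (σ : V ⟶ Line V)
    (hσ : σ ≫ ((Line V) ↘ V) = 𝟙 V) : a = ((Line V) ↘ V) ≫ σ ≫ a := by
  refine hom_spec_ext π _ _ ?_ σ ?_
  · rw [Category.assoc, Category.assoc, ha, reassoc_of% hσ]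
  · rw [reassoc_of% hσ]

/-- A map from a line that is generically closed is constant. -/
theorem eq_comp_of_isClosed [PerfectField k] [IsProper s] {V : Scheme.{u}} [IsIntegral V]
    {t : V ⟶ Spec (.of k)} (f : (Line V) ⟶ X) (hf : f ≫ s = ((Line V) ↘ V) ≫ t) (σ : V ⟶ Line V)
    (hσ : σ ≫ ((Line V) ↘ V) = 𝟙 V) (hc : IsClosed {f (genericPoint (Line V))}) :
    f = ((Line V) ↘ V) ≫ σ ≫ f := by
  let L := X.residueField (f (genericPoint (Line V)))
  let ρ : Spec (.of L) ⟶ X := X.fromSpecResidueField (f (genericPoint (Line V)))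
  obtain ⟨b, hb⟩ : ∃ b : Line V ⟶ Spec (.of L), b ≫ ρ = f := exists_fac_of_genericPoint f hc rfl
  have : IsFinite (ρ ≫ s) := isFinite_of_isClosed_singleton s hc
  have := eq_comp_of_line (ρ ≫ s) b (by rw [← Category.assoc, hb, hf]) σ hσ
  conv_lhs => rw [← hb, this, Category.assoc, Category.assoc, hb]

/-- A map from a line that is generically neither closed nor rational is constant. -/
theorem eq_comp_of_not_isRationalPoint [PerfectField k] [IsProper s]
    (hX : topologicalKrullDim X = 1) {V : Scheme.{u}} [IsIntegral V] {t : V ⟶ Spec (.of k)}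
    [LocallyOfFiniteType t] (H : (Line V) ⟶ X) (hH : H ≫ s = ((Line V) ↘ V) ≫ t) (σ : V ⟶ Line V)
    (hσ : σ ≫ ((Line V) ↘ V) = 𝟙 V)
    (h' : ¬ IsRationalPoint s (H (genericPoint (Line V)))) : H = ((Line V) ↘ V) ≫ σ ≫ H := by
  have : LocallyOfFiniteType (((Line V) ↘ V) ≫ t) := inferInstance
  have : JacobsonSpace (Line V) :=
    LocallyOfFiniteType.jacobsonSpace (((Line V) ↘ V) ≫ t)
  have : JacobsonSpace V := LocallyOfFiniteType.jacobsonSpace t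
  -- Closed points are dense since `Line V` is Jacobson, and they lie over closed points `w` of `V`.
  -- So it is enough to treat the line over `κ(w)`, a finite extension of `k`.
  refine ext_of_fromSpecResidueField_eq H _ s (closedPoints (Line V)) ?_ ?_ ?_
  · exact dense_iff_closure_eq.mpr closure_closedPoints
  · intro y hy
    let w := ((Line V) ↘ V) y
    have hw : IsClosed {w} := ((Line V) ↘ V).closePoints_subset_preimage_closedPoints hy
    let B := Spec (.of (V.residueField w))
    let q : B ⟶ V := V.fromSpecResidueField w
    let τ : B ⟶ Line B := (AffineSpace.isPullback_map q).lift (q ≫ σ) (𝟙 _) (by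
      rw [Category.assoc, hσ, Category.comp_id, Category.id_comp])
    have hτ : τ ≫ AffineSpace.map PUnit.{u + 1} q = q ≫ σ :=
      (AffineSpace.isPullback_map q).lift_fst _ _ _
    have hτ' : τ ≫ ((Line B) ↘ B) = 𝟙 B := (AffineSpace.isPullback_map q).lift_snd _ _ _
    suffices hmain : AffineSpace.map PUnit.{u + 1} q ≫ H = ((Line B) ↘ B) ≫ q ≫ σ ≫ H by
      let r : Spec ((Line V).residueField y) ⟶ Line B :=
        (AffineSpace.isPullback_map q).lift ((Line V).fromSpecResidueField y)
          (Spec.map (((Line V) ↘ V).residueFieldMap y))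
          (Scheme.Hom.SpecMap_residueFieldMap_fromSpecResidueField _ _).symm
      have hr : r ≫ AffineSpace.map PUnit.{u + 1} q = (Line V).fromSpecResidueField y :=
        (AffineSpace.isPullback_map q).lift_fst _ _ _
      rw [← hr, Category.assoc, hmain, Category.assoc, AffineSpace.map_over_assoc]
    have hfin : IsFinite (q ≫ t) := isFinite_of_isClosed_singleton t hw
    let f := AffineSpace.map PUnit.{u + 1} q ≫ H
    have hf : f ≫ s = ((Line B) ↘ B) ≫ q ≫ t := by
      rw [Category.assoc, hH, AffineSpace.map_over_assoc]
    have : IsIntegral B := inferInstanceAs (IsIntegral (Spec (.of (V.residueField w))))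
    by_cases hc : IsClosed {f (genericPoint (Line B))}
    · have h2 := eq_comp_of_isClosed f hf τ hτ' hc
      rw [← reassoc_of% hτ]
      exact h2
    -- A non-closed generic value on this fibre equals the generic value of `H` by dimension one,
    -- and the fibre then exhibits it as a rational point.
    · refine absurd ?_ h'
      have h1 : H (genericPoint (Line V)) = f (genericPoint (Line B)) := by
        refine eq_of_specializes_of_not_isClosed hX hc ?_
        exact (genericPoint_specializes _).map H.continuous
      rw [h1]
      exact ⟨V.residueField w, inferInstance, q ≫ t, hfin, f, hf, rfl⟩
  · rw [Category.assoc, Category.assoc, hH, reassoc_of% hσ]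

/-- Two maps agree or have connected classes. -/
def Rel [IsProper s] {T : Scheme.{u}} (t : T ⟶ Spec (.of k)) (f g : T ⟶ X) : Prop :=
  f = g ∨ ∃ v w : Vert s t, HasClass f v ∧ HasClass g w ∧ Conn v w

theorem Rel.symm [IsProper s] {T : Scheme.{u}} {t : T ⟶ Spec (.of k)} {f g : T ⟶ X}
    (h : Rel (s := s) t f g) : Rel (s := s) t g f := by
  obtain rfl | ⟨v, w, hv, hw, hc⟩ := h
  · exact .inl rfl
  · exact .inr ⟨w, v, hw, hv, .symm _ _ hc⟩

theorem Rel.trans [IsProper s] (hX : topologicalKrullDim X = 1) {T : Scheme.{u}} [IsIntegral T]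
    {t : T ⟶ Spec (.of k)} {f g g' : T ⟶ X} (h : Rel (s := s) t f g) (h' : Rel (s := s) t g g') :
    Rel (s := s) t f g' := by
  obtain rfl | ⟨v, w, hv, hw, hc⟩ := h
  · exact h'
  obtain rfl | ⟨v', w', hv', hw', hc'⟩ := h'
  · exact .inr ⟨v, w, hv, hw, hc⟩
  · exact .inr ⟨v, w', hv, hw', .trans _ _ _ hc (.trans _ _ _ (hw.conn hX hv') hc')⟩

/-- The two ends of a homotopy agree or have a common class. -/
theorem rel_of_line [PerfectField k] [IsProper s] (hX : topologicalKrullDim X = 1) {V : Scheme.{u}}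
    [IsIntegral V] {t : V ⟶ Spec (.of k)} [Smooth t] (H : (Line V) ⟶ X)
    (hH : H ≫ s = ((Line V) ↘ V) ≫ t) (σ σ' : V ⟶ Line V) (hσ : σ ≫ ((Line V) ↘ V) = 𝟙 V)
    (hσ' : σ' ≫ ((Line V) ↘ V) = 𝟙 V) : Rel (s := s) t (σ ≫ H) (σ' ≫ H) := by
  by_cases h : IsClosed {H (genericPoint (Line V))} ∨ IsRationalPoint s (H (genericPoint (Line V)))
  -- The homotopy lifts to a chart because `Line V` is normal. Its constants are pulled back from
  -- `V`, so the two ends share one vertex.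
  · have hn : LocallyNormal (Line V) := locallyNormal_of_smooth (((Line V) ↘ V) ≫ t)
    obtain ⟨v, hv⟩ := exists_hasClass (s := s) hn H h
    obtain ⟨g, hg, hga⟩ := hv
    have ha := eq_comp_of_line v.c.chart.π v.a (v.w.trans hH) σ hσ
    have e (τ : V ⟶ Line V) (hτ : τ ≫ ((Line V) ↘ V) = 𝟙 V) : τ ≫ v.a = σ ≫ v.a := by
      rw [ha, reassoc_of% hτ, reassoc_of% hσ]
    let w : Vert s t := ⟨v.c, σ ≫ v.a, by
      rw [Category.assoc, v.w, hH, reassoc_of% hσ]⟩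
    refine .inr ⟨w, w, ⟨σ ≫ g, ?_, ?_⟩, ⟨σ' ≫ g, ?_, ?_⟩, .refl _⟩
    · exact (Category.assoc _ _ _).trans (congrArg (σ ≫ ·) hg)
    · exact (Category.assoc _ _ _).trans (congrArg (σ ≫ ·) hga)
    · exact (Category.assoc _ _ _).trans (congrArg (σ' ≫ ·) hg)
    · exact (Category.assoc _ _ _).trans ((congrArg (σ' ≫ ·) hga).trans (e σ' hσ'))
  · rw [not_or] at h
    have := eq_comp_of_not_isRationalPoint hX H hH σ hσ h.2
    refine .inl ?_
    rw [this, reassoc_of% hσ, reassoc_of% hσ']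

end

/-! ### Rational function fields, Lüroth's theorem and Möbius transformations -/

section

open TensorProduct in
/-- The tensor product of a finite separable extension with an extension in which the base field is
algebraically closed is a field. -/
theorem isField_tensorProduct {l F K : Type*} [Field l] [Field F] [Field K] [Algebra l F]
    [Algebra l K] [FiniteDimensional l K] [Algebra.IsSeparable l K]
    (hl : ∀ x : F, IsIntegral l x → x ∈ (algebraMap l F).range) : IsField (K ⊗[l] F) := by
  obtain ⟨θ, hθ⟩ := Field.exists_primitive_element l K
  have hint : IsIntegral l θ := Algebra.IsIntegral.isIntegral θ
  let p := minpoly l θ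
  have hp : p.Monic := minpoly.monic hint
  have hirr : Irreducible (p.map (algebraMap l F)) := by
    have hpi := minpoly.irreducible hint
    have hp1 : p ≠ 1 := minpoly.ne_one l θ
    have hm : (p.map (algebraMap l F)).Monic := hp.map _
    refine (hm.irreducible_iff_lt_natDegree_lt fun h ↦ hp1 ?_).mpr fun q hq hd hqp ↦ ?_
    · exact Polynomial.map_injective _ (algebraMap l F).injective (by rw [h, Polynomial.map_one])
    -- The coefficients of a monic factor of `p` are integral over `l`, hence lie in `l`; the
    -- factorization already exists over `l`.
    · have hl : q ∈ Polynomial.lifts (algebraMap l F) := by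
        rw [Polynomial.lifts_iff_coeff_lifts]
        exact fun i ↦ hl _ (Polynomial.isIntegral_coeff_of_dvd p q hp hq hqp i)
      obtain ⟨q, rfl, hdeg, hqm⟩ := Polynomial.lifts_and_natDegree_eq_and_monic hl hq
      rw [Polynomial.map_dvd_map _ (algebraMap l F).injective hqm] at hqp
      rw [Polynomial.natDegree_map, Polynomial.natDegree_map] at hd
      exact (hp.irreducible_iff_lt_natDegree_lt hp1).mp hpi q hqm hd hqp
  have := Fact.mk hirr
  let ι : F →+* K ⊗[l] F := (Algebra.TensorProduct.includeRight : F →ₐ[l] K ⊗[l] F).toRingHom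
  have h1 : ι.comp (algebraMap l F) =
      (Algebra.TensorProduct.includeLeftRingHom : K →+* K ⊗[l] F).comp (algebraMap l K) := by
    ext x
    exact (Algebra.TensorProduct.includeRight : F →ₐ[l] K ⊗[l] F).commutes x
  let φ : AdjoinRoot (p.map (algebraMap l F)) →+* K ⊗[l] F := AdjoinRoot.lift ι (θ ⊗ₜ 1) (by
    rw [Polynomial.eval₂_map, h1]
    exact (Polynomial.hom_eval₂ p (algebraMap l K) Algebra.TensorProduct.includeLeftRingHom
      θ).symm.trans (by
        rw [← Polynomial.aeval_def, minpoly.aeval, map_zero]))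
  have hφ : Function.Surjective φ := by
    intro z
    induction z with
    | zero => exact ⟨0, map_zero _⟩
    | add a b ha hb =>
      obtain ⟨a, rfl⟩ := ha
      obtain ⟨b, rfl⟩ := hb
      exact ⟨a + b, map_add _ _ _⟩
    | tmul c f =>
      have hc : c ∈ Algebra.adjoin l {θ} := by
        have h := IntermediateField.adjoin_simple_toSubalgebra_of_isAlgebraic hint.isAlgebraic
        rw [← h, hθ]
        trivial
      rw [Algebra.adjoin_singleton_eq_range_aeval] at hc
      obtain ⟨q, rfl⟩ := hc
      refine ⟨AdjoinRoot.mk _ (q.map (algebraMap l F) * Polynomial.C f), ?_⟩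
      rw [AdjoinRoot.lift_mk, Polynomial.eval₂_mul, Polynomial.eval₂_C, Polynomial.eval₂_map, h1]
      refine (congrArg (· * ι f) (Polynomial.hom_eval₂ q (algebraMap l K)
        Algebra.TensorProduct.includeLeftRingHom θ).symm).trans ?_
      change (Polynomial.eval₂ (algebraMap l K) θ q ⊗ₜ[l] (1 : F)) * ((1 : K) ⊗ₜ[l] f) = _
      rw [Algebra.TensorProduct.tmul_mul_tmul, mul_one, one_mul]
      rfl
  exact MulEquiv.isField (Field.toIsField (AdjoinRoot (p.map (algebraMap l F))))
    (RingEquiv.ofBijective φ ⟨φ.injective, hφ⟩).symm.toMulEquiv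

theorem ratFunc_mem_range_of_isIntegral {K : Type*} [Field K] {x : RatFunc K}
    (hx : IsIntegral K x) : ∃ c, x = RatFunc.C c := by
  by_contra h
  exact RatFunc.transcendental_of_ne_C x h hx.isAlgebraic

/-- An element generating a rational function field is a Möbius transform of the variable. -/
theorem exists_mobius_of_adjoin_eq_top {K : Type*} [Field K] {x : RatFunc K}
    (hx : IntermediateField.adjoin K {x} = ⊤) :
    ∃ α β γ δ : K, α * δ - β * γ ≠ 0 ∧
      (RatFunc.C γ * RatFunc.X + RatFunc.C δ) * x = RatFunc.C α * RatFunc.X + RatFunc.C β := by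
  -- The degree of `K(t)` over `K(x)` is the larger of the degrees of numerator and denominator, so
  -- that maximum is `1`.
  have h1 := RatFunc.finrank_eq_max_natDegree x
  rw [hx, IntermediateField.finrank_top] at h1
  have hn := Polynomial.eq_X_add_C_of_natDegree_le_one (h1 ▸ le_max_left _ _ : x.num.natDegree ≤ 1)
  have hd := Polynomial.eq_X_add_C_of_natDegree_le_one
    (h1 ▸ le_max_right _ _ : x.denom.natDegree ≤ 1)
  refine ⟨x.num.coeff 1, x.num.coeff 0, x.denom.coeff 1, x.denom.coeff 0, fun h ↦ ?_, ?_⟩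
  -- With zero determinant the numerator and denominator would be proportional, which contradicts
  -- their coprimality unless both are constant.
  · have e : Polynomial.C (x.num.coeff 1) * x.denom = Polynomial.C (x.denom.coeff 1) * x.num := by
      have h' : Polynomial.C (x.num.coeff 1) * Polynomial.C (x.denom.coeff 0) -
          Polynomial.C (x.num.coeff 0) * Polynomial.C (x.denom.coeff 1) = 0 := by
        rw [← map_mul, ← map_mul, ← map_sub, h, map_zero]
      conv_lhs => rw [hd]
      conv_rhs => rw [hn]
      linear_combination h'
    obtain ⟨u, v, huv⟩ := x.isCoprime_num_denom
    have key : ∀ (p : Polynomial K), IsUnit p → p.coeff 1 = 0 := fun p hp ↦ by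
      obtain ⟨c, -, rfl⟩ := Polynomial.isUnit_iff.mp hp
      exact Polynomial.coeff_C_of_ne_zero one_ne_zero
    by_cases hα : x.num.coeff 1 = 0
    · by_cases hγ : x.denom.coeff 1 = 0
      · rw [hα, map_zero, zero_mul, zero_add] at hn
        rw [hγ, map_zero, zero_mul, zero_add] at hd
        rw [hn, hd, Polynomial.natDegree_C, Polynomial.natDegree_C] at h1
        exact one_ne_zero h1
      · rw [hα, map_zero, zero_mul] at e
        have : x.num = 0 := (mul_eq_zero.mp e.symm).resolve_left (Polynomial.C_ne_zero.mpr hγ)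
        rw [this, mul_zero, zero_add] at huv
        exact hγ (key _ (IsUnit.of_mul_eq_one v (by rw [mul_comm, huv])))
    · refine hα (key _ (isUnit_of_dvd_unit
        ⟨Polynomial.C (x.num.coeff 1) * u + v * Polynomial.C (x.denom.coeff 1), ?_⟩
        (Polynomial.isUnit_C.mpr (IsUnit.mk0 _ hα))))
      linear_combination -Polynomial.C (x.num.coeff 1) * huv + v * e
  · have hne : algebraMap (Polynomial K) (RatFunc K) x.denom ≠ 0 :=
      RatFunc.algebraMap_ne_zero x.denom_ne_zero
    have e : algebraMap (Polynomial K) (RatFunc K) x.denom * x = algebraMap _ _ x.num := by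
      rw [mul_comm]
      exact ((div_eq_iff hne).mp (RatFunc.num_div_denom x)).symm
    have hn' := congrArg (algebraMap (Polynomial K) (RatFunc K)) hn
    have hd' := congrArg (algebraMap (Polynomial K) (RatFunc K)) hd
    simp only [map_add, map_mul, RatFunc.algebraMap_C, RatFunc.algebraMap_X] at hn' hd'
    rw [← hn', ← hd', e]

open TensorProduct

variable {l F K : Type*} [Field l] [Field F] [Field K] [Algebra l F] [Algebra l K]

/-- The automorphism of `K ⊗ F` induced by an automorphism of `K`. -/
abbrev galAct (B : Type*) [CommRing B] [Algebra l B] (σ : K ≃ₐ[l] K) : K ⊗[l] B ≃ₐ[l] K ⊗[l] B :=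
  Algebra.TensorProduct.congr σ AlgEquiv.refl

/-- Transported to `K(t)`, the Galois action is a `σ`-semilinear automorphism `τ`. Since `τ`
preserves `K`, the element `τ X` still generates `K(t)` over `K`, hence is a Möbius transform of
`X`. -/
theorem exists_mobius (ψ : RatFunc K ≃ₐ[K] K ⊗[l] F) (σ : K ≃ₐ[l] K) :
    ∃ α β γ δ : K, α * δ - β * γ ≠ 0 ∧
      (γ ⊗ₜ 1 * ψ RatFunc.X + δ ⊗ₜ 1) * galAct F σ (ψ RatFunc.X) =
        α ⊗ₜ 1 * ψ RatFunc.X + β ⊗ₜ 1 := by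
  let τ : RatFunc K ≃+* RatFunc K :=
    ψ.toRingEquiv.trans ((galAct F σ).toRingEquiv.trans ψ.symm.toRingEquiv)
  have hC (c : K) : ψ (RatFunc.C c) = c ⊗ₜ 1 := ψ.commutes c
  have hτ (r) : ψ (τ r) = galAct F σ (ψ r) := ψ.apply_symm_apply _
  have hτC (c : K) : τ (RatFunc.C c) = RatFunc.C (σ c) := by
    apply ψ.injective
    rw [hτ, hC, hC]
    simp
  have htop : IntermediateField.adjoin K {τ RatFunc.X} = ⊤ := by
    rw [eq_top_iff]
    rintro y -
    obtain ⟨r, rfl⟩ := τ.surjective y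
    have hp (p : Polynomial K) : τ (algebraMap _ _ p) ∈ IntermediateField.adjoin K {τ RatFunc.X} := by
      induction p using Polynomial.induction_on' with
      | add p q hp hq =>
        rw [map_add, map_add]
        exact add_mem hp hq
      | monomial n a =>
        rw [← Polynomial.C_mul_X_pow_eq_monomial, map_mul, map_pow, RatFunc.algebraMap_C,
          RatFunc.algebraMap_X, map_mul, map_pow, hτC]
        exact mul_mem (IntermediateField.algebraMap_mem _ (σ a))
          (pow_mem (IntermediateField.mem_adjoin_simple_self K _) n)
    rw [← RatFunc.num_div_denom r, map_div₀]
    exact div_mem (hp _) (hp _)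
  obtain ⟨α, β, γ, δ, h, h'⟩ := exists_mobius_of_adjoin_eq_top htop
  refine ⟨α, β, γ, δ, h, ?_⟩
  have := congrArg ψ h'
  rw [map_mul, map_add, map_add, map_mul, map_mul, hτ, hC, hC, hC, hC] at this
  exact this

theorem exists_algEquiv_ratFunc {K : Type*} [Field K] (f : RatFunc K) (hf : ∀ c, f ≠ RatFunc.C c)
    (hX : RatFunc.X ∈ IntermediateField.adjoin K {f}) :
    ∃ μ : RatFunc K ≃ₐ[K] RatFunc K, μ RatFunc.X = f := by
  have htop : IntermediateField.adjoin K {f} = ⊤ := by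
    rw [eq_top_iff]
    exact (ge_of_eq RatFunc.adjoin_X).trans (IntermediateField.adjoin_simple_le_iff.mpr hX)
  refine ⟨(RatFunc.algEquivOfTranscendental f (RatFunc.transcendental_of_ne_C f
    fun ⟨c, hc⟩ ↦ hf c hc)).trans
      ((IntermediateField.equivOfEq htop).trans IntermediateField.topEquiv), ?_⟩
  simp

/-- The ring `K ⊗ F` is a field, embedded by `J` in `K(t)` with non-constant image, so Lüroth's
theorem makes it purely transcendental. The polynomials `n`, `d` record that the chosen coordinate
has a pole at `t = 0`; thus the origin of the given line will correspond to `∞`. -/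
theorem exists_ratFunc_equiv [FiniteDimensional l K] [Algebra.IsSeparable l K]
    (hl : ∀ x : F, IsIntegral l x → x ∈ (algebraMap l F).range) (J : K ⊗[l] F →ₐ[K] RatFunc K)
    (hJ : ∃ x, ∀ c, J x ≠ RatFunc.C c) :
    ∃ ψ : RatFunc K ≃ₐ[K] K ⊗[l] F, ∃ n d : Polynomial K, n.eval 0 = 0 ∧ d.eval 0 ≠ 0 ∧
      J (ψ RatFunc.X⁻¹) * algebraMap _ _ d = algebraMap _ _ n := by
  let := (isField_tensorProduct (K := K) hl).toField
  let e := AlgEquiv.ofInjectiveField J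
  have hbot : J.fieldRange ≠ ⊥ := by
    intro h
    obtain ⟨x, hx⟩ := hJ
    have : J x ∈ J.fieldRange := ⟨x, rfl⟩
    rw [h, IntermediateField.mem_bot] at this
    obtain ⟨c, hc⟩ := this
    exact hx c hc.symm
  let g := RatFunc.Luroth.generator J.fieldRange
  let e' := (RatFunc.Luroth.algEquiv hbot).trans e.symm
  have he (r) : J (e' r) = (RatFunc.Luroth.algEquiv hbot r).1 :=
    congrArg Subtype.val (e.apply_symm_apply (RatFunc.Luroth.algEquiv hbot r))
  have heX : J (e' RatFunc.X) = g := by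
    rw [he, RatFunc.Luroth.algEquiv_X]
  have hg : g * algebraMap _ _ g.denom = algebraMap _ _ g.num :=
    ((div_eq_iff (RatFunc.algebraMap_ne_zero g.denom_ne_zero)).mp (RatFunc.num_div_denom g)).symm
  by_cases h0 : g.denom.eval 0 = 0
  · refine ⟨e', g.denom, g.num, h0, fun h1 ↦ ?_, ?_⟩
    · obtain ⟨u, v, huv⟩ := g.isCoprime_num_denom
      have := congrArg (Polynomial.eval 0) huv
      rw [Polynomial.eval_add, Polynomial.eval_mul, Polynomial.eval_mul, h0, h1] at this
      simp at this
    · have hg0 : g ≠ 0 := RatFunc.Luroth.generator_ne_zero hbot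
      rw [map_inv₀, map_inv₀, heX, ← hg, inv_mul_cancel_left₀ hg0]
  -- When the generator `g` is regular at `0` with value `c`, the coordinate `1 / (g - c)` has the
  -- required pole.
  · let c := g.num.eval 0 / g.denom.eval 0
    have hX (d : K) : (RatFunc.X : RatFunc K) ≠ RatFunc.C d := fun h ↦
      RatFunc.transcendental_X (h ▸ isAlgebraic_algebraMap d)
    obtain ⟨μ, hμ⟩ := exists_algEquiv_ratFunc (RatFunc.X - RatFunc.C c)⁻¹ (fun d hd ↦ by
      refine hX (d⁻¹ + c) ?_
      rw [map_add, map_inv₀, ← hd, inv_inv, sub_add_cancel]) (by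
      have h1 := add_mem (inv_mem (IntermediateField.mem_adjoin_simple_self K
        (RatFunc.X - RatFunc.C c)⁻¹)) (IntermediateField.algebraMap_mem _ c)
      rw [inv_inv] at h1
      have h2 : RatFunc.X - RatFunc.C c + algebraMap K (RatFunc K) c = RatFunc.X :=
        sub_add_cancel _ _
      rwa [h2] at h1)
    refine ⟨μ.trans e', g.num - Polynomial.C c * g.denom, g.denom, ?_, h0, ?_⟩
    · simp [c, h0]
    · rw [AlgEquiv.trans_apply, map_inv₀, hμ, inv_inv, map_sub, map_sub, heX, sub_mul, hg]
      have : J (e' (RatFunc.C c)) = RatFunc.C c := (J.comp e'.toAlgHom).commutes c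
      rw [this, map_sub, map_mul, RatFunc.algebraMap_C]

end

/-! ### Gluing, and morphisms on the punctured plane -/

section

/-- Two morphisms on open subschemes that agree generically glue on the union. -/
theorem exists_glue {Y X U₀ U₁ Q : Scheme.{u}} [IsIntegral Y] [X.IsSeparated]
    (i₀ : U₀ ⟶ Y) (i₁ : U₁ ⟶ Y) [IsOpenImmersion i₀] [IsOpenImmersion i₁] (g₀ : U₀ ⟶ X)
    (g₁ : U₁ ⟶ X) (q₀ : Q ⟶ U₀) (q₁ : Q ⟶ U₁) (hq : q₀ ≫ i₀ = q₁ ≫ i₁)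
    [IsDominant (q₀ ≫ i₀)] (hg : q₀ ≫ g₀ = q₁ ≫ g₁) (W : Y.Opens)
    (hW : W = i₀.opensRange ⊔ i₁.opensRange) :
    ∃ Φ : W.toScheme ⟶ X,
      (∀ j₀ : U₀ ⟶ W, j₀ ≫ W.ι = i₀ → j₀ ≫ Φ = g₀) ∧
      (∀ j₁ : U₁ ⟶ W, j₁ ≫ W.ι = i₁ → j₁ ≫ Φ = g₁) := by
  subst hW
  let W : Y.Opens := i₀.opensRange ⊔ i₁.opensRange
  let U : Bool → Scheme.{u} := fun b ↦ bif b then U₁ else U₀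
  let i : ∀ b, U b ⟶ Y := fun b ↦ match b with | false => i₀ | true => i₁
  let g : ∀ b, U b ⟶ X := fun b ↦ match b with | false => g₀ | true => g₁
  let q : ∀ b, Q ⟶ U b := fun b ↦ match b with | false => q₀ | true => q₁
  have hi : ∀ b, IsOpenImmersion (i b) := by rintro (_ | _) <;> assumption
  have hr : ∀ b, Set.range (i b) ⊆ Set.range W.ι := by
    intro b
    rw [Scheme.Opens.range_ι]
    cases b
    · exact Set.subset_union_left
    · exact Set.subset_union_right
  let j : ∀ b, U b ⟶ W := fun b ↦ IsOpenImmersion.lift W.ι (i b) (hr b)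
  have hj : ∀ b, j b ≫ W.ι = i b := fun b ↦ IsOpenImmersion.lift_fac _ _ _
  have hjo : ∀ b, IsOpenImmersion (j b) := fun b ↦
    have : IsOpenImmersion (j b ≫ W.ι) := hj b ▸ hi b
    IsOpenImmersion.of_comp _ W.ι
  have hqi : ∀ b, q b ≫ i b = q₀ ≫ i₀ := by
    rintro (_ | _)
    · rfl
    · exact hq.symm
  have hqg : ∀ b, q b ≫ g b = q₀ ≫ g₀ := by
    rintro (_ | _)
    · rfl
    · exact hg.symm
  let 𝒰 : W.toScheme.OpenCover :=
    { I₀ := Bool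
      X := U
      f := j
      mem₀ := by
        rw [Scheme.ofArrows_mem_precoverage_iff]
        refine ⟨fun x ↦ ?_, hjo⟩
        obtain ⟨y, hy⟩ | ⟨y, hy⟩ := x.2
        · refine ⟨false, y, W.ι.isOpenEmbedding.injective ?_⟩
          exact (Scheme.Hom.comp_apply _ _ _).symm.trans ((congr($(hj false) y)).trans hy)
        · refine ⟨true, y, W.ι.isOpenEmbedding.injective ?_⟩
          exact (Scheme.Hom.comp_apply _ _ _).symm.trans ((congr($(hj true) y)).trans hy) }
  have hcomp : ∀ a b, pullback.fst (j a) (j b) ≫ g a = pullback.snd (j a) (j b) ≫ g b := by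
    intro a b
    have := hjo a
    have := hjo b
    -- `Q` maps dominantly to the reduced overlap, so the agreement given on `Q` suffices.
    have hab : q a ≫ j a = q b ≫ j b := by
      rw [← cancel_mono W.ι, Category.assoc, Category.assoc, hj, hj, hqi, hqi]
    have h1 : IsDominant (pullback.lift (q a) (q b) hab) := by
      have : IsDominant (pullback.lift (q a) (q b) hab ≫ pullback.fst _ _ ≫ j a ≫ W.ι) := by
        rw [pullback.lift_fst_assoc, hj, hqi]
        infer_instance
      exact .of_comp_of_isOpenImmersion _ (pullback.fst _ _ ≫ j a ≫ W.ι)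
    have h2 : IsReduced (pullback (j a) (j b)) :=
      isReduced_of_isOpenImmersion (pullback.fst (j a) (j b) ≫ j a ≫ W.ι)
    refine ext_of_isDominant (pullback.lift (q a) (q b) hab) ?_
    rw [pullback.lift_fst_assoc, pullback.lift_snd_assoc, hqg, hqg]
  refine ⟨𝒰.glueMorphisms g hcomp, fun j₀ h ↦ ?_, fun j₁ h ↦ ?_⟩
  · have : j₀ = j false := (cancel_mono W.ι).mp (h.trans (hj false).symm)
    rw [this]
    exact 𝒰.ι_glueMorphisms g hcomp false
  · have : j₁ = j true := (cancel_mono W.ι).mp (h.trans (hj true).symm)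
    rw [this]
    exact 𝒰.ι_glueMorphisms g hcomp true

section PuncturedPlane

variable (K : Type u) [Field K]

/-- The coordinate ring of the plane. -/
abbrev PlaneRing : Type u := MvPolynomial (Fin 2) K

/-- The open complement of the origin in the plane. -/
def puncturedPlane : (Spec (.of (PlaneRing K))).Opens :=
  PrimeSpectrum.basicOpen (MvPolynomial.X 0) ⊔ PrimeSpectrum.basicOpen (MvPolynomial.X 1)

variable {K} {B : Type u} [CommRing B]

/-- The point of the plane with given coordinates. -/
abbrev evalPair (θ : K →+* B) (a b : B) : PlaneRing K →+* B :=
  MvPolynomial.eval₂Hom θ ![a, b]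

/-- The point of the line with given coordinate. -/
abbrev evalAt (θ : K →+* B) (a : B) : Polynomial K →+* B := Polynomial.eval₂RingHom θ a

variable {X : Scheme.{u}}

/-- The morphism `g` is the value at the point `(a : b)` of a morphism on the punctured plane. -/
def Represents (Φ : (puncturedPlane K).toScheme ⟶ X) (θ : K →+* B) (a b : B)
    (g : Spec (.of B) ⟶ X) : Prop :=
  ∃ h : Spec (.of B) ⟶ puncturedPlane K,
    h ≫ (puncturedPlane K).ι = Spec.map (CommRingCat.ofHom (evalPair θ a b)) ∧ h ≫ Φ = g

/-- A unimodular pair has no common zero, so the map to the plane misses the origin. -/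
theorem Represents.exists {Φ : (puncturedPlane K).toScheme ⟶ X} (θ : K →+* B) {a b : B}
    (h : IsCoprime a b) : ∃ g, Represents Φ θ a b g := by
  refine ⟨_, IsOpenImmersion.lift (puncturedPlane K).ι _ ?_, IsOpenImmersion.lift_fac _ _ _, rfl⟩
  rw [Scheme.Opens.range_ι]
  rintro _ ⟨p, rfl⟩
  by_contra hp
  have h0 : a ∈ p.asIdeal := by
    by_contra ha
    refine hp (Or.inl ?_)
    change evalPair θ a b (MvPolynomial.X 0) ∉ p.asIdeal
    simpa using ha
  have h1 : b ∈ p.asIdeal := by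
    by_contra ha
    refine hp (Or.inr ?_)
    change evalPair θ a b (MvPolynomial.X 1) ∉ p.asIdeal
    simpa using ha
  obtain ⟨u, v, huv⟩ := h
  exact p.2.ne_top ((Ideal.eq_top_iff_one _).mpr
    (huv ▸ add_mem (Ideal.mul_mem_left _ _ h0) (Ideal.mul_mem_left _ _ h1)))

theorem Represents.unique {Φ : (puncturedPlane K).toScheme ⟶ X} {θ : K →+* B} {a b : B}
    {g g' : Spec (.of B) ⟶ X} (h : Represents Φ θ a b g) (h' : Represents Φ θ a b g') : g = g' := by
  obtain ⟨h, h1, rfl⟩ := h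
  obtain ⟨h', h1', rfl⟩ := h'
  rw [← h1', cancel_mono] at h1
  rw [h1]

theorem Represents.map {Φ : (puncturedPlane K).toScheme ⟶ X} {θ : K →+* B} {a b : B}
    {g : Spec (.of B) ⟶ X} (h : Represents Φ θ a b g) {B' : Type u} [CommRing B'] (f : B →+* B') :
    Represents Φ (f.comp θ) (f a) (f b) (Spec.map (CommRingCat.ofHom f) ≫ g) := by
  obtain ⟨h, h1, rfl⟩ := h
  refine ⟨Spec.map (CommRingCat.ofHom f) ≫ h, ?_, Category.assoc _ _ _⟩
  rw [Category.assoc, h1, ← Spec.map_comp, ← CommRingCat.ofHom_comp]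
  congr 2
  ext i
  · simp
  · fin_cases i <;> simp

end PuncturedPlane

end

/-! ### Parametrizations in homogeneous coordinates and the Galois action -/

section

open TensorProduct

theorem hom_ext_of_forall_exists_away {T : Type u} [CommRing T] {X : Scheme.{u}}
    {f g : Spec (.of T) ⟶ X} (h : ∀ p : Ideal T, p.IsPrime → ∃ t ∉ p,
      Spec.map (CommRingCat.ofHom (algebraMap T (Localization.Away t))) ≫ f =
        Spec.map (CommRingCat.ofHom (algebraMap T (Localization.Away t))) ≫ g) : f = g := by
  let s : Set T := {t | Spec.map (CommRingCat.ofHom (algebraMap T (Localization.Away t))) ≫ f =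
        Spec.map (CommRingCat.ofHom (algebraMap T (Localization.Away t))) ≫ g}
  have hs : Ideal.span (Set.range ((↑) : s → T)) = ⊤ := by
    rw [Subtype.range_coe]
    by_contra hne
    obtain ⟨p, hp, hle⟩ := Ideal.exists_le_maximal _ hne
    obtain ⟨t, ht, hfg⟩ := h p hp.isPrime
    exact ht (hle (Ideal.subset_span hfg))
  refine Scheme.Cover.hom_ext
    (Scheme.affineOpenCoverOfSpanRangeEqTop (R := .of T) ((↑) : s → T) hs).openCover _ _
    fun i ↦ i.2

section Parametrization

variable (X : Scheme.{u}) (l F K : Type u) [Field l] [Field F] [Field K] [Algebra l F] [Algebra l K]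

/-- A rational parametrization of an `F`-valued point of `X` after base change to `K`, extended to
the two standard affine lines of the projective line over `K`. -/
structure Parametrization where
  point : Spec (.of F) ⟶ X
  iso : RatFunc K ≃ₐ[K] K ⊗[l] F
  zero : Spec (.of (Polynomial K)) ⟶ X
  infty : Spec (.of (Polynomial K)) ⟶ X
  zero_comp : Spec.map (CommRingCat.ofHom (algebraMap (Polynomial K) (RatFunc K))) ≫ zero =
    Spec.map (CommRingCat.ofHom ((iso.symm : K ⊗[l] F →+* RatFunc K).comp
      (Algebra.TensorProduct.includeRight : F →ₐ[l] K ⊗[l] F).toRingHom)) ≫ point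
  infty_comp : Spec.map (CommRingCat.ofHom (evalAt RatFunc.C (RatFunc.X : RatFunc K)⁻¹)) ≫ infty =
    Spec.map (CommRingCat.ofHom ((iso.symm : K ⊗[l] F →+* RatFunc K).comp
      (Algebra.TensorProduct.includeRight : F →ₐ[l] K ⊗[l] F).toRingHom)) ≫ point

variable {X l F K} (D : Parametrization X l F K)

theorem isDominant_specMap_of_injective {A B : Type u} [CommRing A] [CommRing B] [IsDomain A]
    [IsDomain B] (f : A →+* B) (hf : Function.Injective f) :
    IsDominant (Spec.map (CommRingCat.ofHom f)) := by
  refine ⟨?_⟩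
  have h := (PrimeSpectrum.denseRange_comap_iff_ker_le_nilRadical f).mpr
    (by rw [(RingHom.injective_iff_ker_eq_bot f).mp hf]; exact bot_le)
  exact h

/-- Evaluation at the quotient of the coordinates of the plane. -/
def evalRatio (K : Type u) [Field K] : Polynomial K →+* FractionRing (PlaneRing K) :=
  evalAt ((algebraMap (PlaneRing K) (FractionRing (PlaneRing K))).comp MvPolynomial.C)
      (algebraMap (PlaneRing K) _ (MvPolynomial.X 0) /
        algebraMap (PlaneRing K) _ (MvPolynomial.X 1))

/-- The map `t ↦ x / y` factors through the localization at `y`, where setting `x = t`, `y = 1` is a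
left inverse. -/
theorem evalRatio_injective : Function.Injective (evalRatio K) := by
  let A := Localization.Away (MvPolynomial.X 1 : PlaneRing K)
  have h1 : IsUnit (evalPair Polynomial.C (Polynomial.X : Polynomial K) 1 (MvPolynomial.X 1)) := by
    simp
  let e : A →+* Polynomial K := IsLocalization.Away.lift (MvPolynomial.X 1) h1
  have h0 : (MvPolynomial.X 1 : PlaneRing K) ≠ 0 := MvPolynomial.X_ne_zero 1
  have h2 : IsUnit (algebraMap (PlaneRing K) (FractionRing (PlaneRing K)) (MvPolynomial.X 1)) :=
    (map_ne_zero_iff _ (IsFractionRing.injective _ _)).mpr h0 |>.isUnit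
  let q : A →+* FractionRing (PlaneRing K) := IsLocalization.Away.lift (MvPolynomial.X 1) h2
  have hq : Function.Injective q := by
    refine (IsLocalization.lift_injective_iff _).mpr fun x y ↦ ?_
    rw [(IsLocalization.injective A (powers_le_nonZeroDivisors_of_noZeroDivisors h0)).eq_iff,
      (IsFractionRing.injective (PlaneRing K) (FractionRing (PlaneRing K))).eq_iff]
  let i : Polynomial K →+* A := evalAt ((algebraMap (PlaneRing K) A).comp MvPolynomial.C)
    (algebraMap (PlaneRing K) A (MvPolynomial.X 0) * IsLocalization.Away.invSelf (S := A) (MvPolynomial.X 1 : PlaneRing K))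
  have hqa (x : PlaneRing K) : q (algebraMap _ A x) = algebraMap _ _ x :=
    IsLocalization.Away.lift_eq _ _ _
  have hea (x : PlaneRing K) : e (algebraMap _ A x) =
      evalPair Polynomial.C (Polynomial.X : Polynomial K) 1 x :=
    IsLocalization.Away.lift_eq _ _ _
  have hinv : algebraMap (PlaneRing K) A (MvPolynomial.X 1) *
      IsLocalization.Away.invSelf (S := A) (MvPolynomial.X 1 : PlaneRing K) = 1 := IsLocalization.Away.mul_invSelf _
  have hei : e.comp i = RingHom.id _ := by
    ext x
    · simp [i, hea]
    · have := congrArg e hinv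
      rw [map_mul, hea] at this
      simp only [MvPolynomial.coe_eval₂Hom, MvPolynomial.eval₂_X, Matrix.cons_val_one,
        Matrix.cons_val_zero, one_mul, map_one] at this
      simp [i, hea, this]
  have hqi : q.comp i = evalRatio K := by
    ext x
    · simp [i, hqa, evalRatio]
    · have := congrArg q hinv
      rw [map_mul, hqa, map_one] at this
      simp [i, hqa, eq_inv_of_mul_eq_one_right this, div_eq_mul_inv, evalRatio]
  rw [← hqi]
  exact hq.comp (Function.LeftInverse.injective (g := e) fun x ↦ congr($hei x))

namespace Parametrization

/-- The generic point of the parametrization. -/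
def genericPoint : Spec (.of (RatFunc K)) ⟶ X :=
  Spec.map (CommRingCat.ofHom ((D.iso.symm : K ⊗[l] F →+* RatFunc K).comp
      (Algebra.TensorProduct.includeRight : F →ₐ[l] K ⊗[l] F).toRingHom)) ≫ D.point

/-- The quotient of the coordinates, as a map on fraction fields. -/
def ratioHom (K : Type u) [Field K] : RatFunc K →+* FractionRing (PlaneRing K) :=
  IsFractionRing.lift (evalRatio_injective (K := K))

theorem ratioHom_comp : (ratioHom K).comp (algebraMap (Polynomial K) (RatFunc K)) = evalRatio K  := by
  refine RingHom.ext fun p ↦ ?_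
  rw [RingHom.comp_apply, ratioHom]
  exact IsFractionRing.lift_algebraMap _ _

theorem ratioHom_C (c : K) : ratioHom K (RatFunc.C c) =
    algebraMap (PlaneRing K) _ (MvPolynomial.C c) := by
  have := congr($(ratioHom_comp (K := K)) (Polynomial.C c))
  simpa [evalRatio] using this

theorem ratioHom_X : ratioHom K RatFunc.X = algebraMap (PlaneRing K) _ (MvPolynomial.X 0) /
        algebraMap (PlaneRing K) _ (MvPolynomial.X 1) := by
  have := congr($(ratioHom_comp (K := K)) Polynomial.X)
  simpa [evalRatio] using this

/-- The two affine lines composed with `x / y` and `y / x` agree at the generic point of the plane,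
where both give the generic point of `D`, and glue. The punctured plane replaces the projective line
so that unimodular pairs are points and invertible matrices act without a choice of chart. -/
theorem exists_morphism [X.IsSeparated] : ∃ Φ : (puncturedPlane K).toScheme ⟶ X,
    (∀ {B : Type u} [CommRing B] (θ : K →+* B) (a b : B), a * b = 1 → ∀ c,
      Represents Φ θ c b (Spec.map (CommRingCat.ofHom (evalAt θ (c * a))) ≫ D.zero)) ∧
    (∀ {B : Type u} [CommRing B] (θ : K →+* B) (a b : B), a * b = 1 → ∀ c,
      Represents Φ θ b c (Spec.map (CommRingCat.ofHom (evalAt θ (c * a))) ≫ D.infty)) := by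
  let P := PlaneRing K
  let A (i : Fin 2) := Localization.Away (MvPolynomial.X i : P)
  let inv (i : Fin 2) : A i := IsLocalization.Away.invSelf (S := A i) (MvPolynomial.X i : P)
  have hinv (i) : algebraMap P (A i) (MvPolynomial.X i) * inv i = 1 :=
    IsLocalization.Away.mul_invSelf _
  let loc (i : Fin 2) : Spec (.of (A i)) ⟶ Spec (.of P) :=
    Spec.map (CommRingCat.ofHom (algebraMap P (A i)))
  have hloc (i) : IsOpenImmersion (loc i) := AlgebraicGeometry.Scheme.isOpenImmersion_SpecMap_localizationAway (R := .of P) _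
  let Q := FractionRing P
  have hne (i) : algebraMap P Q (MvPolynomial.X i) ≠ 0 :=
    (map_ne_zero_iff _ (IsFractionRing.injective P Q)).mpr (MvPolynomial.X_ne_zero i)
  let q (i : Fin 2) : A i →+* Q := IsLocalization.Away.lift (MvPolynomial.X i) (hne i).isUnit
  have hq (i) : (q i).comp (algebraMap P (A i)) = algebraMap P Q :=
    IsLocalization.Away.lift_comp _ _
  have hqinv (i) : q i (inv i) = (algebraMap P Q (MvPolynomial.X i))⁻¹ := by
    have := congrArg (q i) (hinv i)
    rw [map_mul, map_one] at this
    rw [eq_inv_of_mul_eq_one_right this]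
    exact congr(($(hq i) (MvPolynomial.X i))⁻¹)
  let g (i j : Fin 2) : Polynomial K →+* A i :=
    evalAt ((algebraMap P (A i)).comp MvPolynomial.C) (algebraMap P (A i) (MvPolynomial.X j) * inv i)
  have hqg (i j) : (q i).comp (g i j) = evalAt ((algebraMap P Q).comp MvPolynomial.C)
      (algebraMap P _ (MvPolynomial.X j) / algebraMap P _ (MvPolynomial.X i)) := by
    ext x
    · have := congr($(hq i) (MvPolynomial.C x))
      simpa [g] using this
    · have := congr($(hq i) (MvPolynomial.X j))
      simp only [RingHom.comp_apply] at this
      simp [g, hqinv, this, div_eq_mul_inv]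
  have hdom : IsDominant (Spec.map (CommRingCat.ofHom (q 1)) ≫ loc 1) := by
    rw [← Spec.map_comp, ← CommRingCat.ofHom_comp, hq]
    exact isDominant_specMap_of_injective _ (IsFractionRing.injective P Q)
  have hgen : Spec.map (CommRingCat.ofHom (q 1)) ≫ Spec.map (CommRingCat.ofHom (g 1 0)) ≫ D.zero =
      Spec.map (CommRingCat.ofHom (q 0)) ≫ Spec.map (CommRingCat.ofHom (g 0 1)) ≫ D.infty := by
    rw [← Spec.map_comp_assoc, ← Spec.map_comp_assoc, ← CommRingCat.ofHom_comp,
      ← CommRingCat.ofHom_comp, hqg, hqg, show evalAt _ _ = evalRatio K from rfl, ← ratioHom_comp, CommRingCat.ofHom_comp,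
      Spec.map_comp_assoc, D.zero_comp, ← D.infty_comp, ← Spec.map_comp_assoc,
      ← CommRingCat.ofHom_comp]
    congr 3
    ext x
    · simpa using ratioHom_C x
    · simp [(ratioHom_X)]; rfl
  obtain ⟨Φ, h1, h0⟩ := exists_glue (loc 1) (loc 0) (Spec.map (CommRingCat.ofHom (g 1 0)) ≫ D.zero)
    (Spec.map (CommRingCat.ofHom (g 0 1)) ≫ D.infty) (Spec.map (CommRingCat.ofHom (q 1)))
    (Spec.map (CommRingCat.ofHom (q 0)))
    (by rw [← Spec.map_comp, ← Spec.map_comp, ← CommRingCat.ofHom_comp, ← CommRingCat.ofHom_comp,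
      hq, hq]) hgen (puncturedPlane K) (by
      rw [Scheme.Hom.opensRange_localizationAway (R := .of P),
        Scheme.Hom.opensRange_localizationAway (R := .of P)]
      exact sup_comm _ _)
  have hle (i : Fin 2) : Set.range (loc i) ⊆ Set.range (puncturedPlane K).ι := by
    rw [Scheme.Opens.range_ι]
    have : Set.range (loc i) =
        (PrimeSpectrum.basicOpen (MvPolynomial.X i : P) : Set (PrimeSpectrum P)) :=
      congr(SetLike.coe $(Scheme.Hom.opensRange_localizationAway (R := .of P) (MvPolynomial.X i)))
    rw [this]
    fin_cases i
    · exact Set.subset_union_left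
    · exact Set.subset_union_right
  let j (i : Fin 2) : Spec (.of (A i)) ⟶ puncturedPlane K :=
    IsOpenImmersion.lift (puncturedPlane K).ι (loc i) (hle i)
  have hj (i) : j i ≫ (puncturedPlane K).ι = loc i := IsOpenImmersion.lift_fac _ _ _
  have main {B : Type u} [CommRing B] (θ : K →+* B) (a : B) (v : Fin 2 → B) (i j : Fin 2)
      (h : a * v i = 1) : ∃ e : A i →+* B, e.comp (algebraMap P (A i)) =
        MvPolynomial.eval₂Hom θ v ∧ e.comp (g i j) = evalAt θ (v j * a) := by
    have hu : IsUnit (MvPolynomial.eval₂Hom θ v (MvPolynomial.X i)) := by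
      rw [MvPolynomial.eval₂Hom_X']
      exact .of_mul_eq_one_right _ h
    have he (x) : (IsLocalization.Away.lift (MvPolynomial.X i) hu : A i →+* B)
      (algebraMap P (A i) x) = MvPolynomial.eval₂Hom θ v x := IsLocalization.Away.lift_eq _ _ _
    refine ⟨IsLocalization.Away.lift (MvPolynomial.X i) hu, RingHom.ext he, ?_⟩
    ext x
    · simp only [g, RingHom.comp_apply, Polynomial.coe_eval₂RingHom, Polynomial.eval₂_C, he]
      exact MvPolynomial.eval₂_C θ v x
    · have := congrArg (IsLocalization.Away.lift (MvPolynomial.X i) hu : A i →+* B) (hinv i)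
      rw [map_mul, he, map_one, MvPolynomial.eval₂Hom_X'] at this
      have h3 : (IsLocalization.Away.lift (MvPolynomial.X i) hu : A i →+* B) (inv i) = a := by
        linear_combination a * this - (IsLocalization.Away.lift (MvPolynomial.X i) hu : A i →+* B) (inv i) * h
      simp [g, he, h3]
  refine ⟨Φ, fun {B} _ θ a b h c ↦ ?_, fun {B} _ θ a b h c ↦ ?_⟩
  · obtain ⟨e, h2, h3⟩ := main θ a ![c, b] 1 0 h
    refine ⟨Spec.map (CommRingCat.ofHom e) ≫ j 1, ?_, ?_⟩
    · rw [Category.assoc, hj, ← Spec.map_comp, ← CommRingCat.ofHom_comp, h2]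
    · rw [Category.assoc, h1 _ (hj 1), ← Spec.map_comp_assoc, ← CommRingCat.ofHom_comp, h3]
      rfl
  · obtain ⟨e, h2, h3⟩ := main θ a ![b, c] 0 1 h
    refine ⟨Spec.map (CommRingCat.ofHom e) ≫ j 0, ?_, ?_⟩
    · rw [Category.assoc, hj, ← Spec.map_comp, ← CommRingCat.ofHom_comp, h2]
    · rw [Category.assoc, h0 _ (hj 0), ← Spec.map_comp_assoc, ← CommRingCat.ofHom_comp, h3]
      rfl

/-- The automorphism of the field of rational functions corresponding to the Galois action. -/
def galRatFunc (σ : K ≃ₐ[l] K) : RatFunc K ≃+* RatFunc K :=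
  D.iso.toRingEquiv.trans ((galAct F σ).toRingEquiv.trans D.iso.symm.toRingEquiv)

theorem galRatFunc_C (σ : K ≃ₐ[l] K) (c : K) :
    D.galRatFunc σ (RatFunc.C c) = RatFunc.C (σ c) := by
  have h (c : K) : D.iso (RatFunc.C c) = c ⊗ₜ 1 := D.iso.commutes c
  apply D.iso.injective
  refine (D.iso.apply_symm_apply _).trans ?_
  change galAct F σ (D.iso (RatFunc.C c)) = _
  rw [h, h, Algebra.TensorProduct.congr_apply, Algebra.TensorProduct.map_tmul]
  simp

theorem specMap_galRatFunc (σ : K ≃ₐ[l] K) :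
    Spec.map (CommRingCat.ofHom (D.galRatFunc σ : RatFunc K →+* RatFunc K)) ≫ D.genericPoint =
      D.genericPoint := by
  rw [genericPoint, ← Spec.map_comp_assoc, ← CommRingCat.ofHom_comp]
  congr 3
  ext x
  change D.iso.symm (galAct F σ (D.iso (D.iso.symm (1 ⊗ₜ x)))) = D.iso.symm (1 ⊗ₜ x)
  rw [D.iso.apply_symm_apply, Algebra.TensorProduct.congr_apply, Algebra.TensorProduct.map_tmul]
  simp

/-- The matrix `(α, β; γ, δ)` describes the Galois action on the coordinate of `D`. -/
structure IsMobius (D : Parametrization X l F K) (σ : K ≃ₐ[l] K) (α β γ δ : K) : Prop where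
  det_ne_zero : α * δ - β * γ ≠ 0
  relation : (γ ⊗ₜ 1 * D.iso RatFunc.X + δ ⊗ₜ 1) * galAct F σ (D.iso RatFunc.X) =
    α ⊗ₜ 1 * D.iso RatFunc.X + β ⊗ₜ 1

variable {D} in
theorem IsMobius.galRatFunc_X {σ : K ≃ₐ[l] K} {α β γ δ : K} (h : D.IsMobius σ α β γ δ) :
    (RatFunc.C γ * RatFunc.X + RatFunc.C δ) * D.galRatFunc σ RatFunc.X =
      RatFunc.C α * RatFunc.X + RatFunc.C β := by
  have hC (c : K) : D.iso (RatFunc.C c) = c ⊗ₜ 1 := D.iso.commutes c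
  apply D.iso.injective
  have h2 : D.iso (D.galRatFunc σ RatFunc.X) = galAct F σ (D.iso RatFunc.X) :=
    D.iso.apply_symm_apply _
  rw [map_mul, map_add, map_mul, map_add, map_mul, hC, hC, hC, hC, h2]
  exact h.relation

/-- The extension of the parametrization to the punctured plane. -/
def morphism [X.IsSeparated] : (puncturedPlane K).toScheme ⟶ X := D.exists_morphism.choose

/-- `g` is the value of the parametrization at `(a : b)`. -/
abbrev Value [X.IsSeparated] {B : Type u} [CommRing B] (θ : K →+* B) (a b : B)
    (g : Spec (.of B) ⟶ X) : Prop :=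
  Represents D.morphism θ a b g

variable [X.IsSeparated] {B : Type u} [CommRing B]

theorem value_zero (θ : K →+* B) {a b : B} (h : a * b = 1) (c : B) :
    D.Value θ c b (Spec.map (CommRingCat.ofHom (evalAt θ (c * a))) ≫ D.zero) :=
  D.exists_morphism.choose_spec.1 θ a b h c

theorem value_infty (θ : K →+* B) {a b : B} (h : a * b = 1) (c : B) :
    D.Value θ b c (Spec.map (CommRingCat.ofHom (evalAt θ (c * a))) ≫ D.infty) :=
  D.exists_morphism.choose_spec.2 θ a b h c

variable {D}

theorem Value.notMem {θ : K →+* B} {a b : B} {g : Spec (.of B) ⟶ X} (h : D.Value θ a b g)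
    (p : Ideal B) [hp : p.IsPrime] : a ∉ p ∨ b ∉ p := by
  obtain ⟨h, h1, rfl⟩ := h
  let q : Spec (.of B) := ⟨p, hp⟩
  have h2 := (h q).2
  have h3 : (h q : (puncturedPlane K).toScheme).1 = Spec.map (CommRingCat.ofHom (evalPair θ a b)) q :=
    congr($h1 q)
  rw [h3] at h2
  refine h2.imp (fun h ha ↦ h ?_) (fun h hb ↦ h ?_)
  · change evalPair θ a b (MvPolynomial.X 0) ∈ p
    simpa using ha
  · change evalPair θ a b (MvPolynomial.X 1) ∈ p
    simpa using hb

theorem Value.isCoprime {θ : K →+* B} {a b : B} {g : Spec (.of B) ⟶ X} (h : D.Value θ a b g) :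
    IsCoprime a b := by
  rw [← Ideal.isCoprime_span_singleton_iff, Ideal.isCoprime_iff_sup_eq]
  by_contra hne
  obtain ⟨p, hp, hle⟩ := Ideal.exists_le_maximal _ hne
  rw [sup_le_iff, Ideal.span_singleton_le_iff_mem, Ideal.span_singleton_le_iff_mem] at hle
  have := hp.isPrime
  obtain h | h := h.notMem p
  exacts [h hle.1, h hle.2]

/-- Locally `a` or `b` is invertible. There the value depends only on the ratio, which scaling does
not change. -/
theorem Value.smul {θ : K →+* B} {a b : B} {g : Spec (.of B) ⟶ X}
    (h : D.Value θ a b g) {c : B} (hc : IsUnit c) : D.Value θ (c * a) (c * b) g := by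
  obtain ⟨g', hg'⟩ := Represents.exists (Φ := D.morphism) θ
    ((isCoprime_mul_units_left hc hc _ _).mpr h.isCoprime)
  suffices g = g' by rwa [this]
  refine hom_ext_of_forall_exists_away fun p hp ↦ ?_
  obtain ha | hb := h.notMem p
  · refine ⟨a, ha, ?_⟩
    let q := algebraMap B (Localization.Away a)
    obtain ⟨a', h1⟩ := isUnit_iff_exists_inv'.mp (IsLocalization.Away.algebraMap_isUnit
      (S := Localization.Away a) a)
    obtain ⟨c', h2⟩ := isUnit_iff_exists_inv'.mp (hc.map q)
    have e1 := h.map q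
    have e2 := hg'.map q
    have h3 : (a' * c') * q (c * a) = 1 := by
      rw [map_mul]
      linear_combination a' * q a * h2 + h1
    rw [e1.unique (D.value_infty _ h1 _), e2.unique (D.value_infty _ h3 _)]
    congr 4
    rw [map_mul]
    linear_combination -q b * a' * h2
  · refine ⟨b, hb, ?_⟩
    let q := algebraMap B (Localization.Away b)
    obtain ⟨a', h1⟩ := isUnit_iff_exists_inv'.mp (IsLocalization.Away.algebraMap_isUnit
      (S := Localization.Away b) b)
    obtain ⟨c', h2⟩ := isUnit_iff_exists_inv'.mp (hc.map q)
    have e1 := h.map q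
    have e2 := hg'.map q
    have h3 : (a' * c') * q (c * b) = 1 := by
      rw [map_mul]
      linear_combination a' * q b * h2 + h1
    rw [e1.unique (D.value_zero _ h1 _), e2.unique (D.value_zero _ h3 _)]
    congr 4
    rw [map_mul]
    linear_combination -q a * a' * h2

/-- The linear endomorphism of the plane given by a matrix, twisted by a field automorphism. -/
abbrev planeMap (σ : K →+* K) (α β γ δ : K) : PlaneRing K →+* PlaneRing K :=
  evalPair (MvPolynomial.C.comp σ) (MvPolynomial.C α * MvPolynomial.X 0 +
    MvPolynomial.C β * MvPolynomial.X 1) (MvPolynomial.C γ * MvPolynomial.X 0 +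
    MvPolynomial.C δ * MvPolynomial.X 1)

theorem evalPair_comp_planeMap (θ : K →+* B) (a b : B) (σ : K →+* K) (α β γ δ : K) :
    (evalPair θ a b).comp (planeMap σ α β γ δ) =
      evalPair (θ.comp σ) (θ α * a + θ β * b) (θ γ * a + θ δ * b) := by
  ext i
  · simp
  · fin_cases i <;> simp

/-- It suffices to compare at the generic point of the plane. There the twisted linear map acts on
`x / y` as `galRatFunc σ`, and this fixes the generic point of `D`, because Galois acts on `K ⊗ F`
through `K` only. -/
theorem IsMobius.comp_eq {σ : K ≃ₐ[l] K} {α β γ δ : K} (h : D.IsMobius σ α β γ δ)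
    (T : (puncturedPlane K).toScheme ⟶ (puncturedPlane K).toScheme)
    (hT : T ≫ (puncturedPlane K).ι = (puncturedPlane K).ι ≫
      Spec.map (CommRingCat.ofHom (planeMap (σ : K →+* K) α β γ δ))) :
    T ≫ D.morphism = D.morphism := by
  let P := PlaneRing K
  let Q := FractionRing P
  let θ : K →+* Q := (algebraMap P Q).comp MvPolynomial.C
  let x (i : Fin 2) : Q := algebraMap P Q (MvPolynomial.X i)
  have hne (i) : x i ≠ 0 :=
    (map_ne_zero_iff _ (IsFractionRing.injective P Q)).mpr (MvPolynomial.X_ne_zero i)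
  have hpair : evalPair θ (x 0) (x 1) = algebraMap P Q := by
    ext i
    · simp [θ]
    · fin_cases i <;> simp [x]
  have h1 := D.value_zero θ (inv_mul_cancel₀ (hne 1)) (x 0)
  obtain ⟨q, hq, hq1⟩ := id h1
  rw [hpair] at hq
  have : IsDominant q := by
    have : IsDominant (q ≫ (puncturedPlane K).ι) := by
      rw [hq]
      exact isDominant_specMap_of_injective _ (IsFractionRing.injective P Q)
    exact .of_comp_of_isOpenImmersion _ (puncturedPlane K).ι
  have hv : D.Value (θ.comp (σ : K →+* K)) (θ α * x 0 + θ β * x 1) (θ γ * x 0 + θ δ * x 1)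
      (q ≫ T ≫ D.morphism) := by
    refine ⟨q ≫ T, ?_, Category.assoc _ _ _⟩
    rw [Category.assoc, hT, reassoc_of% hq, ← Spec.map_comp, ← CommRingCat.ofHom_comp,
      ← evalPair_comp_planeMap, hpair]
  have hr (r) : (x 0 * (x 1)⁻¹ = ratioHom K RatFunc.X ∧ θ r = ratioHom K (RatFunc.C r)) := by
    rw [ratioHom_C, ratioHom_X, div_eq_mul_inv]
    exact ⟨rfl, rfl⟩
  have hσ := congrArg (ratioHom K) h.galRatFunc_X
  rw [map_mul, map_add, map_mul, map_add, map_mul, ← (hr _).2, ← (hr _).2, ← (hr _).2, ← (hr _).2,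
    ← (hr 0).1] at hσ
  -- If this vanished, the Möbius relation would make the other row vanish too, against the nonzero
  -- determinant.
  have hne1 : θ γ * x 0 + θ δ * x 1 ≠ 0 := by
    intro h0
    have h3 : θ α * x 0 + θ β * x 1 = 0 := by
      have h4 : θ γ * (x 0 * (x 1)⁻¹) + θ δ = 0 := by
        linear_combination (x 1)⁻¹ * h0 - θ δ * mul_inv_cancel₀ (hne 1)
      rw [h4, zero_mul] at hσ
      have := hne 1
      field_simp at hσ
      linear_combination -hσ
    have h5 : θ (α * δ - β * γ) * x 0 = 0 := by
      simp only [map_sub, map_mul]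
      linear_combination θ δ * h3 - θ β * h0
    exact mul_ne_zero ((map_ne_zero θ).mpr h.det_ne_zero) (hne 0) h5
  refine ext_of_isDominant q ?_
  rw [hq1, hv.unique (D.value_zero _ (inv_mul_cancel₀ hne1) _)]
  have e1 : evalAt θ (x 0 * (x 1)⁻¹) =
      (ratioHom K).comp (algebraMap (Polynomial K) (RatFunc K)) := by
    rw [ratioHom_comp]
    rfl
  have e2 : evalAt (θ.comp (σ : K →+* K)) ((θ α * x 0 + θ β * x 1) * (θ γ * x 0 + θ δ * x 1)⁻¹) =
      (ratioHom K).comp ((D.galRatFunc σ : RatFunc K →+* RatFunc K).comp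
        (algebraMap (Polynomial K) (RatFunc K))) := by
    ext r
    · simpa [galRatFunc_C] using (hr _).2
    · simp only [Polynomial.coe_eval₂RingHom, Polynomial.eval₂_X, RingHom.comp_apply,
        RatFunc.algebraMap_X, RingHom.coe_coe]
      rw [← div_eq_mul_inv, div_eq_iff hne1]
      have := hne 1
      field_simp at hσ
      linear_combination -hσ
  rw [e1, e2, CommRingCat.ofHom_comp, CommRingCat.ofHom_comp, CommRingCat.ofHom_comp,
    Spec.map_comp_assoc, Spec.map_comp_assoc, Spec.map_comp_assoc, D.zero_comp]
  congr 1
  exact D.specMap_galRatFunc σ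

/-- An invertible matrix preserves the punctured plane, and the induced endomorphism leaves the
morphism to `X` unchanged by `IsMobius.comp_eq`. -/
theorem IsMobius.value {σ : K ≃ₐ[l] K} {α β γ δ : K} (h : D.IsMobius σ α β γ δ)
    {θ : K →+* B} {a b : B} {g : Spec (.of B) ⟶ X} (hv : D.Value θ a b g) :
    D.Value (θ.comp (σ : K →+* K)) (θ α * a + θ β * b) (θ γ * a + θ δ * b) g := by
  let T' := (puncturedPlane K).ι ≫
      Spec.map (CommRingCat.ofHom (planeMap (σ : K →+* K) α β γ δ))
  have hT' : Set.range T' ⊆ Set.range (puncturedPlane K).ι := by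
    rw [Scheme.Opens.range_ι]
    rintro _ ⟨p, rfl⟩
    by_contra hp
    have h0 : planeMap (σ : K →+* K) α β γ δ (MvPolynomial.X 0) ∈ p.1.asIdeal := by
      by_contra ha
      exact hp (Or.inl ha)
    have h1 : planeMap (σ : K →+* K) α β γ δ (MvPolynomial.X 1) ∈ p.1.asIdeal := by
      by_contra ha
      exact hp (Or.inr ha)
    simp only [MvPolynomial.coe_eval₂Hom, MvPolynomial.eval₂_X, Matrix.cons_val_one,
      Matrix.cons_val_zero] at h0 h1
    have hC : IsUnit (MvPolynomial.C (α * δ - β * γ) : PlaneRing K) :=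
      (IsUnit.mk0 _ h.det_ne_zero).map _
    obtain hp | hp := p.2
    · refine hp ((Ideal.unit_mul_mem_iff_mem _ hC).mp ?_)
      convert sub_mem (Ideal.mul_mem_left _ (MvPolynomial.C δ) h0)
        (Ideal.mul_mem_left _ (MvPolynomial.C β) h1) using 1
      simp only [map_sub, map_mul]
      ring
    · refine hp ((Ideal.unit_mul_mem_iff_mem _ hC).mp ?_)
      convert sub_mem (Ideal.mul_mem_left _ (MvPolynomial.C α) h1)
        (Ideal.mul_mem_left _ (MvPolynomial.C γ) h0) using 1
      simp only [map_sub, map_mul]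
      ring
  have hT := h.comp_eq _ (IsOpenImmersion.lift_fac _ T' hT')
  obtain ⟨p, hp, rfl⟩ := hv
  refine ⟨p ≫ IsOpenImmersion.lift _ T' hT', ?_, ?_⟩
  · rw [Category.assoc, IsOpenImmersion.lift_fac, reassoc_of% hp, ← Spec.map_comp,
      ← CommRingCat.ofHom_comp, evalPair_comp_planeMap]
  · rw [Category.assoc, hT]

end Parametrization

end Parametrization

end

/-! ### Galois descent of morphisms -/

section

open TensorProduct

@[simp]
theorem galAct_tmul {l K B : Type*} [Field l] [Field K] [Algebra l K] [CommRing B] [Algebra l B]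
    (σ : K ≃ₐ[l] K) (x : K) (y : B) : galAct B σ (x ⊗ₜ y) = σ x ⊗ₜ y := by
  rw [Algebra.TensorProduct.congr_apply, Algebra.TensorProduct.map_tmul]
  rfl

theorem galAct_mul {l K B : Type*} [Field l] [Field K] [Algebra l K] [CommRing B] [Algebra l B]
    (σ τ : K ≃ₐ[l] K) (x : K ⊗[l] B) : galAct B (τ * σ) x = galAct B τ (galAct B σ x) := by
  induction x using TensorProduct.induction_on with
  | zero => simp
  | add x y hx hy => simp only [map_add, hx, hy]
  | tmul x y => simp

/-- For a primitive element `α`, the product of `g α - f r` over the conjugates `r` is `0`, so some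
factor lies in `p`. The other factors do not, because differences of distinct conjugates are units.
Their product is `t`, and inverting it gives `g = f ∘ σ`, where `σ` sends `α` to the chosen `r`. -/
theorem exists_prod_sub_eq_zero {l K T : Type*} [Field l] [Field K] [Algebra l K]
    [FiniteDimensional l K] [IsGalois l K] [CommRing T] (f g : K →+* T)
    (hfg : f.comp (algebraMap l K) = g.comp (algebraMap l K)) (p : Ideal T) (hp : p.IsPrime) :
    ∃ t ∉ p, ∃ σ : K ≃ₐ[l] K, ∀ x, t * (g x - f (σ x)) = 0 := by
  classical
  obtain ⟨α, hα⟩ := Field.exists_primitive_element l K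
  have hint : IsIntegral l α := Algebra.IsIntegral.isIntegral α
  let P := (minpoly l α).map (algebraMap l K)
  have hsep : P.roots.Nodup := Polynomial.nodup_roots
    (Polynomial.Separable.map (Algebra.IsSeparable.isSeparable l α))
  have hP : P = ∏ r ∈ P.roots.toFinset, (Polynomial.X - Polynomial.C r) := by
    have h := (IsGalois.splits l α).eq_prod_roots_of_monic ((minpoly.monic hint).map _)
    rw [Finset.prod, Multiset.toFinset_val, hsep.dedup]
    exact h
  have h0 : ∏ r ∈ P.roots.toFinset, (g α - f r) = 0 := by
    have h1 : P.eval₂ f (g α) = 0 := by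
      rw [Polynomial.eval₂_map, hfg, ← Polynomial.hom_eval₂, ← Polynomial.aeval_def, minpoly.aeval,
        map_zero]
    rw [hP, Polynomial.eval₂_finsetProd] at h1
    simpa using h1
  obtain ⟨r, hr, hrp⟩ := hp.prod_mem_iff.mp (h0 ▸ p.zero_mem)
  have hroot : Polynomial.aeval r (minpoly l α) = 0 := by
    rw [Polynomial.aeval_def, Polynomial.eval₂_eq_eval_map]
    exact (Polynomial.mem_roots'.mp (Multiset.mem_toFinset.mp hr)).2
  obtain ⟨σ, hσ⟩ := minpoly.exists_algEquiv_of_root' (Algebra.IsAlgebraic.isAlgebraic α) hroot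
  refine ⟨∏ x ∈ P.roots.toFinset.erase r, (g α - f x), fun hmem ↦ ?_, σ, fun x ↦ ?_⟩
  · obtain ⟨x, hx, hxp⟩ := hp.prod_mem_iff.mp hmem
    have hu : IsUnit (f (x - r)) :=
      (IsUnit.mk0 _ (sub_ne_zero.mpr (Finset.ne_of_mem_erase hx))).map f
    refine hp.ne_top (Ideal.eq_top_of_isUnit_mem _ ?_ hu)
    convert sub_mem hrp hxp using 1
    simp
  · have hx : x ∈ Algebra.adjoin l {α} := by
      rw [← IntermediateField.adjoin_simple_toSubalgebra_of_isAlgebraic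
        (Algebra.IsAlgebraic.isAlgebraic α), hα]
      trivial
    induction hx using Algebra.adjoin_induction with
    | mem x hx =>
      obtain rfl := hx
      rw [hσ, mul_comm, Finset.mul_prod_erase _ (fun r ↦ g x - f r) hr, h0]
    | algebraMap c =>
      rw [σ.commutes, show f (algebraMap l K c) = g (algebraMap l K c) from congr($hfg c), sub_self,
        mul_zero]
    | add x y _ _ hx hy =>
      simp only [map_add]
      linear_combination hx + hy
    | mul x y _ _ hx hy =>
      simp only [map_mul]
      linear_combination g x * hy + f (σ y) * hx

theorem flat_surjective_specMap_includeRight (l K R : Type u) [Field l] [Field K] [Algebra l K]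
    [CommRing R] [Algebra l R] :
    Flat (Spec.map (CommRingCat.ofHom
      (Algebra.TensorProduct.includeRight : R →ₐ[l] K ⊗[l] R).toRingHom)) ∧
    Surjective (Spec.map (CommRingCat.ofHom
      (Algebra.TensorProduct.includeRight : R →ₐ[l] K ⊗[l] R).toRingHom)) := by
  let π := Spec.map (CommRingCat.ofHom
      (Algebra.TensorProduct.includeRight : R →ₐ[l] K ⊗[l] R).toRingHom)
  have hpb : IsPullback (Spec.map (CommRingCat.ofHom
      (Algebra.TensorProduct.includeLeftRingHom : K →+* K ⊗[l] R))) π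
      (Spec.map (CommRingCat.ofHom (algebraMap l K)))
      (Spec.map (CommRingCat.ofHom (algebraMap l R))) :=
    isPullback_SpecMap_of_isPushout _ _ _ _ (CommRingCat.isPushout_tensorProduct l K R)
  have h1 : Flat (Spec.map (CommRingCat.ofHom (algebraMap l K))) := inferInstance
  have h2 : Surjective (Spec.map (CommRingCat.ofHom (algebraMap l K))) := inferInstance
  exact ⟨MorphismProperty.of_isPullback hpb h1, MorphismProperty.of_isPullback hpb h2⟩

theorem epi_specMap_includeRight (l K R : Type u) [Field l] [Field K] [Algebra l K]
    [CommRing R] [Algebra l R] :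
    Epi (Spec.map (CommRingCat.ofHom
      (Algebra.TensorProduct.includeRight : R →ₐ[l] K ⊗[l] R).toRingHom)) := by
  obtain ⟨_, _⟩ := flat_surjective_specMap_includeRight l K R
  infer_instance

/-- The projection is flat and surjective, hence an effective epimorphism. Two points with the same
projection differ, locally, by a Galois automorphism (`exists_prod_sub_eq_zero`), so invariance
under the group is enough. -/
theorem exists_descent {l K R : Type u} [Field l] [Field K] [Algebra l K]
    [FiniteDimensional l K] [IsGalois l K] [CommRing R] [Algebra l R] {X : Scheme.{u}}
    (g : Spec (.of (K ⊗[l] R)) ⟶ X)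
    (hg : ∀ σ : K ≃ₐ[l] K,
      Spec.map (CommRingCat.ofHom (galAct R σ : K ⊗[l] R →+* K ⊗[l] R)) ≫ g = g) :
    ∃ f, Spec.map (CommRingCat.ofHom
      (Algebra.TensorProduct.includeRight : R →ₐ[l] K ⊗[l] R).toRingHom) ≫ f = g := by
  let π := Spec.map (CommRingCat.ofHom
      (Algebra.TensorProduct.includeRight : R →ₐ[l] K ⊗[l] R).toRingHom)
  obtain ⟨_, _⟩ := flat_surjective_specMap_includeRight l K R
  suffices h : ∀ {Z : Scheme.{u}} (g₁ g₂ : Z ⟶ Spec (.of (K ⊗[l] R))), g₁ ≫ π = g₂ ≫ π →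
      g₁ ≫ g = g₂ ≫ g from ⟨EffectiveEpi.desc π g h, EffectiveEpi.fac π g _⟩
  suffices key : ∀ {T : CommRingCat.{u}} (g₁ g₂ : Spec T ⟶ Spec (.of (K ⊗[l] R))),
      g₁ ≫ π = g₂ ≫ π → g₁ ≫ g = g₂ ≫ g by
    intro Z g₁ g₂ h
    refine Scheme.Cover.hom_ext Z.affineCover _ _ fun i ↦ ?_
    have h' := key (Z.affineCover.f i ≫ g₁) (Z.affineCover.f i ≫ g₂)
      ((Category.assoc _ _ _).trans ((congrArg _ h).trans (Category.assoc _ _ _).symm))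
    exact (Category.assoc _ _ _).symm.trans (h'.trans (Category.assoc _ _ _))
  intro T g₁ g₂ h
  obtain ⟨a, rfl⟩ := Spec.map_surjective g₁
  obtain ⟨b, rfl⟩ := Spec.map_surjective g₂
  rw [← Spec.map_comp, ← Spec.map_comp] at h
  replace h := Spec.map_injective h
  have hR (r : R) : a.hom (1 ⊗ₜ r) = b.hom (1 ⊗ₜ r) := congr($h r)
  refine hom_ext_of_forall_exists_away (T := T) fun p hp ↦ ?_
  obtain ⟨t, ht, σ, hσ⟩ := exists_prod_sub_eq_zero (l := l)
    (a.hom.comp Algebra.TensorProduct.includeLeftRingHom)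
    (b.hom.comp Algebra.TensorProduct.includeLeftRingHom) (by
      ext x
      have := hR (algebraMap l R x)
      rwa [← Algebra.TensorProduct.algebraMap_apply', Algebra.TensorProduct.algebraMap_apply]
        at this) p hp
  refine ⟨t, ht, ?_⟩
  have hab : (algebraMap T (Localization.Away t)).comp b.hom =
      ((algebraMap T (Localization.Away t)).comp a.hom).comp
        (galAct R σ : K ⊗[l] R →+* K ⊗[l] R) := by
    have hx (x : K) : algebraMap T (Localization.Away t) (b.hom (x ⊗ₜ 1)) =
        algebraMap T (Localization.Away t) (a.hom (σ x ⊗ₜ 1)) := by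
      have h1 := congrArg (algebraMap T (Localization.Away t)) (hσ x)
      rw [map_mul, map_zero, (IsLocalization.Away.algebraMap_isUnit t).mul_right_eq_zero, map_sub,
        sub_eq_zero] at h1
      exact h1
    refine RingHom.ext fun z ↦ ?_
    change K ⊗[l] R at z
    induction z using TensorProduct.induction_on with
    | zero => simp
    | add x y hx hy => rw [map_add, map_add, hx, hy]
    | tmul x y =>
      rw [← mul_one x, ← one_mul y, ← Algebra.TensorProduct.tmul_mul_tmul]
      simp only [RingHom.comp_apply, map_mul, RingHom.coe_coe]
      rw [hx, ← hR, galAct_tmul, galAct_tmul, map_one]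
  have e2 : Spec.map (CommRingCat.ofHom (algebraMap T (Localization.Away t))) ≫ Spec.map b =
      Spec.map (CommRingCat.ofHom (algebraMap T (Localization.Away t))) ≫ Spec.map a ≫
        Spec.map (CommRingCat.ofHom (galAct R σ : K ⊗[l] R →+* K ⊗[l] R)) := by
    rw [← Spec.map_comp, ← Spec.map_comp, ← Spec.map_comp]
    exact congrArg Spec.map (CommRingCat.hom_ext hab)
  have e3 := congrArg (· ≫ g) e2
  simp only [Category.assoc, hg] at e3
  exact e3.symm

namespace Parametrization

variable {X : Scheme.{u}} {l F K R : Type u} [Field l] [Field F] [Field K] [CommRing R]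
  [Algebra l F] [Algebra l K] [Algebra l R] [X.IsSeparated]
  {D : Parametrization X l F K}

/-- The hypothesis says that `σ` moves the pair by the matrix describing its action on `D`, up to a
unit. `IsMobius.value` and `Value.smul` then show that the value is Galois invariant, so it
descends. -/
theorem exists_value_of_galois [FiniteDimensional l K] [IsGalois l K] {a b : K ⊗[l] R} (hab : IsCoprime a b)
    (h : ∀ σ : K ≃ₐ[l] K, ∃ α β γ δ, D.IsMobius σ α β γ δ ∧ ∃ c, IsUnit c ∧
      galAct R σ a = c * (α ⊗ₜ 1 * a + β ⊗ₜ 1 * b) ∧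
      galAct R σ b = c * (γ ⊗ₜ 1 * a + δ ⊗ₜ 1 * b)) :
    ∃ f : Spec (.of R) ⟶ X, D.Value Algebra.TensorProduct.includeLeftRingHom a b
      (Spec.map (CommRingCat.ofHom
        (Algebra.TensorProduct.includeRight : R →ₐ[l] K ⊗[l] R).toRingHom) ≫ f) := by
  obtain ⟨g, hg⟩ := Represents.exists (Φ := D.morphism)
    (Algebra.TensorProduct.includeLeftRingHom : K →+* K ⊗[l] R) hab
  obtain ⟨f, rfl⟩ := exists_descent g fun σ ↦ by
    obtain ⟨α, β, γ, δ, hm, c, hc, ha, hb⟩ := h σ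
    have h1 := (hm.value hg).smul hc
    have h2 := hg.map (galAct R σ : K ⊗[l] R →+* K ⊗[l] R)
    refine Represents.unique h2 ?_
    convert h1 using 1
    · ext x
      simp
    · exact ha
    · exact hb
  exact ⟨f, hg⟩

theorem Value.right_unique {a b : K ⊗[l] R} {f g : Spec (.of R) ⟶ X}
    (hf : D.Value Algebra.TensorProduct.includeLeftRingHom a b
      (Spec.map (CommRingCat.ofHom
        (Algebra.TensorProduct.includeRight : R →ₐ[l] K ⊗[l] R).toRingHom) ≫ f))
    (hg : D.Value Algebra.TensorProduct.includeLeftRingHom a b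
      (Spec.map (CommRingCat.ofHom
        (Algebra.TensorProduct.includeRight : R →ₐ[l] K ⊗[l] R).toRingHom) ≫ g)) : f = g := by
  have := epi_specMap_includeRight l K R
  exact (cancel_epi _).mp (hf.unique hg)

end Parametrization

end

/-! ### Points and frames of the twisted projective line -/

section

open TensorProduct

namespace Parametrization

variable {X : Scheme.{u}} {l F K R : Type u} [Field l] [Field F] [Field K] [CommRing R]
  [Algebra l F] [Algebra l K] [Algebra l R] {D : Parametrization X l F K}

/-- Applying `τ` to `σ(X) = M_σ X` gives the matrix `τ(M_σ) M_τ` for `τ * σ`. -/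
theorem IsMobius.comp {σ τ : K ≃ₐ[l] K} {α β γ δ α' β' γ' δ' : K} (hσ : D.IsMobius σ α β γ δ)
    (hτ : D.IsMobius τ α' β' γ' δ') :
    D.IsMobius (τ * σ) (τ α * α' + τ β * γ') (τ α * β' + τ β * δ') (τ γ * α' + τ δ * γ')
      (τ γ * β' + τ δ * δ') := by
  have hd : τ (α * δ - β * γ) ≠ 0 := (map_ne_zero τ).mpr hσ.det_ne_zero
  refine ⟨?_, ?_⟩
  · convert mul_ne_zero hd hτ.det_ne_zero using 1
    simp only [map_sub, map_mul]
    ring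
  · have h1 := congrArg (galAct F τ) hσ.relation
    have h2 := hτ.relation
    let ι : K →+* K ⊗[l] F := Algebra.TensorProduct.includeLeftRingHom
    have hι (c : K) : c ⊗ₜ 1 = ι c := rfl
    have hτι (c : K) : galAct F τ (ι c) = ι (τ c) := galAct_tmul _ _ _
    simp only [hι, map_mul, map_add, hτι] at h1 h2 ⊢
    rw [galAct_mul]
    linear_combination (ι γ' * D.iso RatFunc.X + ι δ') * h1 + (ι (τ α) - ι (τ γ) *
      galAct F τ (galAct F σ (D.iso RatFunc.X))) * h2

/-- Cross-multiplying two expressions for the same element of `K(t)` and comparing coefficients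
shows that the matrices are proportional. Quantities homogeneous of degree `0` in the matrix are
therefore well defined. -/
theorem IsMobius.unique {σ : K ≃ₐ[l] K} {α β γ δ α' β' γ' δ' : K} (h : D.IsMobius σ α β γ δ)
    (h' : D.IsMobius σ α' β' γ' δ') :
    ∃ μ ≠ 0, α' = μ * α ∧ β' = μ * β ∧ γ' = μ * γ ∧ δ' = μ * δ := by
  have h1 := h.galRatFunc_X
  have h2 := h'.galRatFunc_X
  have h3 : (RatFunc.C α * RatFunc.X + RatFunc.C β) * (RatFunc.C γ' * RatFunc.X + RatFunc.C δ') =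
      (RatFunc.C α' * RatFunc.X + RatFunc.C β') * (RatFunc.C γ * RatFunc.X + RatFunc.C δ) := by
    rw [← h1, ← h2]
    ring
  replace h3 : (Polynomial.C α * Polynomial.X + Polynomial.C β) *
      (Polynomial.C γ' * Polynomial.X + Polynomial.C δ') =
      (Polynomial.C α' * Polynomial.X + Polynomial.C β') *
        (Polynomial.C γ * Polynomial.X + Polynomial.C δ) := by
    apply RatFunc.algebraMap_injective
    simpa using h3
  have e (p q r s : K) : (Polynomial.C p * Polynomial.X + Polynomial.C q) *
      (Polynomial.C r * Polynomial.X + Polynomial.C s) = Polynomial.C (p * r) * Polynomial.X ^ 2 +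
      Polynomial.C (p * s + q * r) * Polynomial.X + Polynomial.C (q * s) := by
    simp only [Polynomial.C_mul, Polynomial.C_add]
    ring
  rw [e, e] at h3
  have hcoeff (p q r p' q' r' : K) (h : Polynomial.C p * Polynomial.X ^ 2 +
      Polynomial.C q * Polynomial.X + Polynomial.C r = Polynomial.C p' * Polynomial.X ^ 2 +
      Polynomial.C q' * Polynomial.X + Polynomial.C r') : p = p' ∧ q = q' ∧ r = r' := by
    have c0 := congrArg (Polynomial.coeff · 0) h
    have c1 := congrArg (Polynomial.coeff · 1) h
    have c2 := congrArg (Polynomial.coeff · 2) h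
    simp [Polynomial.coeff_X, Polynomial.coeff_C] at c0 c1 c2
    exact ⟨c2, c1, c0⟩
  obtain ⟨c2, c1, c0⟩ := hcoeff _ _ _ _ _ _ h3
  have hd := h.det_ne_zero
  have hd' := h'.det_ne_zero
  have m1 : (α * δ - β * γ) * α' = (δ * α' - β * γ') * α := by linear_combination β * c2
  have m2 : (α * δ - β * γ) * β' = (δ * α' - β * γ') * β := by
    linear_combination β * c1 - α * c0
  have m3 : (α * δ - β * γ) * γ' = (δ * α' - β * γ') * γ := by linear_combination δ * c2
  have m4 : (α * δ - β * γ) * δ' = (δ * α' - β * γ') * δ := by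
    linear_combination δ * c1 - γ * c0
  have e (x y : K) (h : (α * δ - β * γ) * x = (δ * α' - β * γ') * y) :
      x = (δ * α' - β * γ') / (α * δ - β * γ) * y := by
    rw [div_mul_eq_mul_div, eq_div_iff hd]
    linear_combination h
  refine ⟨(δ * α' - β * γ') / (α * δ - β * γ), fun h0 ↦ ?_, e _ _ m1, e _ _ m2, e _ _ m3, e _ _ m4⟩
  have h1 := e _ _ m1
  have h2 := e _ _ m2
  rw [h0, zero_mul] at h1 h2
  apply hd'
  rw [h1, h2]
  ring

theorem exists_isMobius (D : Parametrization X l F K) (σ : K ≃ₐ[l] K) :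
    ∃ α β γ δ, D.IsMobius σ α β γ δ := by
  obtain ⟨α, β, γ, δ, h1, h2⟩ := exists_mobius D.iso σ
  exact ⟨α, β, γ, δ, h1, h2⟩

/-- The element `a` transforms under the Galois group like the coordinate of `D`. -/
def IsPoint (D : Parametrization X l F K) (a : K ⊗[l] R) : Prop :=
  ∀ {σ : K ≃ₐ[l] K} {α β γ δ : K}, D.IsMobius σ α β γ δ →
    (γ ⊗ₜ 1 * a + δ ⊗ₜ 1) * galAct R σ a = α ⊗ₜ 1 * a + β ⊗ₜ 1

/-- The elements `A` and `B` define Galois invariant coordinates on the complement of `a`. -/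
def IsFrame (D : Parametrization X l F K) (a A B : K ⊗[l] R) : Prop :=
  ∀ {σ : K ≃ₐ[l] K} {α β γ δ : K}, D.IsMobius σ α β γ δ →
    (γ ⊗ₜ 1 * a + δ ⊗ₜ 1) ^ 2 * galAct R σ A = (α * δ - β * γ) ⊗ₜ 1 * A ∧
    (γ ⊗ₜ 1 * a + δ ⊗ₜ 1) * galAct R σ B = (γ ⊗ₜ 1 * a + δ ⊗ₜ 1) * B - γ ⊗ₜ 1 * A

theorem tmul_one_eq_algebraMap (c : K) : (c ⊗ₜ 1 : K ⊗[l] R) = algebraMap K _ c := rfl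

theorem galAct_algebraMap (σ : K ≃ₐ[l] K) (c : K) :
    galAct R σ (algebraMap K _ c) = algebraMap K _ (σ c) := galAct_tmul _ _ _

/-- Its use is that `γ a + δ` is a unit: a point with finite coordinate has finite conjugates. -/
theorem IsPoint.map_mul_sub {a : K ⊗[l] R} (ha : D.IsPoint a) {σ : K ≃ₐ[l] K} {α β γ δ : K}
    (h : D.IsMobius σ α β γ δ) :
    (γ ⊗ₜ 1 * a + δ ⊗ₜ 1) * (α ⊗ₜ 1 - γ ⊗ₜ 1 * galAct R σ a) = (α * δ - β * γ) ⊗ₜ 1 := by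
  have := ha h
  simp only [tmul_one_eq_algebraMap, map_sub, map_mul] at this ⊢
  linear_combination -algebraMap K (K ⊗[l] R) γ * this

theorem IsMobius.isUnit_det {σ : K ≃ₐ[l] K} {α β γ δ : K} (h : D.IsMobius σ α β γ δ) :
    IsUnit ((α * δ - β * γ) ⊗ₜ 1 : K ⊗[l] R) :=
  (IsUnit.mk0 _ h.det_ne_zero).map (algebraMap K (K ⊗[l] R))

theorem IsPoint.isUnit {a : K ⊗[l] R} (ha : D.IsPoint a) {σ : K ≃ₐ[l] K} {α β γ δ : K}
    (h : D.IsMobius σ α β γ δ) : IsUnit (γ ⊗ₜ 1 * a + δ ⊗ₜ 1 : K ⊗[l] R) :=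
  isUnit_of_mul_isUnit_left (ha.map_mul_sub h ▸ h.isUnit_det)

theorem IsPoint.galAct_sub {a b : K ⊗[l] R} (ha : D.IsPoint a) (hb : D.IsPoint b)
    {σ : K ≃ₐ[l] K} {α β γ δ : K} (h : D.IsMobius σ α β γ δ) :
    (γ ⊗ₜ 1 * a + δ ⊗ₜ 1) * (γ ⊗ₜ 1 * b + δ ⊗ₜ 1) * galAct R σ (b - a) =
      (α * δ - β * γ) ⊗ₜ 1 * (b - a) := by
  have h1 := ha h
  have h2 := hb h
  simp only [tmul_one_eq_algebraMap, map_sub, map_mul] at h1 h2 ⊢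
  linear_combination (algebraMap K (K ⊗[l] R) γ * a + algebraMap K (K ⊗[l] R) δ) * h2 -
    (algebraMap K (K ⊗[l] R) γ * b + algebraMap K (K ⊗[l] R) δ) * h1

/-- The factor is the same as for `b - a` in `IsPoint.galAct_sub`. So `(A + B (b - a) : b - a)`, the
position of `b` in the frame, is Galois invariant. -/
theorem IsFrame.galAct_add {a b A B : K ⊗[l] R} (hA : D.IsFrame a A B) (ha : D.IsPoint a)
    (hb : D.IsPoint b) {σ : K ≃ₐ[l] K} {α β γ δ : K} (h : D.IsMobius σ α β γ δ) :
    (γ ⊗ₜ 1 * a + δ ⊗ₜ 1) * (γ ⊗ₜ 1 * b + δ ⊗ₜ 1) * galAct R σ (A + B * (b - a)) =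
      (α * δ - β * γ) ⊗ₜ 1 * (A + B * (b - a)) := by
  have h1 := (hA h).1
  have h2 := (hA h).2
  have h3 := ha.galAct_sub hb h
  apply (ha.isUnit h).mul_left_cancel
  rw [map_add, map_mul]
  generalize galAct R σ (b - a) = s at *
  simp only [tmul_one_eq_algebraMap] at *
  linear_combination (algebraMap K (K ⊗[l] R) γ * b + algebraMap K (K ⊗[l] R) δ) * h1 +
    (algebraMap K (K ⊗[l] R) γ * a + algebraMap K (K ⊗[l] R) δ) * galAct R σ B * h3 +
    (algebraMap K (K ⊗[l] R) (α * δ - β * γ)) * (b - a) * h2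

/-- The substitution `(x : y) ↦ (a (x - B y) + A y : x - B y)` has determinant `-A`, a unit, and
sends `(1 : 0)` to `a`. The frame relations say that it turns the trivial Galois action into the
twisted one, up to the unit `(γ a + δ)⁻¹`. -/
theorem IsFrame.exists_value [X.IsSeparated] [FiniteDimensional l K] [IsGalois l K]
    {a A B : K ⊗[l] R} (hA : D.IsFrame a A B) (ha : D.IsPoint a) (hu : IsUnit A)
    {x y : K ⊗[l] R} (hxy : IsCoprime x y) (hx : ∀ σ, galAct R σ x = x)
    (hy : ∀ σ, galAct R σ y = y) :
    ∃ f : Spec (.of R) ⟶ X, D.Value Algebra.TensorProduct.includeLeftRingHom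
      (a * (x - B * y) + A * y) (x - B * y) (Spec.map (CommRingCat.ofHom
        (Algebra.TensorProduct.includeRight : R →ₐ[l] K ⊗[l] R).toRingHom) ≫ f) := by
  refine exists_value_of_galois ?_ fun σ ↦ ?_
  · obtain ⟨p, q, hpq⟩ := hxy
    obtain ⟨A', hA'⟩ := isUnit_iff_exists_inv.mp hu
    refine ⟨(p * B + q) * A', p - (p * B + q) * A' * a, ?_⟩
    linear_combination hpq + (p * B + q) * y * hA'
  · obtain ⟨α, β, γ, δ, h⟩ := D.exists_isMobius σ
    obtain ⟨c, hc⟩ := isUnit_iff_exists_inv.mp (ha.isUnit h)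
    refine ⟨α, β, γ, δ, h, c, .of_mul_eq_one_right _ hc, ?_⟩
    have h1 := (hA h).1
    have h2 := (hA h).2
    have h3 := ha h
    have e : (γ ⊗ₜ 1 * a + δ ⊗ₜ 1) * galAct R σ (x - B * y) =
        γ ⊗ₜ 1 * (a * (x - B * y) + A * y) + δ ⊗ₜ 1 * (x - B * y) := by
      rw [map_sub, map_mul, hx, hy]
      linear_combination -y * h2
    refine ⟨?_, ?_⟩
    · have e' : (γ ⊗ₜ 1 * a + δ ⊗ₜ 1) ^ 2 * galAct R σ (a * (x - B * y) + A * y) =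
        (γ ⊗ₜ 1 * a + δ ⊗ₜ 1) * (α ⊗ₜ 1 * (a * (x - B * y) + A * y) + β ⊗ₜ 1 * (x - B * y)) := by
        rw [map_add, map_mul, map_mul, hy]
        generalize galAct R σ (x - B * y) = s at *
        simp only [tmul_one_eq_algebraMap, map_sub, map_mul] at *
        linear_combination (algebraMap K (K ⊗[l] R) γ * a + algebraMap K (K ⊗[l] R) δ) *
          galAct R σ a * e + (algebraMap K (K ⊗[l] R) γ * (a * (x - B * y) + A * y) +
          algebraMap K (K ⊗[l] R) δ * (x - B * y)) * h3 + y * h1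
      have e'' : (γ ⊗ₜ 1 * a + δ ⊗ₜ 1) * galAct R σ (a * (x - B * y) + A * y) =
          α ⊗ₜ 1 * (a * (x - B * y) + A * y) + β ⊗ₜ 1 * (x - B * y) := by
        apply (ha.isUnit h).mul_left_cancel
        linear_combination e'
      linear_combination c * e'' - galAct R σ (a * (x - B * y) + A * y) * hc
    · linear_combination c * e - galAct R σ (x - B * y) * hc

end Parametrization

end

/-! ### Existence of frames by averaging -/

section

open TensorProduct

/-- Multiply by an element `c` of trace `1` and sum over the Galois group: the sum is the invariant
element itself, and any such sum lies in `R`. -/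
theorem exists_eq_tmul_of_galAct_eq {l K R : Type*} [Field l] [Field K] [Algebra l K]
    [FiniteDimensional l K] [IsGalois l K] [CommRing R] [Algebra l R] {x : K ⊗[l] R}
    (hx : ∀ σ, galAct R σ x = x) : ∃ r : R, x = 1 ⊗ₜ r := by
  obtain ⟨c, hc⟩ := Algebra.trace_surjective l K 1
  have h (y : K ⊗[l] R) : ∃ r : R, ∑ σ, galAct R σ y = 1 ⊗ₜ r := by
    induction y using TensorProduct.induction_on with
    | zero => exact ⟨0, by simp⟩
    | add x y hx hy =>
      obtain ⟨r, hr⟩ := hx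
      obtain ⟨s, hs⟩ := hy
      exact ⟨r + s, by simp_rw [map_add, Finset.sum_add_distrib, hr, hs, TensorProduct.tmul_add]⟩
    | tmul x y =>
      refine ⟨Algebra.trace l K x • y, ?_⟩
      simp_rw [galAct_tmul]
      rw [← TensorProduct.sum_tmul, ← trace_eq_sum_automorphisms, Algebra.algebraMap_eq_smul_one,
        TensorProduct.smul_tmul]
  obtain ⟨r, hr⟩ := h (c ⊗ₜ 1 * x)
  refine ⟨r, hr ▸ ?_⟩
  simp_rw [map_mul, hx, galAct_tmul]
  rw [← Finset.sum_mul, ← TensorProduct.sum_tmul, ← trace_eq_sum_automorphisms, hc, map_one,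
    ← Algebra.TensorProduct.one_def, one_mul]

/-- The norm of `x` is invariant, hence comes from `R`. Each conjugate is a unit times `x`, so the
norm stays outside the prime `P`. -/
theorem exists_dvd_tmul {l K R : Type*} [Field l] [Field K] [Algebra l K]
    [FiniteDimensional l K] [IsGalois l K] [CommRing R] [Algebra l R] {x : K ⊗[l] R}
    (hx : ∀ σ, ∃ c, IsUnit c ∧ galAct R σ x = c * x) (P : Ideal (K ⊗[l] R)) [hP : P.IsPrime]
    (hxP : x ∉ P) : ∃ r : R, x ∣ 1 ⊗ₜ r ∧ (1 ⊗ₜ r : K ⊗[l] R) ∉ P := by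
  have h1 (τ : K ≃ₐ[l] K) : galAct R τ (∏ σ, galAct R σ x) = ∏ σ, galAct R σ x := by
    rw [map_prod]
    refine Fintype.prod_equiv (Equiv.mulLeft τ) _ _ fun σ ↦ ?_
    exact (galAct_mul σ τ x).symm
  obtain ⟨r, hr⟩ := exists_eq_tmul_of_galAct_eq h1
  refine ⟨r, hr ▸ ?_, hr ▸ ?_⟩
  · have h2 : galAct R 1 x = x := by
      have (y : K ⊗[l] R) : galAct R 1 y = y := by
        induction y using TensorProduct.induction_on with
        | zero => simp
        | add x y hx hy => rw [map_add, hx, hy]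
        | tmul x y => simp
      exact this x
    exact h2.symm.dvd.trans (Finset.dvd_prod_of_mem _ (Finset.mem_univ 1))
  · intro h
    obtain ⟨σ, -, hσ⟩ := hP.prod_mem_iff.mp h
    obtain ⟨c, hc, hcx⟩ := hx σ
    rw [hcx] at hσ
    exact hxP ((Ideal.unit_mul_mem_iff_mem _ hc).mp hσ)

/-- Otherwise the images of the `p i` in the fraction field of `B ⧸ P` give a linear relation among
distinct characters of `K`. Independence of characters forces `p i ∈ P`, impossible for a unit. -/
theorem exists_sum_notMem {K B ι : Type*} [Field K] [CommRing B] [Algebra K B] [Fintype ι]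
    [Nonempty ι] (σ : ι → K →+* K) (hσ : Function.Injective σ) (p : ι → B) (hp : ∀ i, IsUnit (p i))
    (P : Ideal B) [hP : P.IsPrime] : ∃ c : K, ∑ i, algebraMap K B (σ i c) * p i ∉ P := by
  by_contra! h
  let κ := FractionRing (B ⧸ P)
  let q : B →+* κ := (algebraMap (B ⧸ P) κ).comp (Ideal.Quotient.mk P)
  have hq (b : B) : q b = 0 ↔ b ∈ P := by
    rw [← Ideal.Quotient.eq_zero_iff_mem, RingHom.comp_apply,
      map_eq_zero_iff _ (IsFractionRing.injective (B ⧸ P) κ)]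
  let f (i : ι) : K →* κ := ((q.comp (algebraMap K B)).comp (σ i) : K →+* κ)
  have hf : Function.Injective f := fun i j hij ↦ hσ <| RingHom.ext fun x ↦
    (q.comp (algebraMap K B)).injective (DFunLike.congr_fun hij x)
  have h1 := Fintype.linearIndependent_iff.mp ((linearIndependent_monoidHom K κ).comp f hf)
    (fun i ↦ q (p i)) (by
      ext c
      have h2 := (hq _).mpr (h c)
      rw [map_sum] at h2
      simp only [map_mul] at h2
      simp only [Function.comp_def, Finset.sum_apply, Pi.smul_apply, smul_eq_mul, Pi.zero_apply]
      rw [← h2]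
      refine Finset.sum_congr rfl fun i _ ↦ mul_comm _ _)
  have i := Classical.arbitrary ι
  exact hP.ne_top (Ideal.eq_top_of_isUnit_mem _ ((hq _).mp (h1 i)) (hp i))

namespace Parametrization

variable {X : Scheme.{u}} {l F K R : Type u} [Field l] [Field F] [Field K] [CommRing R]
  [Algebra l F] [Algebra l K] [Algebra l R] {D : Parametrization X l F K}

/-- The frame relations say that `(A, B)` is fixed by the twisted action `σ • (A, B) = (p σ * σ A, σ
B + q σ * σ A)`. The sum over the orbit of `(c, 0)` is fixed, and `exists_sum_notMem` supplies a `c`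
with `A ∉ P`. -/
theorem exists_isFrame [FiniteDimensional l K] {a : K ⊗[l] R} (ha : D.IsPoint a)
    (P : Ideal (K ⊗[l] R)) [P.IsPrime] : ∃ A B, D.IsFrame a A B ∧ A ∉ P := by
  choose α β γ δ hm using D.exists_isMobius
  let ι : K →+* K ⊗[l] R := algebraMap K (K ⊗[l] R)
  have hι (c : K) : c ⊗ₜ 1 = ι c := rfl
  let v (σ) := ι (γ σ) * a + ι (δ σ)
  let Δ (σ) := α σ * δ σ - β σ * γ σ
  have hΔ (σ) : Δ σ ≠ 0 := (hm σ).det_ne_zero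
  let p (σ) := ι (Δ σ)⁻¹ * v σ ^ 2
  let q (σ) := ι ((Δ σ)⁻¹ * γ σ) * v σ
  have hp (σ) : IsUnit (p σ) :=
    ((IsUnit.mk0 _ (inv_ne_zero (hΔ σ))).map ι).mul ((ha.isUnit (hm σ)).pow 2)
  obtain ⟨c, hc⟩ := exists_sum_notMem (fun σ : K ≃ₐ[l] K ↦ (σ : K →+* K))
    (fun σ τ h ↦ AlgEquiv.ext fun x ↦ DFunLike.congr_fun h x) p hp P
  refine ⟨_, ∑ σ, ι (σ c) * q σ, fun {τ α' β' γ' δ'} h ↦ ?_, hc⟩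
  -- These are the cocycle identities for the action. The scalar `μ` by which the two matrices of `τ
  -- * σ` differ cancels, as `p` and `q` have degree `0` in the matrix.
  have key (σ) : (ι γ' * a + ι δ') ^ 2 * galAct R τ (p σ) = ι (α' * δ' - β' * γ') * p (τ * σ) ∧
      (ι γ' * a + ι δ') * galAct R τ (q σ) =
        (ι γ' * a + ι δ') * q (τ * σ) - ι γ' * p (τ * σ) := by
    obtain ⟨μ, hμ, e1, e2, e3, e4⟩ := ((hm σ).comp h).unique (hm (τ * σ))
    have hΔ' := h.det_ne_zero
    have hv : v (τ * σ) = ι μ * (ι γ' * a + ι δ') * galAct R τ (v σ) := by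
      have := ha h
      simp only [v, e3, e4, map_add, map_mul, hι, ι, galAct_algebraMap] at this ⊢
      linear_combination -algebraMap K (K ⊗[l] R) μ * algebraMap K (K ⊗[l] R) (τ (γ σ)) * this
    have hD : Δ (τ * σ) = μ ^ 2 * τ (Δ σ) * (α' * δ' - β' * γ') := by
      simp only [Δ, e1, e2, e3, e4, map_sub, map_mul]
      ring
    have hi : (τ (Δ σ))⁻¹ = (α' * δ' - β' * γ') * (Δ (τ * σ))⁻¹ * μ ^ 2 := by
      have := (map_ne_zero τ).mpr (hΔ σ)
      rw [hD]
      field_simp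
    have hp' : galAct R τ (p σ) =
        ι (α' * δ' - β' * γ') * ι (Δ (τ * σ))⁻¹ * ι μ ^ 2 * galAct R τ (v σ) ^ 2 := by
      simp only [p, map_mul, map_pow, ι, galAct_algebraMap, map_inv₀, hi]
    have hq' : galAct R τ (q σ) = ι (α' * δ' - β' * γ') * ι (Δ (τ * σ))⁻¹ * ι μ ^ 2 *
        ι (τ (γ σ)) * galAct R τ (v σ) := by
      simp only [q, map_mul, map_pow, ι, galAct_algebraMap, map_inv₀, hi]
    have hγ : ι (γ (τ * σ)) = ι μ * (ι (τ (γ σ)) * ι α' + ι (τ (δ σ)) * ι γ') := by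
      simp only [e3, map_mul, map_add]
    have hτv : galAct R τ (v σ) = ι (τ (γ σ)) * galAct R τ a + ι (τ (δ σ)) := by
      simp only [v, map_mul, map_add, ι, galAct_algebraMap]
    have hΔv := ha.map_mul_sub h
    simp only [hι] at hΔv
    refine ⟨?_, ?_⟩
    · rw [hp']
      simp only [p, hv]
      ring
    · rw [hq', ← hΔv]
      simp only [p, q, hv, map_mul ι (Δ (τ * σ))⁻¹, hγ]
      rw [hτv]
      ring
  have hsum (f : (K ≃ₐ[l] K) → K ⊗[l] R) :
      galAct R τ (∑ σ, ι (σ c) * f σ) = ∑ σ, ι ((τ * σ) c) * galAct R τ (f σ) := by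
    rw [map_sum]
    refine Finset.sum_congr rfl fun σ _ ↦ ?_
    rw [map_mul, galAct_algebraMap]
    rfl
  have hsum' (f : (K ≃ₐ[l] K) → K ⊗[l] R) :
      ∑ σ, ι ((τ * σ) c) * f (τ * σ) = ∑ σ, ι (σ c) * f σ :=
    Fintype.sum_equiv (Equiv.mulLeft τ) _ _ fun σ ↦ rfl
  refine ⟨?_, ?_⟩
  · change (ι γ' * a + ι δ') ^ 2 * galAct R τ (∑ σ, ι (σ c) * p σ) =
      ι (α' * δ' - β' * γ') * ∑ σ, ι (σ c) * p σ
    rw [hsum, ← hsum', Finset.mul_sum, Finset.mul_sum]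
    refine Finset.sum_congr rfl fun σ _ ↦ ?_
    linear_combination ι ((τ * σ) c) * (key σ).1
  · change (ι γ' * a + ι δ') * galAct R τ (∑ σ, ι (σ c) * q σ) =
      (ι γ' * a + ι δ') * ∑ σ, ι (σ c) * q σ - ι γ' * ∑ σ, ι (σ c) * p σ
    rw [hsum, ← hsum', ← hsum', Finset.mul_sum, Finset.mul_sum, Finset.mul_sum,
      ← Finset.sum_sub_distrib]
    refine Finset.sum_congr rfl fun σ _ ↦ ?_
    linear_combination ι ((τ * σ) c) * (key σ).2

end Parametrization

end

/-! ### Straight-line homotopies on the twisted projective line -/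

section

open TensorProduct

/-- The base change to `K` of a morphism of `l`-algebras. -/
abbrev extend (K : Type*) {l R R' : Type*} [Field l] [Field K] [Algebra l K] [CommRing R]
    [Algebra l R] [CommRing R'] [Algebra l R'] (φ : R →ₐ[l] R') : K ⊗[l] R →ₐ[K] K ⊗[l] R' :=
  Algebra.TensorProduct.map (AlgHom.id K K) φ

theorem galAct_extend {l K R R' : Type*} [Field l] [Field K] [Algebra l K] [CommRing R]
    [Algebra l R] [CommRing R'] [Algebra l R'] (φ : R →ₐ[l] R') (σ : K ≃ₐ[l] K) (x : K ⊗[l] R) :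
    galAct R' σ (extend K φ x) = extend K φ (galAct R σ x) := by
  induction x using TensorProduct.induction_on with
  | zero => simp
  | add x y hx hy => simp only [map_add, hx, hy]
  | tmul x y => simp

/-- The projection from the base change to `K`. -/
abbrev baseProj (l K R : Type u) [Field l] [Field K] [Algebra l K] [CommRing R] [Algebra l R] :
    Spec (.of (K ⊗[l] R)) ⟶ Spec (.of R) :=
  Spec.map (CommRingCat.ofHom (Algebra.TensorProduct.includeRight : R →ₐ[l] K ⊗[l] R).toRingHom)

namespace Parametrization

variable {X : Scheme.{u}} {l F K R R' : Type u} [Field l] [Field F] [Field K] [CommRing R]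
  [Algebra l F] [Algebra l K] [Algebra l R] [CommRing R'] [Algebra l R']
  {D : Parametrization X l F K}

theorem IsPoint.extend {a : K ⊗[l] R} (ha : D.IsPoint a) (φ : R →ₐ[l] R') :
    D.IsPoint (extend K φ a) := by
  intro σ α β γ δ h
  have := congrArg (A1Chain.extend K φ) (ha h)
  simp only [tmul_one_eq_algebraMap, map_add, map_mul, AlgHom.commutes] at this ⊢
  rw [galAct_extend]
  exact this

theorem IsFrame.extend {a A B : K ⊗[l] R} (h : D.IsFrame a A B) (φ : R →ₐ[l] R') :
    D.IsFrame (extend K φ a) (extend K φ A) (extend K φ B) := by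
  intro σ α β γ δ hσ
  have h1 := congrArg (A1Chain.extend K φ) (h hσ).1
  have h2 := congrArg (A1Chain.extend K φ) (h hσ).2
  simp only [tmul_one_eq_algebraMap, map_add, map_mul, map_pow, map_sub, AlgHom.commutes]
    at h1 h2 ⊢
  rw [galAct_extend, galAct_extend]
  exact ⟨h1, h2⟩

/-- At a prime `P` over `p`, with `A ∉ P`, the two frame coordinates `b - a` and `A + B (b - a)` of
`b` cannot both vanish. A norm (`exists_dvd_tmul`) provides an element of `R` whose inversion makes
`A` and the nonvanishing coordinate units. -/
theorem exists_isFrame_dvd [FiniteDimensional l K] [IsGalois l K] {a b : K ⊗[l] R}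
    (ha : D.IsPoint a) (hb : D.IsPoint b) (p : Ideal R) [hp : p.IsPrime] :
    ∃ A B, D.IsFrame a A B ∧ ∃ r ∉ p,
      A * (b - a) ∣ 1 ⊗ₜ r ∨ A * (A + B * (b - a)) ∣ 1 ⊗ₜ r := by
  obtain ⟨_, hs⟩ := flat_surjective_specMap_includeRight l K R
  obtain ⟨⟨P, hP⟩, hPp⟩ := hs.1 (⟨p, hp⟩ : PrimeSpectrum R)
  replace hPp (r : R) : (1 ⊗ₜ r : K ⊗[l] R) ∈ P ↔ r ∈ p :=
    SetLike.ext_iff.mp (congrArg PrimeSpectrum.asIdeal hPp) r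
  obtain ⟨A, B, hA, hAP⟩ := exists_isFrame ha P
  refine ⟨A, B, hA, ?_⟩
  have key (d : K ⊗[l] R) (hd : d ∉ P) (hσ : ∀ {σ : K ≃ₐ[l] K} {α β γ δ : K},
      D.IsMobius σ α β γ δ → (γ ⊗ₜ 1 * a + δ ⊗ₜ 1) * (γ ⊗ₜ 1 * b + δ ⊗ₜ 1) * galAct R σ d =
        (α * δ - β * γ) ⊗ₜ 1 * d) : ∃ r ∉ p, A * d ∣ 1 ⊗ₜ r := by
    obtain ⟨r, h1, h2⟩ := exists_dvd_tmul (x := A * d) (fun σ ↦ by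
      obtain ⟨α, β, γ, δ, h⟩ := D.exists_isMobius σ
      obtain ⟨v, hv⟩ := isUnit_iff_exists_inv.mp (ha.isUnit h)
      obtain ⟨w, hw⟩ := isUnit_iff_exists_inv.mp (hb.isUnit h)
      refine ⟨v ^ 3 * w * ((α * δ - β * γ) ⊗ₜ 1) ^ 2, ?_, ?_⟩
      · exact (((IsUnit.of_mul_eq_one_right _ hv).pow 3).mul (.of_mul_eq_one_right _ hw)).mul
          (h.isUnit_det.pow 2)
      · have h1 := (hA h).1
        have h2 := hσ h
        rw [map_mul]
        have h3 : galAct R σ A = v ^ 2 * ((α * δ - β * γ) ⊗ₜ 1 * A) := by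
          rw [← h1]
          linear_combination -((γ ⊗ₜ 1 * a + δ ⊗ₜ 1) * v + 1) * galAct R σ A * hv
        have h4 : galAct R σ d = v * w * ((α * δ - β * γ) ⊗ₜ 1 * d) := by
          rw [← h2]
          linear_combination -(γ ⊗ₜ 1 * b + δ ⊗ₜ 1) * w * galAct R σ d * hv - galAct R σ d * hw
        rw [h3, h4]
        ring) P
      (fun h ↦ (hP.mem_or_mem h).elim hAP hd)
    exact ⟨r, fun h ↦ h2 ((hPp r).mpr h), h1⟩
  by_cases hd : b - a ∈ P
  · obtain ⟨r, hr, h⟩ := key (A + B * (b - a))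
      (fun h ↦ hAP ((Ideal.add_mem_iff_left _ (Ideal.mul_mem_left _ _ hd)).mp h))
      (fun h ↦ hA.galAct_add ha hb h)
    exact ⟨r, hr, .inr h⟩
  · obtain ⟨r, hr, h⟩ := key (b - a) hd (fun h ↦ ha.galAct_sub hb h)
    exact ⟨r, hr, .inl h⟩

variable [X.IsSeparated]

theorem Value.extend {a b : K ⊗[l] R} {f : Spec (.of R) ⟶ X}
    (h : D.Value Algebra.TensorProduct.includeLeftRingHom a b (baseProj l K R ≫ f))
    (φ : R →ₐ[l] R') : D.Value Algebra.TensorProduct.includeLeftRingHom (extend K φ a)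
      (extend K φ b) (baseProj l K R' ≫ Spec.map (CommRingCat.ofHom φ.toRingHom) ≫ f) := by
  have h1 := h.map (A1Chain.extend K φ : K ⊗[l] R →+* K ⊗[l] R')
  have e1 : (A1Chain.extend K φ : K ⊗[l] R →+* K ⊗[l] R').comp
      Algebra.TensorProduct.includeLeftRingHom = Algebra.TensorProduct.includeLeftRingHom :=
    RingHom.ext fun x ↦ (A1Chain.extend K φ).commutes x
  have e2 : (A1Chain.extend K φ : K ⊗[l] R →+* K ⊗[l] R').comp
      (Algebra.TensorProduct.includeRight : R →ₐ[l] K ⊗[l] R).toRingHom =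
      (Algebra.TensorProduct.includeRight : R' →ₐ[l] K ⊗[l] R').toRingHom.comp φ.toRingHom := by
    ext x
    simp
  rw [e1, ← Spec.map_comp_assoc, ← CommRingCat.ofHom_comp, e2, CommRingCat.ofHom_comp,
    Spec.map_comp_assoc] at h1
  exact h1

/-- In frame coordinates `(x : y)` is an invariant path from `(1 : 0)`, the position of `a`, to the
position of `b`. The unit `v` is the scaling of homogeneous coordinates at time `1`. -/
theorem exists_homotopy_of_invariant [FiniteDimensional l K] [IsGalois l K] {a b A B : K ⊗[l] R}
    (ha : D.IsPoint a) (hA : D.IsFrame a A B) (hu : IsUnit A) {f g : Spec (.of R) ⟶ X}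
    (hf : D.Value Algebra.TensorProduct.includeLeftRingHom a 1 (baseProj l K R ≫ f))
    (hg : D.Value Algebra.TensorProduct.includeLeftRingHom b 1 (baseProj l K R ≫ g))
    {x y : K ⊗[l] (Polynomial R)} (hxy : IsCoprime x y) (hx : ∀ σ, galAct _ σ x = x)
    (hy : ∀ σ, galAct _ σ y = y)
    (ev : R → Polynomial R →ₐ[l] R) (hev : ∀ r, (ev r).toRingHom = Polynomial.evalRingHom r)
    (hx0 : extend K (ev 0) x = 1) (hy0 : extend K (ev 0) y = 0) {v : K ⊗[l] R} (hv : IsUnit v)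
    (hv1 : a * (extend K (ev 1) x - B * extend K (ev 1) y) + A * extend K (ev 1) y = v * b)
    (hv2 : extend K (ev 1) x - B * extend K (ev 1) y = v) :
    ∃ H : Spec (.of (Polynomial R)) ⟶ X,
      Spec.map (CommRingCat.ofHom (Polynomial.evalRingHom 0)) ≫ H = f ∧
      Spec.map (CommRingCat.ofHom (Polynomial.evalRingHom 1)) ≫ H = g := by
  let C : R →ₐ[l] Polynomial R := Algebra.algHom l R (Polynomial R)
  obtain ⟨H, hH⟩ := IsFrame.exists_value (hA.extend C) (ha.extend C) (hu.map (A1Chain.extend K C)) hxy hx hy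
  have hC (r : R) (z : K ⊗[l] R) : A1Chain.extend K (ev r) (A1Chain.extend K C z) = z := by
    have h1 : (ev r).comp C = AlgHom.id l R := by
      ext s
      have : (ev r).toRingHom (Polynomial.C s) = s := by
        rw [hev]
        simp
      exact this
    have h2 := Algebra.TensorProduct.map_comp (AlgHom.id K K) (AlgHom.id K K) (ev r) C
    rw [h1, AlgHom.comp_id, Algebra.TensorProduct.map_id] at h2
    exact (DFunLike.congr_fun h2 z).symm
  have h0 := hH.extend (ev 0)
  have h1 := hH.extend (ev 1)
  rw [hv2] at hv1
  simp only [map_add, map_sub, map_mul, hC, hx0, hy0, hv1, hv2] at h0 h1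
  simp only [mul_zero, sub_zero, mul_one, add_zero] at h0
  have h2 := hg.smul hv
  rw [mul_one] at h2
  rw [← hev, ← hev]
  exact ⟨H, h0.right_unique hf, h1.right_unique h2⟩

theorem galAct_mul_inv_eq {σ : K ≃ₐ[l] K} {x y y' : K ⊗[l] R}
    (h : galAct R σ x * y = x * galAct R σ y) (hy : y * y' = 1) :
    galAct R σ (x * y') = x * y' := by
  have h1 := congrArg (galAct R σ) hy
  rw [map_mul, map_one] at h1
  rw [map_mul]
  linear_combination galAct R σ y' * y' * h + x * y' * h1 - galAct R σ x * galAct R σ y' * hy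

theorem exists_homotopy [FiniteDimensional l K] [IsGalois l K] {a b A B : K ⊗[l] R}
    (ha : D.IsPoint a) (hb : D.IsPoint b) (hA : D.IsFrame a A B) (hu : IsUnit A)
    (h : IsUnit (b - a) ∨ IsUnit (A + B * (b - a))) {f g : Spec (.of R) ⟶ X}
    (hf : D.Value Algebra.TensorProduct.includeLeftRingHom a 1 (baseProj l K R ≫ f))
    (hg : D.Value Algebra.TensorProduct.includeLeftRingHom b 1 (baseProj l K R ≫ g)) :
    ∃ H : Spec (.of (Polynomial R)) ⟶ X,
      Spec.map (CommRingCat.ofHom (Polynomial.evalRingHom 0)) ≫ H = f ∧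
      Spec.map (CommRingCat.ofHom (Polynomial.evalRingHom 1)) ≫ H = g := by
  let ev (r : R) : Polynomial R →ₐ[l] R := (Polynomial.aeval r).restrictScalars l
  have hev (r : R) : (ev r).toRingHom = Polynomial.evalRingHom r := by
    ext x
    · simp [ev]
    · simp [ev]
  let C : R →ₐ[l] Polynomial R := Algebra.algHom l R (Polynomial R)
  have hC (r : R) (z : K ⊗[l] R) : A1Chain.extend K (ev r) (A1Chain.extend K C z) = z := by
    induction z using TensorProduct.induction_on with
    | zero => simp
    | add x y hx hy => simp only [map_add, hx, hy]
    | tmul x y =>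
      have : ev r (C y) = y := Polynomial.aeval_C r y
      simp [this]
  let t : K ⊗[l] Polynomial R := 1 ⊗ₜ Polynomial.X
  have ht (r : R) : A1Chain.extend K (ev r) t = 1 ⊗ₜ r := by simp [t, ev]
  have hσt (σ : K ≃ₐ[l] K) : galAct _ σ t = t := by simp [t]
  have key {σ : K ≃ₐ[l] K} : galAct R σ (A + B * (b - a)) * (b - a) =
      (A + B * (b - a)) * galAct R σ (b - a) := by
    obtain ⟨α, β, γ, δ, h⟩ := D.exists_isMobius σ
    have h1 := ha.galAct_sub hb h
    have h2 := hA.galAct_add ha hb h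
    apply ((ha.isUnit h).mul (hb.isUnit h)).mul_left_cancel
    generalize galAct R σ (b - a) = s at *
    generalize galAct R σ (A + B * (b - a)) = s' at *
    linear_combination (b - a) * h2 - (A + B * (b - a)) * h1
  obtain h | h := h
  · obtain ⟨d, hd⟩ := isUnit_iff_exists_inv.mp h
    -- Here `b` is at `(w : 1)` and the path is `(1 - t + t w : t)`. At `t = 1`, `x - B y = w - B =
    -- A d`, which explains `v`.
    let w := (A + B * (b - a)) * d
    have hw (σ : K ≃ₐ[l] K) : galAct R σ w = w := galAct_mul_inv_eq key hd
    refine exists_homotopy_of_invariant ha hA hu hf hg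
      (x := 1 - t + t * A1Chain.extend K C w) (y := t) ⟨1, 1 - A1Chain.extend K C w, by ring⟩
      (fun σ ↦ ?_) hσt ev hev ?_ ?_ (v := A * d)
      (hu.mul (.of_mul_eq_one_right _ hd)) ?_ ?_
    · simp only [map_add, map_sub, map_mul, map_one, hσt, galAct_extend, hw]
    · simp [hC, ht]
    · simp [ht]
    · simp only [map_add, map_sub, map_mul, map_one, hC, ht, ← Algebra.TensorProduct.one_def, w]
      linear_combination (a * B - A) * hd
    · simp only [map_add, map_sub, map_mul, map_one, hC, ht, ← Algebra.TensorProduct.one_def, w]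
      linear_combination B * hd
  · obtain ⟨e, he⟩ := isUnit_iff_exists_inv.mp h
    -- Here `b` is at `(1 : w)` and the path is `(1 : t w)`. At `t = 1`, `1 - B w = A e`.
    let w := (b - a) * e
    have hw (σ : K ≃ₐ[l] K) : galAct R σ w = w :=
      galAct_mul_inv_eq (by linear_combination -key (σ := σ)) he
    refine exists_homotopy_of_invariant ha hA hu hf hg
      (x := 1) (y := t * A1Chain.extend K C w) isCoprime_one_left
      (fun σ ↦ map_one _) (fun σ ↦ ?_) ev hev (map_one _) ?_ (v := A * e)
      (hu.mul (.of_mul_eq_one_right _ he)) ?_ ?_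
    · simp only [map_mul, hσt, galAct_extend, hw]
    · simp [ht]
    · simp only [map_mul, map_one, hC, ht, ← Algebra.TensorProduct.one_def, w]
      linear_combination -a * he
    · simp only [map_mul, map_one, hC, ht, ← Algebra.TensorProduct.one_def, w]
      linear_combination -he

theorem exists_local_homotopy [FiniteDimensional l K] [IsGalois l K] {a b : K ⊗[l] R}
    (ha : D.IsPoint a) (hb : D.IsPoint b) {f g : Spec (.of R) ⟶ X}
    (hf : D.Value Algebra.TensorProduct.includeLeftRingHom a 1 (baseProj l K R ≫ f))
    (hg : D.Value Algebra.TensorProduct.includeLeftRingHom b 1 (baseProj l K R ≫ g))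
    (p : Ideal R) [hp : p.IsPrime] :
    ∃ r ∉ p, ∃ H : Spec (.of (Polynomial (Localization.Away r))) ⟶ X,
      Spec.map (CommRingCat.ofHom (Polynomial.evalRingHom 0)) ≫ H =
        Spec.map (CommRingCat.ofHom (algebraMap R (Localization.Away r))) ≫ f ∧
      Spec.map (CommRingCat.ofHom (Polynomial.evalRingHom 1)) ≫ H =
        Spec.map (CommRingCat.ofHom (algebraMap R (Localization.Away r))) ≫ g := by
  obtain ⟨A, B, hA, r, hr, h⟩ := exists_isFrame_dvd ha hb p
  let φ : R →ₐ[l] Localization.Away r := IsScalarTower.toAlgHom l R (Localization.Away r)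
  have hu : IsUnit (A1Chain.extend K φ (1 ⊗ₜ r)) := by
    have : A1Chain.extend K φ (1 ⊗ₜ r) =
        Algebra.TensorProduct.includeRight (algebraMap R (Localization.Away r) r) := by simp [φ]
    rw [this]
    exact (IsLocalization.Away.algebraMap_isUnit r).map _
  have h1 := hf.extend φ
  have h2 := hg.extend φ
  rw [map_one] at h1 h2
  have hdvd {x y : K ⊗[l] R} (h : x * y ∣ 1 ⊗ₜ r) :
      IsUnit (A1Chain.extend K φ x) ∧ IsUnit (A1Chain.extend K φ y) := by
    have := isUnit_of_dvd_unit (map_dvd (A1Chain.extend K φ) h) hu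
    rw [map_mul] at this
    exact IsUnit.mul_iff.mp this
  have hA' : IsUnit (A1Chain.extend K φ A) := h.elim (fun h ↦ (hdvd h).1) fun h ↦ (hdvd h).1
  refine ⟨r, hr, exists_homotopy (ha.extend φ) (hb.extend φ) (hA.extend φ) hA'
    (h.imp (fun h ↦ ?_) (fun h ↦ ?_)) h1 h2⟩
  · simpa using (hdvd h).2
  · simpa using (hdvd h).2

end Parametrization

end

/-! ### Integrality of the coordinate away from infinity -/

section

open TensorProduct

/-- Base change along a separable algebraic extension commutes with integral closure. -/
theorem mem_range_extend_of_isIntegral {l K G F : Type u} [Field l] [Field K] [Algebra l K]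
    [FiniteDimensional l K] [Algebra.IsSeparable l K] [CommRing G] [Algebra l G] [Field F]
    [Algebra l F] [Algebra G F] [IsScalarTower l G F]
    (hG : ∀ z : F, _root_.IsIntegral G z → z ∈ Set.range (algebraMap G F)) (x : K ⊗[l] F)
    (hx : (((Algebra.TensorProduct.includeRight : F →ₐ[l] K ⊗[l] F).toRingHom).comp
      (algebraMap G F)).IsIntegralElem x) :
    ∃ a : K ⊗[l] G, extend K (IsScalarTower.toAlgHom l G F) a = x := by
  have := Algebra.FormallyEtale.of_isSeparable l K
  have := Algebra.FinitePresentation.of_finiteType (R := l) (A := K) |>.mp inferInstance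
  have : Algebra.Smooth l K := {}
  let S := G ⊗[l] K
  -- `S = G ⊗ K` is smooth over `G` because `K` is étale over `l`. Under this identification,
  -- integral closure in `F` is compatible with the base change from `G` to `S`.
  let E : S ⊗[G] F ≃+* K ⊗[l] F :=
    (Algebra.TensorProduct.comm G S F).toRingEquiv.trans
      ((Algebra.TensorProduct.cancelBaseChange l G G F K).toRingEquiv.trans
        (Algebra.TensorProduct.comm l F K).toRingEquiv)
  have hE (g : G) (c : K) (z : F) : E ((g ⊗ₜ c) ⊗ₜ z) = c ⊗ₜ (g • z) := by
    change Algebra.TensorProduct.comm l F K (Algebra.TensorProduct.cancelBaseChange l G G F K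
      (z ⊗ₜ (g ⊗ₜ c))) = _
    rw [Algebra.TensorProduct.cancelBaseChange_tmul]
    rfl
  have h1 : IsIntegral G (E.symm x) := by
    obtain ⟨P, hP, hPx⟩ := hx
    refine ⟨P, hP, ?_⟩
    apply E.injective
    have : (E : S ⊗[G] F →+* K ⊗[l] F).comp (algebraMap G (S ⊗[G] F)) =
        ((Algebra.TensorProduct.includeRight : F →ₐ[l] K ⊗[l] F).toRingHom).comp
          (algebraMap G F) := by
      ext g
      change E ((algebraMap G S g) ⊗ₜ 1) = _
      rw [Algebra.TensorProduct.algebraMap_apply, hE]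
      simp [Algebra.smul_def]
    rw [map_zero, ← hPx, ← this]
    have := Polynomial.hom_eval₂ P (algebraMap G (S ⊗[G] F)) (E : S ⊗[G] F →+* K ⊗[l] F) (E.symm x)
    simpa using this
  obtain ⟨w, hw⟩ := (TensorProduct.toIntegralClosure_bijective_of_smooth (R := G) (S := S)
    (B := F)).2 ⟨E.symm x, h1.tower_top⟩
  have hw' : E (TensorProduct.toIntegralClosure G S F w).1 = x := by
    rw [hw]
    exact E.apply_symm_apply x
  rw [← hw']
  clear hw hw'
  have key : ∀ w, ∃ a : K ⊗[l] G, extend K (IsScalarTower.toAlgHom l G F) a =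
      E (TensorProduct.toIntegralClosure G S F w).1 := by
    intro w
    induction w using TensorProduct.induction_on with
    | zero => exact ⟨0, by simp⟩
    | add x y hx hy =>
      obtain ⟨a, ha⟩ := hx
      obtain ⟨b, hb⟩ := hy
      exact ⟨a + b, by simp [ha, hb]⟩
    | tmul s z =>
      obtain ⟨g, hg⟩ := hG z.1 z.2
      have h2 : (TensorProduct.toIntegralClosure G S F (s ⊗ₜ z)).1 = s ⊗ₜ z.1 := rfl
      rw [h2]
      induction s using TensorProduct.induction_on with
      | zero => exact ⟨0, by simp⟩
      | add x y hx hy =>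
        obtain ⟨a, ha⟩ := hx rfl
        obtain ⟨b, hb⟩ := hy rfl
        exact ⟨a + b, by simp [ha, hb, TensorProduct.add_tmul]⟩
      | tmul g' c =>
        refine ⟨c ⊗ₜ (g' * g), ?_⟩
        rw [hE, Algebra.smul_def, ← hg]
        simp
  exact key w

namespace Parametrization

variable {X : Scheme.{u}} {l F K : Type u} [Field l] [Field F] [Field K]
  [Algebra l F] [Algebra l K] [X.IsSeparated] (D : Parametrization X l F K)

/-- An integral coordinate already lies in `K ⊗ G`, since `G` is integrally closed in `F`. The point
relation and the identification of the value are checked after the injection into `K ⊗ F`. -/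
theorem exists_isPoint_of_isIntegral [FiniteDimensional l K] [Algebra.IsSeparable l K]
    {G : Type u} [CommRing G] [Algebra l G] [Algebra G F] [IsScalarTower l G F]
    (hinj : Function.Injective (algebraMap G F))
    (hG : ∀ z : F, _root_.IsIntegral G z → z ∈ Set.range (algebraMap G F))
    (g : Spec (.of G) ⟶ X)
    (hg : Spec.map (CommRingCat.ofHom (algebraMap G F)) ≫ g = D.point)
    (hx : (((Algebra.TensorProduct.includeRight : F →ₐ[l] K ⊗[l] F).toRingHom).comp
      (algebraMap G F)).IsIntegralElem (D.iso RatFunc.X)) :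
    ∃ a : K ⊗[l] G, D.IsPoint a ∧
      D.Value Algebra.TensorProduct.includeLeftRingHom a 1 (baseProj l K G ≫ g) := by
  obtain ⟨a, ha⟩ := mem_range_extend_of_isIntegral hG _ hx
  let j := extend K (IsScalarTower.toAlgHom l G F)
  have hj : Function.Injective j :=
    Module.Flat.lTensor_preserves_injective_linearMap (IsScalarTower.toAlgHom l G F).toLinearMap hinj
  have hdF : IsDomain (K ⊗[l] F) := D.iso.symm.toRingEquiv.toMulEquiv.isDomain _
  have hdG : IsDomain (K ⊗[l] G) := hj.isDomain j.toRingHom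
  refine ⟨a, fun {σ α β γ δ} h ↦ hj ?_, ?_⟩
  · have := h.relation
    simp only [tmul_one_eq_algebraMap, map_add, map_mul, AlgHom.commutes] at this ⊢
    have hσ : j (galAct G σ a) = galAct F σ (D.iso RatFunc.X) := by
      rw [← ha]
      exact (galAct_extend _ _ _).symm
    have hja : j a = D.iso RatFunc.X := ha
    rwa [hσ, hja]
  · have h1 := D.value_zero (Algebra.TensorProduct.includeLeftRingHom : K →+* K ⊗[l] G)
      (mul_one 1) a
    rw [mul_one] at h1
    convert h1 using 1
    have : IsDominant (Spec.map (CommRingCat.ofHom j.toRingHom)) :=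
      isDominant_specMap_of_injective _ hj
    refine ext_of_isDominant (Spec.map (CommRingCat.ofHom j.toRingHom)) ?_
    have e1 : j.toRingHom.comp
        (Algebra.TensorProduct.includeRight : G →ₐ[l] K ⊗[l] G).toRingHom =
        (Algebra.TensorProduct.includeRight : F →ₐ[l] K ⊗[l] F).toRingHom.comp
          (algebraMap G F) := by
      ext x
      simp [j]
    have e2 : j.toRingHom.comp (evalAt (Algebra.TensorProduct.includeLeftRingHom) a) =
        (D.iso : RatFunc K →+* K ⊗[l] F).comp (algebraMap (Polynomial K) (RatFunc K)) := by
      ext x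
      · have := D.iso.commutes x
        simp only [RingHom.comp_apply, Polynomial.coe_eval₂RingHom, Polynomial.eval₂_C]
        exact (j.commutes x).trans (this.symm)
      · simpa [j] using ha
    rw [← Spec.map_comp_assoc, ← Spec.map_comp_assoc, ← CommRingCat.ofHom_comp,
      ← CommRingCat.ofHom_comp, e1, e2, CommRingCat.ofHom_comp, CommRingCat.ofHom_comp,
      Spec.map_comp_assoc, Spec.map_comp_assoc, hg, D.zero_comp, ← Spec.map_comp_assoc,
      ← CommRingCat.ofHom_comp]
    congr 3
    ext x
    exact (D.iso.apply_symm_apply _).symm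

/-- If `X` were not integral, a valuation ring of `K(t)` would contain the integral closure of `B`
but not `X`. Then `X⁻¹` is a non-unit there, so the closed point of the valuation ring maps to the
value at `∞`; yet this image also lies in the range of `i`. -/
theorem isIntegralElem_iso_X {B : Type u} [CommRing B] (β : B →+* F) (i : Spec (.of B) ⟶ X)
    (hi : Spec.map (CommRingCat.ofHom β) ≫ i = D.point)
    (hK : ∀ c : K, ((Algebra.TensorProduct.includeRight : F →ₐ[l] K ⊗[l] F).toRingHom.comp
      β).IsIntegralElem (c ⊗ₜ 1))
    (hy : ∀ q : Spec (.of (Polynomial K)), Polynomial.X ∈ q.asIdeal →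
      D.infty q ∉ Set.range i) :
    ((Algebra.TensorProduct.includeRight : F →ₐ[l] K ⊗[l] F).toRingHom.comp
      β).IsIntegralElem (D.iso RatFunc.X) := by
  let θ : B →+* RatFunc K := (D.iso.symm : K ⊗[l] F →+* RatFunc K).comp
    ((Algebra.TensorProduct.includeRight : F →ₐ[l] K ⊗[l] F).toRingHom.comp β)
  let := θ.toAlgebra
  let I : Subring (RatFunc K) := (integralClosure B (RatFunc K)).toSubring
  have hback (z : RatFunc K) (hz : z ∈ I) : ((Algebra.TensorProduct.includeRight :
      F →ₐ[l] K ⊗[l] F).toRingHom.comp β).IsIntegralElem (D.iso z) := by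
    obtain ⟨P, hP, hPz⟩ := (mem_integralClosure_iff B (RatFunc K)).mp hz
    refine ⟨P, hP, ?_⟩
    have h1 := Polynomial.hom_eval₂ P θ (D.iso : RatFunc K →+* K ⊗[l] F) z
    have h2 : (D.iso : RatFunc K →+* K ⊗[l] F).comp θ = (Algebra.TensorProduct.includeRight :
      F →ₐ[l] K ⊗[l] F).toRingHom.comp β := RingHom.ext fun b ↦ D.iso.apply_symm_apply _
    rw [h2] at h1
    refine h1.symm.trans ?_
    change D.iso (Polynomial.eval₂ θ z P) = 0
    rw [show Polynomial.eval₂ θ z P = 0 from hPz, map_zero]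
  have hCI (c : K) : RatFunc.C c ∈ I := by
    obtain ⟨P, hP, hPz⟩ := hK c
    refine (mem_integralClosure_iff B (RatFunc K)).mpr ⟨P, hP, ?_⟩
    have h1 := Polynomial.hom_eval₂ P ((Algebra.TensorProduct.includeRight :
      F →ₐ[l] K ⊗[l] F).toRingHom.comp β) (D.iso.symm : K ⊗[l] F →+* RatFunc K) (c ⊗ₜ 1)
    rw [hPz, map_zero] at h1
    have h2 : (D.iso.symm : K ⊗[l] F →+* RatFunc K) (c ⊗ₜ 1) = RatFunc.C c :=
      D.iso.symm.commutes c
    rw [h2] at h1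
    exact h1.symm
  by_contra hX
  have hXI : RatFunc.X ∉ I := fun h ↦ hX (hback _ h)
  have : IsIntegrallyClosedIn I (RatFunc K) :=
    inferInstanceAs (IsIntegrallyClosedIn (integralClosure B (RatFunc K)) (RatFunc K))
  obtain ⟨V, hIV, hXV⟩ := Subring.exists_le_valuationSubring_of_isIntegrallyClosedIn hXI
  have hXV' : (RatFunc.X : RatFunc K)⁻¹ ∈ V := (V.mem_or_inv_mem _).resolve_left hXV
  let x : V := ⟨_, hXV'⟩
  let θV : B →+* V := θ.codRestrict V.toSubring
    fun b ↦ hIV (Subalgebra.algebraMap_mem (integralClosure B (RatFunc K)) b)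
  let CV : K →+* V := (RatFunc.C : K →+* RatFunc K).codRestrict V.toSubring fun c ↦ hIV (hCI c)
  have hdom : IsDominant (Spec.map (CommRingCat.ofHom V.subtype)) :=
    isDominant_specMap_of_injective _ Subtype.val_injective
  have hmaps : Spec.map (CommRingCat.ofHom θV) ≫ i =
      Spec.map (CommRingCat.ofHom (evalAt CV x)) ≫ D.infty := by
    refine ext_of_isDominant (Spec.map (CommRingCat.ofHom V.subtype)) ?_
    rw [← Spec.map_comp_assoc, ← Spec.map_comp_assoc, ← CommRingCat.ofHom_comp,
      ← CommRingCat.ofHom_comp]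
    have e1 : V.subtype.comp (evalAt CV x) = evalAt RatFunc.C (RatFunc.X : RatFunc K)⁻¹ := by
      ext y
      · simp [CV]
      · simp [x]
    have e2 : V.subtype.comp θV = ((D.iso.symm : K ⊗[l] F →+* RatFunc K).comp
      (Algebra.TensorProduct.includeRight : F →ₐ[l] K ⊗[l] F).toRingHom).comp β := rfl
    rw [e1, e2, D.infty_comp, CommRingCat.ofHom_comp, Spec.map_comp_assoc, hi]
  let m : Spec (.of V) := IsLocalRing.closedPoint V
  refine hy (Spec.map (CommRingCat.ofHom (evalAt CV x)) m) ?_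
    ⟨Spec.map (CommRingCat.ofHom θV) m, ?_⟩
  · change evalAt CV x Polynomial.X ∈ IsLocalRing.maximalIdeal V
    rw [IsLocalRing.mem_maximalIdeal, mem_nonunits_iff]
    simp only [Polynomial.coe_eval₂RingHom, Polynomial.eval₂_X]
    intro hu
    obtain ⟨w, hw⟩ := isUnit_iff_exists_inv.mp hu
    have hw' : (RatFunc.X : RatFunc K)⁻¹ * w = 1 := congrArg Subtype.val hw
    have : (w : RatFunc K) = RatFunc.X := by
      have h0 : (RatFunc.X : RatFunc K) ≠ 0 := RatFunc.X_ne_zero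
      field_simp at hw'
      exact hw'
    exact hXV (this ▸ w.2)
  · exact congr($hmaps m)

end Parametrization

end

/-! ### Coordinates of morphisms into a chart -/

section

open TensorProduct

namespace Parametrization

/-- The open `A` avoids the value at `∞`, so the coordinate is integral over the functions on `A`
and becomes a universal point over the sections of `C` above `A`. Its pullback along `f` is `a`. -/
theorem exists_isPoint {X : Scheme.{u}} {k l F K : Type u} [Field k] [Field l] [Field F] [Field K]
    [Algebra l F] [Algebra l K] [X.IsSeparated] (D : Parametrization X l F K)
    [FiniteDimensional l K] [Algebra.IsSeparable l K]
    (π : Spec (.of l) ⟶ Spec (.of k)) [IsIntegralHom π] (s : X ⟶ Spec (.of k))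
    (hs : D.point ≫ s = Spec.map (CommRingCat.ofHom (algebraMap l F)) ≫ π)
    {C : Scheme.{u}} (ν : C ⟶ X) [IsIntegralHom ν] (p : C ⟶ Spec (.of l)) (η : Spec (.of F) ⟶ C)
    (hην : η ≫ ν = D.point) (hηp : η ≫ p = Spec.map (CommRingCat.ofHom (algebraMap l F)))
    (A : X.Opens) (hA : IsAffineOpen A)
    (hy : ∀ q : Spec (.of (Polynomial K)), Polynomial.X ∈ q.asIdeal → D.infty q ∉ A)
    (γ : Γ(C, ν ⁻¹ᵁ A) ⟶ .of F) (hγ : Spec.map γ ≫ (hA.preimage ν).fromSpec = η)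
    (hγi : Function.Injective γ)
    (hγc : ∀ z : F, (ν.app A ≫ γ).hom.IsIntegralElem z → z ∈ Set.range γ)
    {R : Type u} [CommRing R] [Algebra l R] (f : Spec (.of R) ⟶ C)
    (hfp : f ≫ p = Spec.map (CommRingCat.ofHom (algebraMap l R)))
    (hfA : Set.range (f ≫ ν) ⊆ A) :
    ∃ a : K ⊗[l] R, D.IsPoint a ∧
      D.Value Algebra.TensorProduct.includeLeftRingHom a 1 (baseProj l K R ≫ f ≫ ν) := by
  let W := ν ⁻¹ᵁ A
  have hW : IsAffineOpen W := hA.preimage ν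
  let G := Γ(C, W)
  let δ : CommRingCat.of l ⟶ G := Spec.preimage (hW.fromSpec ≫ p)
  have hδ : Spec.map δ = hW.fromSpec ≫ p := Spec.map_preimage _
  let := δ.hom.toAlgebra
  let := γ.hom.toAlgebra
  have hδγ : δ ≫ γ = CommRingCat.ofHom (algebraMap l F) := by
    apply Spec.map_injective
    rw [Spec.map_comp, hδ, reassoc_of% hγ, hηp]
  have : IsScalarTower l G F := .of_algebraMap_eq' congr($(hδγ).hom).symm
  have hνint : (ν.app A).hom.IsIntegral := IsIntegralHom.isIntegral_app _ _ hA
  have hβ : Spec.map (ν.app A ≫ γ) ≫ hA.fromSpec = D.point := by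
    rw [Spec.map_comp, Category.assoc, ← hην, ← hγ, Category.assoc]
    congr 1
    have h := hA.SpecMap_appLE_fromSpec ν hW le_rfl
    rwa [← Scheme.Hom.app_eq_appLE] at h
  let π₀ : CommRingCat.of k ⟶ .of l := Spec.preimage π
  have hπ₀ : Spec.map π₀ = π := Spec.map_preimage _
  have hπi : π₀.hom.IsIntegral := by
    rw [← IsIntegralHom.SpecMap_iff, hπ₀]
    infer_instance
  have hKint : ((algebraMap l K).comp π₀.hom).IsIntegral :=
    hπi.trans _ _ (algebraMap_isIntegral_iff.mpr inferInstance)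
  let κ : CommRingCat.of k ⟶ Γ(X, A) := Spec.preimage (hA.fromSpec ≫ s)
  have hκ : κ ≫ ν.app A ≫ γ = π₀ ≫ CommRingCat.ofHom (algebraMap l F) := by
    apply Spec.map_injective
    rw [Spec.map_comp, Spec.map_preimage, reassoc_of% hβ, hs, Spec.map_comp, hπ₀]
  obtain ⟨a, ha, hav⟩ := D.exists_isPoint_of_isIntegral (G := G) hγi (fun z hz ↦ by
      refine hγc z ?_
      let := (ν.app A).hom.toAlgebra
      let := (ν.app A ≫ γ).hom.toAlgebra
      have : IsScalarTower Γ(X, A) G F := .of_algebraMap_eq' rfl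
      have : Algebra.IsIntegral Γ(X, A) G := ⟨hνint⟩
      exact isIntegral_trans (R := Γ(X, A)) z hz) (hW.fromSpec ≫ ν) (by
      rw [← hην, ← hγ, Category.assoc]
      rfl) (by
      have h := D.isIntegralElem_iso_X (ν.app A ≫ γ).hom hA.fromSpec hβ (fun c ↦ by
        obtain ⟨P, hP, hPc⟩ := hKint c
        refine ⟨P.map κ.hom, hP.map _, ?_⟩
        rw [Polynomial.eval₂_map]
        have e : ((Algebra.TensorProduct.includeRight : F →ₐ[l] K ⊗[l] F).toRingHom.comp
            (ν.app A ≫ γ).hom).comp κ.hom = (Algebra.TensorProduct.includeLeftRingHom :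
              K →+* K ⊗[l] F).comp ((algebraMap l K).comp π₀.hom) := by
          ext x
          have := congr($hκ x)
          refine (congrArg (Algebra.TensorProduct.includeRight : F →ₐ[l] K ⊗[l] F) this).trans ?_
          exact ((Algebra.TensorProduct.includeRight : F →ₐ[l] K ⊗[l] F).commutes (π₀ x)).trans
            ((Algebra.TensorProduct.includeLeft : K →ₐ[l] K ⊗[l] F).commutes (π₀ x)).symm
        have h1 := Polynomial.hom_eval₂ P ((algebraMap l K).comp π₀.hom)
          (Algebra.TensorProduct.includeLeftRingHom : K →+* K ⊗[l] F) c
        rw [hPc, map_zero, ← e] at h1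
        exact h1.symm) (fun q hq ↦ by
          rw [hA.range_fromSpec]
          exact hy q hq)
      obtain ⟨P, hP, hPx⟩ := h
      refine ⟨P.map (ν.app A).hom, hP.map _, ?_⟩
      rw [Polynomial.eval₂_map]
      exact hPx)
  have hfr : Set.range f ⊆ Set.range hW.fromSpec := by
    rw [hW.range_fromSpec]
    rintro _ ⟨x, rfl⟩
    exact hfA ⟨x, Scheme.Hom.comp_apply _ _ _⟩
  let φ : G ⟶ .of R := Spec.preimage (IsOpenImmersion.lift hW.fromSpec f hfr)
  have hφ : Spec.map φ ≫ hW.fromSpec = f := by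
    rw [Spec.map_preimage, IsOpenImmersion.lift_fac]
  have hδφ : δ ≫ φ = CommRingCat.ofHom (algebraMap l R) := by
    apply Spec.map_injective
    rw [Spec.map_comp, hδ, reassoc_of% hφ, hfp]
  let φ' : G →ₐ[l] R := { φ.hom with commutes' := fun x ↦ congr($(hδφ).hom x) }
  refine ⟨_, ha.extend φ', ?_⟩
  have h := hav.extend φ'
  rw [map_one] at h
  convert h using 2
  rw [← hφ, Category.assoc]
  rfl

end Parametrization

end

/-! ### Sections of the normalization over affine opens -/

section

open TensorProduct

/-- The sections of the normalization at `ζ` over an affine open are integrally closed in the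
residue field of `ζ`. -/
theorem exists_normalizationAt_sections {X : Scheme.{u}} (ζ : X) {A : X.Opens}
    (hA : IsAffineOpen A) (hζ : ζ ∈ A) :
    ∃ γ : Γ(normalizationAt ζ, normalizationAtHom ζ ⁻¹ᵁ A) ⟶ X.residueField ζ,
      Spec.map γ ≫ (hA.preimage (normalizationAtHom ζ)).fromSpec =
        (X.fromSpecResidueField ζ).toNormalization ∧ Function.Injective γ ∧
      ∀ z : X.residueField ζ, ((normalizationAtHom ζ).app A ≫ γ).hom.IsIntegralElem z →
        z ∈ Set.range γ := by
  let r := X.fromSpecResidueField ζ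
  let := (r.app A).hom.toAlgebra
  have htop : r ⁻¹ᵁ A = ⊤ := by
    ext x
    simp [r, Scheme.fromSpecResidueField_apply, hζ]
  have hle : r ⁻¹ᵁ A ≤ r.toNormalization ⁻¹ᵁ (normalizationAtHom ζ ⁻¹ᵁ A) := by
    simp [r, ← Scheme.Hom.comp_preimage]
  let j := r.toNormalization.appLE (normalizationAtHom ζ ⁻¹ᵁ A) (r ⁻¹ᵁ A) hle
  have h1 := r.normalizationObjIso_hom_val hA
  have h2 : ∀ a, j a = ((r.normalizationObjIso hA).hom a).1 := fun a ↦ congr($h1.symm a)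
  have hW := hA.preimage (normalizationAtHom ζ)
  have hV : IsAffineOpen (r ⁻¹ᵁ A) := by
    rw [htop]
    exact isAffineOpen_top _
  let ε : X.residueField ζ ⟶ Γ(Spec (X.residueField ζ), r ⁻¹ᵁ A) := Spec.preimage hV.fromSpec
  have hε : Spec.map ε = hV.fromSpec := Spec.map_preimage _
  have : IsIso hV.fromSpec := by
    have : Surjective hV.fromSpec := ⟨by
      rw [← Set.range_eq_univ, hV.range_fromSpec, htop]
      rfl⟩
    exact IsOpenImmersion.isIso _
  have hεi : Function.Injective ε := by
    have : IsIso (Spec.map ε) := hε ▸ this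
    exact (isIso_SpecMap_iff.mp this).1
  have hfr : Set.range r.toNormalization ⊆ Set.range hW.fromSpec := by
    rw [hW.range_fromSpec]
    rintro _ ⟨x, rfl⟩
    exact hle (by rw [htop]; trivial)
  let γ : Γ(normalizationAt ζ, normalizationAtHom ζ ⁻¹ᵁ A) ⟶ X.residueField ζ :=
    Spec.preimage (IsOpenImmersion.lift hW.fromSpec r.toNormalization hfr)
  have hγ : Spec.map γ ≫ hW.fromSpec = r.toNormalization := by
    rw [Spec.map_preimage, IsOpenImmersion.lift_fac]
  have hj : γ ≫ ε = j := by
    apply Spec.map_injective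
    rw [← cancel_mono hW.fromSpec, Spec.map_comp, Category.assoc, hγ, hε,
      hW.SpecMap_appLE_fromSpec]
  have hjr : (normalizationAtHom ζ).app A ≫ j = r.app A := by
    have h1 : ∀ r' (_ : r' = r) h', r'.appLE A (r ⁻¹ᵁ A) h' = r.app A := by
      rintro _ rfl _
      exact Scheme.Hom.appLE_eq_app _
    rw [Scheme.Hom.app_eq_appLE, Scheme.Hom.appLE_comp_appLE]
    exact h1 _ r.toNormalization_fromNormalization _
  refine ⟨γ, hγ, ?_, fun z hz ↦ ?_⟩
  · have : Function.Injective (γ ≫ ε) := by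
      rw [hj]
      intro a b hab
      rw [h2, h2] at hab
      exact (ConcreteCategory.bijective_of_isIso (r.normalizationObjIso hA).hom).1
        (Subtype.val_injective hab)
    exact Function.Injective.of_comp (f := ε) (by simpa using this)
  · have hz' : ε z ∈ integralClosure Γ(X, A) Γ(Spec (X.residueField ζ), r ⁻¹ᵁ A) := by
      obtain ⟨P, hP, hPz⟩ := hz
      refine ⟨P, hP, ?_⟩
      have h3 := Polynomial.hom_eval₂ P ((normalizationAtHom ζ).app A ≫ γ).hom ε.hom z
      rw [hPz, map_zero, ← CommRingCat.hom_comp, Category.assoc, hj, hjr] at h3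
      exact h3.symm
    obtain ⟨w, hw⟩ := (ConcreteCategory.bijective_of_isIso
      (r.normalizationObjIso hA).hom).2 ⟨_, hz'⟩
    refine ⟨w, hεi ?_⟩
    have h4 : ε (γ w) = j w := congr($hj w)
    rw [h4, h2, hw]

end

/-! ### Lines through a rational point with prescribed behaviour at the origin -/

section

open TensorProduct

theorem exists_isGalois_extension (k L : Type u) [Field k] [Field L] [PerfectField k] [Algebra k L]
    [FiniteDimensional k L] : ∃ (K : Type u) (_ : Field K) (_ : Algebra k K),
      FiniteDimensional k K ∧ IsGalois k K ∧ Nonempty (L →ₐ[k] K) := by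
  have : Algebra.IsAlgebraic k (AlgebraicClosure L) := Algebra.IsAlgebraic.trans k L _
  have : IsAlgClosure k (AlgebraicClosure L) := ⟨inferInstance, inferInstance⟩
  have : Normal k (AlgebraicClosure L) := IsAlgClosure.normal _ _
  exact ⟨IntermediateField.normalClosure k L (AlgebraicClosure L), inferInstance, inferInstance,
    inferInstance, {}, ⟨IsScalarTower.toAlgHom k L _⟩⟩

/-- The affine line over an affine scheme is the spectrum of a polynomial ring. -/
def specPolynomialIso (R : CommRingCat.{u}) : Spec (.of (Polynomial R)) ≅ Line (Spec R) :=
  (Scheme.Spec.mapIso (MvPolynomial.uniqueAlgEquiv R PUnit.{u + 1}).toRingEquiv.toCommRingCatIso.op)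
    ≪≫ (AffineSpace.SpecIso PUnit.{u + 1} R).symm

theorem specPolynomialIso_hom (R : CommRingCat.{u}) : (specPolynomialIso R).hom =
    Spec.map (CommRingCat.ofHom ((MvPolynomial.uniqueAlgEquiv R PUnit.{u + 1}) :
      MvPolynomial PUnit.{u + 1} R →+* Polynomial R)) ≫
    (AffineSpace.SpecIso PUnit.{u + 1} R).inv := rfl

theorem specPolynomialIso_hom_over (R : CommRingCat.{u}) :
    (specPolynomialIso R).hom ≫ (Line (Spec R) ↘ Spec R) =
      Spec.map (CommRingCat.ofHom Polynomial.C) := by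
  rw [specPolynomialIso_hom, Category.assoc, AffineSpace.SpecIso_inv_over, ← Spec.map_comp]
  congr 1
  refine CommRingCat.hom_ext (RingHom.ext fun x ↦ ?_)
  exact (MvPolynomial.uniqueAlgEquiv R PUnit.{u + 1}).commutes x

theorem specMap_eval_specPolynomialIso_hom (R : CommRingCat.{u}) (c : R) :
    Spec.map (CommRingCat.ofHom (Polynomial.evalRingHom c)) ≫ (specPolynomialIso R).hom =
      AffineSpace.homOfVector (𝟙 _) fun _ ↦ (Scheme.ΓSpecIso R).inv c := by
  refine AffineSpace.hom_ext ?_ fun i ↦ ?_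
  · rw [Category.assoc, specPolynomialIso_hom_over, AffineSpace.homOfVector_over, ← Spec.map_comp,
      ← Spec.map_id]
    congr 1
    ext x
    exact Polynomial.eval_C
  · rw [AffineSpace.homOfVector_appTop_coord, specPolynomialIso_hom, ← Category.assoc,
      ← Spec.map_comp, Scheme.Hom.comp_appTop, CommRingCat.comp_apply,
      AffineSpace.SpecIso_inv_appTop_coord, ← CommRingCat.comp_apply,
      ← Scheme.ΓSpecIso_inv_naturality, CommRingCat.comp_apply]
    congr 1
    change Polynomial.eval c (MvPolynomial.uniqueAlgEquiv R PUnit.{u + 1} (MvPolynomial.X i)) = c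
    simp

section

variable {k : Type u} [Field k] {X : Scheme.{u}} (s : X ⟶ Spec (.of k))

/-- The value at the origin of a map from an affine line. -/
abbrev atOrigin {K : Type u} [Field K] (χ : Spec (.of (Polynomial K)) ⟶ X) :
    Spec (.of K) ⟶ X :=
  Spec.map (CommRingCat.ofHom (Polynomial.evalRingHom 0)) ≫ χ

theorem isClosed_singleton_of_integral_comp [IsSeparated s] {K : Type u} [Field K]
    (g : Spec (.of K) ⟶ X) [IsIntegralHom (g ≫ s)] (x : Spec (.of K)) : IsClosed {g x} := by
  have : IsIntegralHom g := IsIntegralHom.of_comp g s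
  have h := g.isClosedMap Set.univ isClosed_univ
  rwa [Set.image_univ, Set.range_unique, Subsingleton.elim default x] at h

/-- A line over a finite extension has generic value `ζ`, which is not closed, so the preimage of
any closed points among `z`, `z'` is a proper closed subset. A closed point `m` outside it becomes
the origin after extension to a Galois field containing its residue field and translation. -/
theorem exists_polynomial_line [PerfectField k] [IsProper s] (ζ : X) (hζ : ¬ IsClosed {ζ})
    (hr : IsRationalPoint s ζ) (z z' : X) :
    ∃ (K : Type u) (_ : Field K) (_ : Algebra k K) (_ : FiniteDimensional k K) (_ : IsGalois k K)
      (χ : Spec (.of (Polynomial K)) ⟶ X),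
      χ ≫ s = Spec.map (CommRingCat.ofHom (algebraMap k (Polynomial K))) ∧
      (∀ t, (Spec.map (CommRingCat.ofHom (algebraMap (Polynomial K) (RatFunc K))) ≫ χ) t = ζ) ∧
      ∀ t, IsClosed {atOrigin χ t} ∧ atOrigin χ t ≠ z ∧ atOrigin χ t ≠ z' := by
  obtain ⟨L, _, ψ, _, φ, hφ, hφζ⟩ := hr
  obtain ⟨ψ, rfl⟩ := Spec.map_surjective ψ
  let := ψ.hom.toAlgebra
  have hfin : FiniteDimensional k L := (IsFinite.SpecMap_iff (f := ψ)).mp inferInstance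
  let χ₀ : Spec (.of (Polynomial L)) ⟶ X := (specPolynomialIso (.of L)).hom ≫ φ
  have hχ₀ : χ₀ ≫ s = Spec.map (CommRingCat.ofHom (algebraMap k (Polynomial L))) := by
    rw [Category.assoc, hφ, reassoc_of% specPolynomialIso_hom_over (.of L)]
    exact (Spec.map_comp _ _).symm
  have hgen : χ₀ (genericPoint _) = ζ := by
    rw [← hφζ, ← genericPoint_eq_of_isOpenImmersion (specPolynomialIso (.of L)).hom]
    rfl
  -- Only the closed points among `z`, `z'` matter, because the value at the origin is closed;
  -- restricting to them makes `Z` closed.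
  let Z : Set X := {x | (x = z ∨ x = z') ∧ IsClosed {x}}
  have hZ : IsClosed Z := by
    have : Z = ⋃ x ∈ Z, {x} := by simp
    rw [this]
    refine Set.Finite.isClosed_biUnion ((Set.toFinite {z, z'}).subset fun x hx ↦ hx.1) fun x hx ↦ hx.2
  have hopen : IsOpen (χ₀ ⁻¹' Z)ᶜ := (hZ.preimage χ₀.continuous).isOpen_compl
  have hne : ((χ₀ ⁻¹' Z)ᶜ).Nonempty := ⟨genericPoint _, fun h ↦ hζ (by
    have := h.2
    rwa [hgen] at this)⟩
  obtain ⟨m, hmZ, hm⟩ := nonempty_inter_closedPoints hne hopen.isLocallyClosed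
  have hmax : m.asIdeal.IsMaximal := (PrimeSpectrum.isClosed_singleton_iff_isMaximal m).mp hm
  let M := Polynomial L ⧸ m.asIdeal
  let : Field M := Ideal.Quotient.field m.asIdeal
  have : Module.Finite L M := finite_of_finite_type_of_isJacobsonRing L M
  have : FiniteDimensional k M := Module.Finite.trans L M
  obtain ⟨K, _, _, hfd, hgal, ⟨e⟩⟩ := exists_isGalois_extension k M
  let i : L →+* K := (e : M →+* K).comp (algebraMap L M)
  let c : K := e (Ideal.Quotient.mk m.asIdeal Polynomial.X)
  -- `c` is the coordinate of `m` in `K`, so the substitution `X ↦ X + c` moves `m` to the origin.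
  let τ : Polynomial L →+* Polynomial K :=
    (Polynomial.compRingHom (Polynomial.X + Polynomial.C c)).comp (Polynomial.mapRingHom i)
  have hτ : Function.Injective τ := by
    refine Function.Injective.comp (g := Polynomial.compRingHom (Polynomial.X + Polynomial.C c)) ?_
      (Polynomial.map_injective _ i.injective)
    exact (Polynomial.taylor_injective c)
  have hτk : τ.comp (algebraMap k (Polynomial L)) = algebraMap k (Polynomial K) := by
    ext x
    have h1 : i (algebraMap k L x) = algebraMap k K x := by
      refine Eq.trans ?_ (e.commutes x)
      change e (algebraMap L M _) = _
      rw [← IsScalarTower.algebraMap_apply]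
    have h2 : algebraMap k (Polynomial L) x = Polynomial.C (algebraMap k L x) := rfl
    have h3 : algebraMap k (Polynomial K) x = Polynomial.C (algebraMap k K x) := rfl
    simp [τ, h2, h3, h1]
  have hτ0 : (Polynomial.evalRingHom 0).comp τ =
      (e : M →+* K).comp (Ideal.Quotient.mk m.asIdeal) := by
    ext x
    · simp [τ, i]
      rfl
    · simp [τ, c]
  let χ : Spec (.of (Polynomial K)) ⟶ X := Spec.map (CommRingCat.ofHom τ) ≫ χ₀
  have hχs : χ ≫ s = Spec.map (CommRingCat.ofHom (algebraMap k (Polynomial K))) := by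
    rw [Category.assoc, hχ₀, ← Spec.map_comp, ← CommRingCat.ofHom_comp, hτk]
  refine ⟨K, inferInstance, inferInstance, hfd, hgal, χ, hχs, fun t ↦ ?_, fun t ↦ ?_⟩
  · rw [← Category.assoc, ← Spec.map_comp, Scheme.Hom.comp_apply, ← hgen]
    congr 1
    rw [genericPoint_eq_bot_of_affine]
    refine PrimeSpectrum.ext ?_
    have ht : t.asIdeal = ⊥ := (Ideal.eq_bot_or_top t.asIdeal).resolve_right t.2.ne_top
    change Ideal.comap ((algebraMap (Polynomial K) (RatFunc K)).comp τ) t.asIdeal = ⊥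
    rw [ht]
    exact (RingHom.injective_iff_ker_eq_bot _).mp
      ((IsFractionRing.injective (Polynomial K) (RatFunc K)).comp hτ)
  · have hint : IsIntegralHom (atOrigin χ ≫ s) := by
      have : atOrigin χ ≫ s = Spec.map (CommRingCat.ofHom (algebraMap k K)) := by
        rw [Category.assoc, hχs, ← Spec.map_comp, ← CommRingCat.ofHom_comp]
        congr 2
        ext x
        exact Polynomial.eval_C
      rw [this, IsIntegralHom.SpecMap_iff]
      exact algebraMap_isIntegral_iff.mpr inferInstance
    have hcl := isClosed_singleton_of_integral_comp s (atOrigin χ) t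
    have hpt : atOrigin χ t = χ₀ m := by
      have e1 : atOrigin χ = Spec.map (CommRingCat.ofHom ((Polynomial.evalRingHom 0).comp τ)) ≫
          χ₀ := by
        rw [CommRingCat.ofHom_comp, Spec.map_comp, Category.assoc]
      rw [e1, hτ0, Scheme.Hom.comp_apply]
      congr 1
      refine PrimeSpectrum.ext ?_
      have ht : t.asIdeal = ⊥ := (Ideal.eq_bot_or_top t.asIdeal).resolve_right t.2.ne_top
      change Ideal.comap ((e : M →+* K).comp (Ideal.Quotient.mk m.asIdeal)) t.asIdeal = _
      rw [ht, ← Ideal.comap_comap]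
      have : Ideal.comap (e : M →+* K) ⊥ = ⊥ :=
        (RingHom.injective_iff_ker_eq_bot _).mp (e : M →+* K).injective
      rw [this]
      exact Ideal.mk_ker
    refine ⟨hcl, fun h ↦ hmZ ?_, fun h ↦ hmZ ?_⟩
    · exact ⟨.inl (hpt.symm.trans h), by rwa [hpt] at hcl⟩
    · exact ⟨.inr (hpt.symm.trans h), by rwa [hpt] at hcl⟩

end

end

/-! ### Construction of the parametrization -/

section

open TensorProduct

/-- The automorphism of a rational function field inverting the variable. -/
theorem exists_inversion (K : Type*) [Field K] : ∃ ρ : RatFunc K ≃ₐ[K] RatFunc K,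
    ρ RatFunc.X = RatFunc.X⁻¹ ∧ ∀ x, ρ (ρ x) = x := by
  obtain ⟨ρ, hρ⟩ := exists_algEquiv_ratFunc (K := K) RatFunc.X⁻¹ (fun c hc ↦ by
    have h : RatFunc.X = RatFunc.C c⁻¹ := by rw [map_inv₀, ← hc, inv_inv]
    have := congrArg RatFunc.num h
    rw [RatFunc.num_X, RatFunc.num_C] at this
    exact Polynomial.X_ne_C _ this) (by
    have h1 := inv_mem (IntermediateField.mem_adjoin_simple_self K (RatFunc.X⁻¹ : RatFunc K))
    rwa [inv_inv] at h1)
  refine ⟨ρ, hρ, fun x ↦ ?_⟩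
  have key : (((ρ : RatFunc K →+* RatFunc K).comp (ρ : RatFunc K →+* RatFunc K)).comp
      (algebraMap (Polynomial K) (RatFunc K))) = algebraMap (Polynomial K) (RatFunc K) := by
    ext x
    · have : ρ (RatFunc.C x) = RatFunc.C x := ρ.commutes x
      simp [this]
    · simp [hρ]
  have h2 : (ρ : RatFunc K →+* RatFunc K).comp (ρ : RatFunc K →+* RatFunc K) = RingHom.id _ :=
    IsLocalization.ringHom_ext (nonZeroDivisors (Polynomial K)) (by rw [key]; rfl)
  exact congr($h2 x)

section

variable {k : Type u} [Field k] {X : Scheme.{u}} (s : X ⟶ Spec (.of k))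

/-- Elements of the residue field that are integral over the constants are constant. -/
theorem mem_range_constants (ζ : X) (x : X.residueField ζ)
    (hx : IsIntegral (constants s ζ) x) : x ∈ (algebraMap (constants s ζ) (X.residueField ζ)).range := by
  let := residueFieldAlgebra s ζ
  have : IsIntegral k x := isIntegral_trans (A := algebraicClosure k (X.residueField ζ)) x hx
  exact ⟨⟨x, mem_algebraicClosure_iff'.mpr this⟩, rfl⟩

theorem isSeparated_of_isProper [IsProper s] : X.IsSeparated := by
  have : IsSeparated (s ≫ terminal.from _) := inferInstance
  exact ⟨by rwa [terminal.comp_from] at this⟩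

/-- The line embeds `F = κ(ζ)` in `K(t)`. Lüroth's theorem applied to `K ⊗ F` gives the coordinate,
and properness extends the generic point over both affine lines. The coordinate has its pole at `t =
0`, so the value at `∞` is that of the line at its origin, which was chosen to avoid `z` and `z'`.
-/
theorem exists_parametrization [PerfectField k] [IsProper s] (ζ : X) (hζ : ¬ IsClosed {ζ})
    (hr : IsRationalPoint s ζ) (z z' : X) :
    ∃ (K : Type u) (_ : Field K) (_ : Algebra (constants s ζ) K)
      (_ : FiniteDimensional (constants s ζ) K) (_ : IsGalois (constants s ζ) K)
      (D : Parametrization X (constants s ζ) (X.residueField ζ) K),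
      D.point = X.fromSpecResidueField ζ ∧
      ∃ y, IsClosed {y} ∧ y ≠ z ∧ y ≠ z' ∧
        ∀ q : Spec (.of (Polynomial K)), Polynomial.X ∈ q.asIdeal → D.infty q = y := by
  obtain ⟨K, _, _, hfin, hgal, χ, hχs, hχζ, hχ0⟩ := exists_polynomial_line s ζ hζ hr z z'
  obtain ⟨b, hb⟩ := exists_fac_of_field _ hχζ
  let l := constants s ζ
  let F := X.residueField ζ
  let := residueFieldAlgebra s ζ
  have hbk : b.hom.comp (algebraMap k F) = algebraMap k (RatFunc K) := by
    have : residueFieldHom s ζ ≫ b = CommRingCat.ofHom (algebraMap k (RatFunc K)) := by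
      apply Spec.map_injective
      rw [Spec.map_comp, specMap_residueFieldHom, reassoc_of% hb, hχs, ← Spec.map_comp,
        ← CommRingCat.ofHom_comp]
    exact congr($(this).hom)
  -- Constants are algebraic over `k`, and the only elements of `K(t)` algebraic over `K` are those
  -- of `K`; this makes `K` an extension of `l`.
  have hconst (x : l) : ∃ c, b (algebraMap l F x) = RatFunc.C c := by
    have h1 : IsIntegral k x := Algebra.IsIntegral.isIntegral x
    have h2 : (algebraMap k (RatFunc K)).IsIntegralElem (b (algebraMap l F x)) := by
      obtain ⟨P, hP, hPx⟩ := h1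
      refine ⟨P, hP, ?_⟩
      have h3 := Polynomial.hom_eval₂ P (algebraMap k l) (b.hom.comp (algebraMap l F)) x
      rw [hPx, map_zero, RingHom.comp_assoc, ← IsScalarTower.algebraMap_eq, hbk] at h3
      exact h3.symm
    exact ratFunc_mem_range_of_isIntegral (IsIntegral.tower_top (R := k) h2)
  choose lam hlam using hconst
  have hC : Function.Injective (RatFunc.C : K →+* RatFunc K) := RingHom.injective _
  let Λ : l →+* K :=
    { toFun := lam
      map_one' := hC (by rw [← hlam]; simp)
      map_mul' := fun x y ↦ hC (by rw [← hlam, map_mul, map_mul, map_mul, hlam, hlam])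
      map_zero' := hC (by rw [← hlam]; simp)
      map_add' := fun x y ↦ hC (by rw [← hlam, map_add, map_add, map_add, hlam, hlam]) }
  let := Λ.toAlgebra
  have : IsScalarTower k l K := .of_algebraMap_eq' (RingHom.ext fun x ↦ hC (by
    have h1 := congr($hbk x)
    refine Eq.trans h1.symm ?_
    exact (hlam (algebraMap k l x))))
  have hfd : FiniteDimensional l K := FiniteDimensional.right k l K
  have hG : IsGalois l K := IsGalois.tower_top_of_isGalois k l K
  let bl : F →ₐ[l] RatFunc K := { b.hom with commutes' := fun x ↦ hlam x }
  let J : K ⊗[l] F →ₐ[K] RatFunc K :=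
    Algebra.TensorProduct.lift (Algebra.ofId K (RatFunc K)) bl fun _ _ ↦ .all _ _
  have hJb (x : F) : J (1 ⊗ₜ x) = b x := by
    simp [J]
    rfl
  -- If `J` had only constant values, `κ(ζ)` would be algebraic over `k` and `ζ` closed.
  have hJ : ∃ x, ∀ c, J x ≠ RatFunc.C c := by
    by_contra! hcon
    refine hζ ?_
    have : IsIntegralHom (X.fromSpecResidueField ζ ≫ s) := by
      rw [← specMap_residueFieldHom, IsIntegralHom.SpecMap_iff]
      intro x
      obtain ⟨c, hc⟩ := hcon (1 ⊗ₜ x)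
      rw [hJb] at hc
      obtain ⟨P, hP, hPc⟩ := Algebra.IsIntegral.isIntegral (R := k) c
      refine ⟨P, hP, b.hom.injective ?_⟩
      have h1 := Polynomial.hom_eval₂ P (algebraMap k F) b.hom x
      have h2 := Polynomial.hom_eval₂ P (algebraMap k K) RatFunc.C c
      rw [hPc, map_zero] at h2
      rw [hbk, hc] at h1
      rw [map_zero]
      exact h1.trans h2.symm
    exact isClosed_singleton_of_isIntegralHom s
  obtain ⟨ψ, n, d, hn, hd, hnd⟩ := exists_ratFunc_equiv (mem_range_constants s ζ) J hJ
  let E : F →+* RatFunc K := (ψ.symm : K ⊗[l] F →+* RatFunc K).comp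
    (Algebra.TensorProduct.includeRight : F →ₐ[l] K ⊗[l] F).toRingHom
  let x₀ : Spec (.of (RatFunc K)) ⟶ X :=
    Spec.map (CommRingCat.ofHom E) ≫ X.fromSpecResidueField ζ
  have hEk : residueFieldHom s ζ ≫ CommRingCat.ofHom E =
      CommRingCat.ofHom (algebraMap k (RatFunc K)) := by
    refine CommRingCat.hom_ext (RingHom.ext fun x ↦ ψ.injective ?_)
    have h1 : ψ (algebraMap k (RatFunc K) x) = algebraMap k K x ⊗ₜ 1 :=
      ψ.commutes (algebraMap k K x)
    refine (ψ.apply_symm_apply _).trans (Eq.trans ?_ h1.symm)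
    rw [IsScalarTower.algebraMap_apply k l K]
    exact ((Algebra.TensorProduct.includeRight : F →ₐ[l] K ⊗[l] F).commutes
      (algebraMap k l x)).trans
        ((Algebra.TensorProduct.includeLeft : K →ₐ[l] K ⊗[l] F).commutes (algebraMap k l x)).symm
  have hx₀ : x₀ ≫ s = Spec.map (CommRingCat.ofHom (algebraMap k (RatFunc K))) := by
    rw [Category.assoc, ← specMap_residueFieldHom, ← Spec.map_comp]
    exact congrArg Spec.map hEk
  let sR : Spec (.of (Polynomial K)) ⟶ Spec (.of k) :=
    Spec.map (CommRingCat.ofHom (algebraMap k (Polynomial K)))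
  have hsR : Spec.map (CommRingCat.ofHom (algebraMap (Polynomial K) (RatFunc K))) ≫ sR =
      Spec.map (CommRingCat.ofHom (algebraMap k (RatFunc K))) := by
    rw [← Spec.map_comp]
    rfl
  obtain ⟨φ₀, hφ₀⟩ := exists_extension_of_isPrincipalIdealRing (R := .of (Polynomial K))
    (E := RatFunc K) sR s x₀ (hx₀.trans hsR.symm)
  obtain ⟨ρ, hρX, hρρ⟩ := exists_inversion K
  let ρ' : CommRingCat.of (RatFunc K) ⟶ .of (RatFunc K) := CommRingCat.ofHom ρ
  have hρC (c : K) : ρ (RatFunc.C c) = RatFunc.C c := ρ.commutes c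
  -- The line around `∞` is the extension after the substitution `X ↦ X⁻¹`.
  obtain ⟨φ₁, hφ₁⟩ := exists_extension_of_isPrincipalIdealRing (R := .of (Polynomial K))
    (E := RatFunc K) sR s (Spec.map ρ' ≫ x₀) (by
      rw [Category.assoc, hx₀, hsR, ← Spec.map_comp]
      congr 1
      refine CommRingCat.hom_ext (RingHom.ext fun x ↦ ?_)
      exact hρC (algebraMap k K x))
  have hinf : Spec.map (CommRingCat.ofHom (evalAt (RatFunc.C : K →+* RatFunc K) RatFunc.X⁻¹)) ≫ φ₁ = x₀ := by
    have e1 : evalAt (RatFunc.C : K →+* RatFunc K) RatFunc.X⁻¹ =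
        (ρ : RatFunc K →+* RatFunc K).comp (algebraMap (Polynomial K) (RatFunc K)) := by
      ext x
      · simp [hρC]
      · simp [hρX]
    rw [e1, CommRingCat.ofHom_comp, Spec.map_comp, Category.assoc]
    refine (congrArg (Spec.map ρ' ≫ ·) hφ₁).trans ?_
    change Spec.map ρ' ≫ Spec.map ρ' ≫ x₀ = x₀
    rw [← Spec.map_comp_assoc]
    have : ρ' ≫ ρ' = 𝟙 _ := CommRingCat.hom_ext (RingHom.ext hρρ)
    rw [this, Spec.map_id, Category.id_comp]
  refine ⟨K, inferInstance, inferInstance, hfd, hG,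
    { point := X.fromSpecResidueField ζ
      iso := ψ
      zero := φ₀
      infty := φ₁
      zero_comp := hφ₀
      infty_comp := hinf }, rfl, atOrigin χ default, (hχ0 _).1, (hχ0 _).2.1, (hχ0 _).2.2,
    fun q hq ↦ ?_⟩
  -- On this neighbourhood of the origin the inverse coordinate is the regular function `n / d`,
  -- vanishing at `0`. Comparison of `χ` with `φ₁ ∘ (n / d)` and evaluation at `0` identify the
  -- value at `∞`.
  let O := Localization.Away d
  have hd0 : d ≠ 0 := by
    rintro rfl
    simp at hd
  let ι : O →+* RatFunc K := IsLocalization.Away.lift d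
    (g := algebraMap (Polynomial K) (RatFunc K)) (IsUnit.mk0 _ (RatFunc.algebraMap_ne_zero hd0))
  have hιa (x : Polynomial K) : ι (algebraMap _ O x) = algebraMap _ _ x :=
    IsLocalization.Away.lift_eq _ _ _
  have hι : Function.Injective ι := by
    refine (IsLocalization.lift_injective_iff _).mpr fun x y ↦ ?_
    rw [(IsLocalization.injective O (powers_le_nonZeroDivisors_of_noZeroDivisors hd0)).eq_iff,
      (IsFractionRing.injective (Polynomial K) (RatFunc K)).eq_iff]
  let ε : O →+* K := IsLocalization.Away.lift d (g := Polynomial.evalRingHom 0) (IsUnit.mk0 _ hd)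
  have hεa (x : Polynomial K) : ε (algebraMap _ O x) = x.eval 0 :=
    IsLocalization.Away.lift_eq _ _ _
  let w : O := algebraMap _ O n * IsLocalization.Away.invSelf d
  have hw : w * algebraMap _ O d = algebraMap _ O n := by
    rw [mul_assoc, mul_comm (IsLocalization.Away.invSelf d), IsLocalization.Away.mul_invSelf, mul_one]
  let β : Polynomial K →+* O := evalAt ((algebraMap (Polynomial K) O).comp Polynomial.C) w
  have hιw : ι w = J (ψ RatFunc.X⁻¹) := by
    have h1 := congrArg ι hw
    rw [map_mul, hιa, hιa, ← hnd] at h1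
    exact mul_right_cancel₀ (RatFunc.algebraMap_ne_zero hd0) h1
  have hιβ : ι.comp β = ((J : K ⊗[l] F →+* RatFunc K).comp (ψ : RatFunc K →+* K ⊗[l] F)).comp
      (evalAt (RatFunc.C : K →+* RatFunc K) RatFunc.X⁻¹) := by
    ext x
    · have h1 : ψ (RatFunc.C x) = x ⊗ₜ 1 := ψ.commutes x
      have h2 : J (x ⊗ₜ 1) = RatFunc.C x := J.commutes x
      have h3 : ι (algebraMap _ O (Polynomial.C x)) = RatFunc.C x := hιa _
      refine (congrArg ι (Polynomial.eval₂_C _ _)).trans (h3.trans (h2.symm.trans ?_))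
      exact congrArg J (h1.symm.trans (congrArg ψ (Polynomial.eval₂_C _ _).symm))
    · refine (congrArg ι (Polynomial.eval₂_X _ _)).trans (hιw.trans ?_)
      exact congrArg (fun x ↦ J (ψ x)) (Polynomial.eval₂_X _ _).symm
  have hJψ : ((J : K ⊗[l] F →+* RatFunc K).comp (ψ : RatFunc K →+* K ⊗[l] F)).comp E = b.hom := by
    ext x
    change J (ψ (ψ.symm (1 ⊗ₜ x))) = _
    rw [ψ.apply_symm_apply, hJb]
  have hmain : Spec.map (CommRingCat.ofHom (algebraMap (Polynomial K) O)) ≫ χ =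
      Spec.map (CommRingCat.ofHom β) ≫ φ₁ := by
    have : IsDomain O := hι.isDomain ι
    have : X.IsSeparated := isSeparated_of_isProper s
    have : IsDominant (Spec.map (CommRingCat.ofHom ι)) := isDominant_specMap_of_injective _ hι
    refine ext_of_isDominant (Spec.map (CommRingCat.ofHom ι)) ?_
    have e1 : ι.comp (algebraMap (Polynomial K) O) = algebraMap _ _ := RingHom.ext hιa
    rw [← Spec.map_comp_assoc, ← Spec.map_comp_assoc, ← CommRingCat.ofHom_comp,
      ← CommRingCat.ofHom_comp, e1, hιβ, CommRingCat.ofHom_comp, Spec.map_comp_assoc, hinf,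
      ← Spec.map_comp_assoc, ← CommRingCat.ofHom_comp, hJψ]
    exact hb.symm
  have horig : atOrigin χ = atOrigin φ₁ := by
    have h1 := congrArg (Spec.map (CommRingCat.ofHom ε) ≫ ·) hmain
    have e1 : ε.comp (algebraMap (Polynomial K) O) = Polynomial.evalRingHom 0 := RingHom.ext hεa
    have hεw : ε w = 0 := by
      have h1 := congrArg ε hw
      rw [map_mul, hεa, hεa, hn] at h1
      exact (mul_eq_zero.mp h1).resolve_right hd
    have e2 : ε.comp β = Polynomial.evalRingHom 0 := by
      ext x
      · simp [β, hεa]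
      · simp [β, hεw]
    simp only [← Spec.map_comp_assoc, ← CommRingCat.ofHom_comp, e1, e2] at h1
    exact h1
  have hq' : q = Spec.map (CommRingCat.ofHom (Polynomial.evalRingHom (0 : K))) default := by
    refine PrimeSpectrum.ext ?_
    have h1 : (Ideal.span {(Polynomial.X : Polynomial K)}).IsMaximal :=
      PrincipalIdealRing.isMaximal_of_irreducible Polynomial.irreducible_X
    have h2 : Ideal.span {(Polynomial.X : Polynomial K)} ≤ q.asIdeal := by
      rwa [Ideal.span_singleton_le_iff_mem]
    refine (h1.eq_of_le q.2.ne_top h2).symm.trans (h1.eq_of_le (PrimeSpectrum.isPrime _).ne_top ?_)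
    rw [Ideal.span_singleton_le_iff_mem]
    have : Polynomial.evalRingHom (0 : K) Polynomial.X ∈ (default : Spec (.of K)).asIdeal := by
      simp
    exact this
  rw [hq', horig, Scheme.Hom.comp_apply]

end

end

/-! ### Local homotopies inside a chart -/

section

open TensorProduct

/-- A ring homomorphism from a field to a polynomial ring over a domain has constant values. -/
theorem eq_C_comp_eval {k R : Type*} [Field k] [CommRing R] [IsDomain R] (θ : k →+* Polynomial R) :
    θ = Polynomial.C.comp ((Polynomial.evalRingHom 0).comp θ) := by
  ext x : 1
  by_cases hx : x = 0
  · simp [hx]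
  · obtain ⟨c, -, hc⟩ := Polynomial.isUnit_iff.mp ((IsUnit.mk0 x hx).map θ)
    simp [← hc]

variable {k : Type u} [Field k] {X : Scheme.{u}} {s : X ⟶ Spec (.of k)}

/-- Homotopies over affine schemes as morphisms from affine lines. -/
theorem exists_line_of_polynomial {R : CommRingCat.{u}} [IsDomain R] {f g : Spec R ⟶ X}
    (H : Spec (.of (Polynomial R)) ⟶ X)
    (h0 : Spec.map (CommRingCat.ofHom (Polynomial.evalRingHom 0)) ≫ H = f)
    (h1 : Spec.map (CommRingCat.ofHom (Polynomial.evalRingHom 1)) ≫ H = g) :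
    ∃ H : Line (Spec R) ⟶ X, AffineSpace.homOfVector (𝟙 _) (fun _ ↦ 0) ≫ H = f ∧
      AffineSpace.homOfVector (𝟙 _) (fun _ ↦ 1) ≫ H = g ∧
      H ≫ s = (Line (Spec R) ↘ Spec R) ≫ f ≫ s := by
  have e0 := specMap_eval_specPolynomialIso_hom R 0
  have e1 := specMap_eval_specPolynomialIso_hom R 1
  rw [map_zero] at e0
  rw [map_one] at e1
  refine ⟨(specPolynomialIso R).inv ≫ H, ?_, ?_, ?_⟩
  · rw [← e0, Category.assoc, Iso.hom_inv_id_assoc, h0]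
  · rw [← e1, Category.assoc, Iso.hom_inv_id_assoc, h1]
  · rw [Category.assoc, Iso.inv_comp_eq, reassoc_of% specPolynomialIso_hom_over R]
    obtain ⟨θ, hθ⟩ := Spec.map_surjective (H ≫ s)
    rw [← h0, Category.assoc, ← hθ, ← Spec.map_comp, ← Spec.map_comp]
    congr 1
    exact CommRingCat.hom_ext (eq_C_comp_eval θ.hom)

/-- In a closed chart equal constants mean equal maps. In a rational chart, a parametrization whose
value at `∞` differs from the images of `u` under both maps gives them finite equivariant
coordinates near `u`, and `Parametrization.exists_local_homotopy` joins these. -/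
theorem Adm.exists_local_homotopy [PerfectField k] [IsProper s] (c : Adm s) {U : Scheme.{u}}
    [IsIntegral U] (f g : U ⟶ c.chart.C) (h : f ≫ c.chart.p = g ≫ c.chart.p) (u : U) :
    ∃ (V : Scheme.{u}) (j : V ⟶ U) (_ : IsOpenImmersion j) (H : Line V ⟶ X),
      u ∈ Set.range j ∧
      AffineSpace.homOfVector (𝟙 _) (fun _ ↦ 0) ≫ H = j ≫ f ≫ c.chart.ν ∧
      AffineSpace.homOfVector (𝟙 _) (fun _ ↦ 1) ≫ H = j ≫ g ≫ c.chart.ν ∧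
      H ≫ s = (Line V ↘ V) ≫ (j ≫ f ≫ c.chart.ν) ≫ s := by
  cases c with
  | closed z hz =>
    have hfg : f = g := (Category.comp_id f).symm.trans (h.trans (Category.comp_id g))
    subst hfg
    refine ⟨U, 𝟙 U, inferInstance, (Line U ↘ U) ≫ f ≫ X.fromSpecResidueField z, ⟨u, rfl⟩, ?_, ?_, ?_⟩
    · rw [AffineSpace.homOfVector_over_assoc]
      rfl
    · rw [AffineSpace.homOfVector_over_assoc]
      rfl
    · rw [Category.assoc, Category.id_comp]
      rfl
  | rational ζ hζ hr =>
    change U ⟶ normalizationAt ζ at f g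
    replace h : f ≫ normalizationAtConstants s ζ = g ≫ normalizationAtConstants s ζ := h
    let ν := normalizationAtHom ζ
    have : X.IsSeparated := isSeparated_of_isProper s
    obtain ⟨K, _, _, _, _, D, hD, y, hy, hyf, hyg, hyD⟩ :=
      exists_parametrization s ζ hζ hr ((f ≫ ν) u) ((g ≫ ν) u)
    have key (x : U ⟶ normalizationAt ζ) (hx : y ≠ (x ≫ ν) u) : ∃ A : X.Opens,
        IsAffineOpen A ∧ ζ ∈ A ∧ (x ≫ ν) u ∈ A ∧ y ∉ A := by
      obtain ⟨_, ⟨A, hA, rfl⟩, hAx, hAy⟩ :=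
        X.isBasis_affineOpens.exists_subset_of_mem_open (a := (x ≫ ν) u) (u := {y}ᶜ)
          (by simpa using hx.symm) hy.isOpen_compl
      refine ⟨A, hA, ?_, hAx, fun hyA ↦ hAy hyA rfl⟩
      -- The open contains `ζ` because `ζ` specializes to the value at `u`.
      have hs := normalizationAtHom_specializes (ζ := ζ) (x u)
      refine hs.mem_open A.2 ?_
      rwa [← Scheme.Hom.comp_apply]
    obtain ⟨A, hA, hζA, hfA, hyA⟩ := key f hyf
    obtain ⟨B, hB, hζB, hgB, hyB⟩ := key g hyg
    obtain ⟨_, ⟨V, hV, rfl⟩, huV, hVAB⟩ :=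
      U.isBasis_affineOpens.exists_subset_of_mem_open (a := u)
        (u := ((f ≫ ν) ⁻¹ᵁ A ⊓ (g ≫ ν) ⁻¹ᵁ B : U.Opens)) ⟨hfA, hgB⟩ (TopologicalSpace.Opens.isOpen _)
    replace hV : IsAffineOpen V := hV
    replace huV : u ∈ V := huV
    have : Nonempty V := ⟨⟨u, huV⟩⟩
    let R := Γ(U, V)
    let j : Spec (.of R) ⟶ U := hV.fromSpec
    have hjr : Set.range j = V := hV.range_fromSpec
    obtain ⟨ρ, hρ⟩ := Spec.map_surjective (j ≫ f ≫ normalizationAtConstants s ζ)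
    let := ρ.hom.toAlgebra
    have hpoint (x : U ⟶ normalizationAt ζ)
        (hx : x ≫ normalizationAtConstants s ζ = f ≫ normalizationAtConstants s ζ)
        (A : X.Opens) (hA : IsAffineOpen A) (hζA : ζ ∈ A) (hyA : y ∉ A) (hV : V ≤ (x ≫ ν) ⁻¹ᵁ A) :
        ∃ a : K ⊗[constants s ζ] R, D.IsPoint a ∧
          D.Value Algebra.TensorProduct.includeLeftRingHom a 1
            (baseProj (constants s ζ) K R ≫ (j ≫ x) ≫ ν) := by
      obtain ⟨γ, hγ, hγi, hγc⟩ := exists_normalizationAt_sections ζ hA hζA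
      refine D.exists_isPoint (constantsHom s ζ) s ?_ ν (normalizationAtConstants s ζ)
        (X.fromSpecResidueField ζ).toNormalization ?_ (toNormalization_normalizationAtConstants s ζ)
        A hA (fun q hq hqA ↦ hyA (hyD q hq ▸ hqA)) γ hγ hγi hγc (j ≫ x) ?_ ?_
      · rw [hD]
        exact (toConstants_comp s ζ).symm
      · rw [hD]
        exact Scheme.Hom.toNormalization_fromNormalization _
      · rw [Category.assoc, hx, ← hρ]
        rfl
      · rintro _ ⟨t, rfl⟩
        have : j t ∈ V := by
          have : j t ∈ Set.range j := ⟨t, rfl⟩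
          rwa [hjr] at this
        have := hV this
        rw [Category.assoc, Scheme.Hom.comp_apply]
        exact this
    obtain ⟨a, ha, hav⟩ := hpoint f rfl A hA hζA hyA fun x hx ↦ (hVAB hx).1
    obtain ⟨b, hb, hbv⟩ := hpoint g h.symm B hB hζB hyB fun x hx ↦ (hVAB hx).2
    obtain ⟨t, ht⟩ : u ∈ Set.range j := by rwa [hjr]
    have : t.asIdeal.IsPrime := PrimeSpectrum.isPrime t
    obtain ⟨r, hr, H, H0, H1⟩ := Parametrization.exists_local_homotopy ha hb hav hbv t.asIdeal
    let i : Spec (.of (Localization.Away r)) ⟶ Spec (.of R) :=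
      Spec.map (CommRingCat.ofHom (algebraMap R (Localization.Away r)))
    have hi : IsOpenImmersion i := inferInstance
    have hti : t ∈ Set.range i := by
      have := PrimeSpectrum.localization_away_comap_range (Localization.Away r) r
      change t ∈ Set.range (PrimeSpectrum.comap (algebraMap R (Localization.Away r)))
      rw [this]
      exact hr
    obtain ⟨t', ht'⟩ := hti
    have : Nonempty (Spec (.of (Localization.Away r))) := ⟨t'⟩
    have : IsIntegral (Spec (.of (Localization.Away r))) := isIntegral_of_isOpenImmersion (i ≫ j)
    have : IsDomain (CommRingCat.of (Localization.Away r)) :=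
      (affine_isIntegral_iff (.of (Localization.Away r))).mp inferInstance
    obtain ⟨H', h0, h1, h2⟩ := exists_line_of_polynomial (s := s) (R := .of (Localization.Away r))
      H H0 H1
    refine ⟨_, i ≫ j, inferInstance, H', ⟨t', ?_⟩, ?_, ?_, ?_⟩
    · rw [Scheme.Hom.comp_apply, ht', ht]
    · rw [h0, Category.assoc, Category.assoc]
      rfl
    · rw [h1, Category.assoc, Category.assoc]
      rfl
    · rw [h2, Category.assoc, Category.assoc, Category.assoc]
      rfl

end

section

variable {k : Type u} [Field k]

/-! ### Étale neighbourhoods -/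

/-- A scheme with an open immersion to an object of `Sm k`, as an object of `Sm k`. -/
def openSubobject (U : Sm k) {V : Scheme.{u}} (j : V ⟶ U.left) [IsOpenImmersion j] : Sm k :=
  MorphismProperty.Over.mk ⊤ (j ≫ U.hom) (by
    have : IsLocallyNoetherian V := LocallyOfFiniteType.isLocallyNoetherian j
    have : TopologicalSpace.NoetherianSpace V :=
      j.isOpenEmbedding.isInducing.noetherianSpace
    have : CompactSpace V := inferInstance
    exact ⟨inferInstance, inferInstance⟩)

def openSubobjectHom (U : Sm k) {V : Scheme.{u}} (j : V ⟶ U.left) [IsOpenImmersion j] :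
    openSubobject U j ⟶ U :=
  MorphismProperty.Over.homMk j rfl

theorem SplitAt.of_isOpenImmersion {V U : Scheme.{u}} (j : V ⟶ U) [IsOpenImmersion j] (v : V) :
    SplitAt j (j v) := ⟨v, rfl, inferInstance⟩

theorem SplitAt.comp {W V U : Scheme.{u}} {f : W ⟶ V} {g : V ⟶ U} {v : V} {u : U} (hu : g v = u)
    (hi : IsIso (g.residueFieldMap v)) (h : SplitAt f v) : SplitAt (f ≫ g) u := by
  obtain ⟨w, rfl, hw⟩ := h
  subst hu
  refine ⟨w, Scheme.Hom.comp_apply _ _ _, ?_⟩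
  rw [Scheme.residueFieldMap_comp]
  exact IsIso.comp_isIso' hi hw

theorem locallyNormal_left (U : Sm k) : LocallyNormal U.left := locallyNormal_of_smooth U.hom

theorem exists_integral_neighbourhood (U : Sm k) (x : U.left) :
    ∃ (V : Sm k) (j : V ⟶ U), IsIntegral V.left ∧ IsOpenImmersion j.left ∧ ∃ v, j.left v = x := by
  obtain ⟨W, -, hx, hW⟩ := (locallyNormal_left U).exists_isIntegral x
  exact ⟨openSubobject U W.ι, openSubobjectHom U W.ι, hW, inferInstanceAs (IsOpenImmersion W.ι),
    ⟨x, hx⟩, rfl⟩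

theorem etale_left_comp {U V W : Sm k} (f : U ⟶ V) (g : V ⟶ W) [Etale f.left] [Etale g.left] :
    Etale (f ≫ g).left :=
  inferInstanceAs (Etale (f.left ≫ g.left))

theorem exists_integral_of_mem_nisnevich {U : Sm k} {S : Sieve U} (hS : S ∈ nisnevich k U)
    (x : U.left) : ∃ (V : Sm k) (e : V ⟶ U), S e ∧ IsIntegral V.left ∧ Etale e.left ∧
      SplitAt e.left x := by
  obtain ⟨V, e, he, _, y, hy, hi⟩ := hS x
  obtain ⟨W, j, hW, _, w, rfl⟩ := exists_integral_neighbourhood V y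
  exact ⟨W, j ≫ e, S.downward_closed he j, hW, etale_left_comp j e,
    SplitAt.comp hy hi (.of_isOpenImmersion j.left w)⟩

theorem SplitAt.etalePullbackSnd {U V W : Sm k} (f : V ⟶ U) (g : W ⟶ U) [Etale f.left] (x : W.left)
    (h : SplitAt f.left (g.left x)) : SplitAt (A1Chain.etalePullbackSnd f g).left x := by
  obtain ⟨l, hl⟩ := (splitAt_iff _ _).mp h
  refine (splitAt_iff _ _).mpr ⟨pullback.lift (Spec.map (g.left.residueFieldMap x) ≫ l)
    (W.left.fromSpecResidueField x) ?_, pullback.lift_snd _ _ _⟩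
  rw [Category.assoc, hl, Scheme.Hom.SpecMap_residueFieldMap_fromSpecResidueField]

instance etale_etalePullbackSnd {U V W : Sm k} (f : V ⟶ U) (g : W ⟶ U) [Etale f.left] :
    Etale (etalePullbackSnd f g).left :=
  inferInstanceAs (Etale (pullback.snd f.left g.left))

instance etale_etalePullbackFst {U V W : Sm k} (f : V ⟶ U) (g : W ⟶ U) [Etale f.left]
    [Etale g.left] : Etale (etalePullbackFst f g).left :=
  inferInstanceAs (Etale (pullback.fst f.left g.left))

/-! ### Sections of `S` -/

theorem eq_of_locally_eq (G : Shv k) {U : Sm k} {a b : G.obj.obj (op U)}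
    (h : ∀ x : U.left, ∃ (V : Sm k) (e : V ⟶ U), Etale e.left ∧ SplitAt e.left x ∧
      G.obj.map e.op a = G.obj.map e.op b) : a = b := by
  have hG := (isSheaf_iff_isSheaf_of_type _ _).mp G.property
  let S : Sieve U :=
    { arrows := fun V e ↦ G.obj.map e.op a = G.obj.map e.op b
      downward_closed := fun {V W e} he g ↦ by
        rw [op_comp, Functor.map_comp_apply, Functor.map_comp_apply, he] }
  have hS : S ∈ nisnevich k U := fun x ↦ by
    obtain ⟨V, e, he, hx, hab⟩ := h x
    exact ⟨V, e, hab, he, hx⟩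
  exact (hG S hS).isSeparatedFor.ext fun V e he ↦ he

/-- The relation is then equality, so the quotient presheaf is `G`, already a sheaf. -/
theorem isIso_toS (G : Shv k)
    (h : ∀ (U : Sm k) (a : G.obj.obj (op (lineOver U))),
      G.obj.map (zeroSection U).op a = G.obj.map (oneSection U).op a) : IsIso (toS G) := by
  have h1 : IsIso (toPreS G.obj) := by
    rw [NatTrans.isIso_iff_isIso_app]
    intro U
    rw [isIso_iff_bijective]
    refine ⟨fun a b hab ↦ ?_, Quot.mk_surjective⟩
    have h2 := Quot.eqvGen_exact hab
    induction h2 with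
    | rel a b h2 =>
      obtain ⟨c, rfl, rfl⟩ := h2
      exact h _ c
    | refl => rfl
    | symm a b _ ih => exact (ih (Quot.eqvGen_sound ‹_›)).symm
    | trans a b c h3 h4 ih ih' => exact (ih (Quot.eqvGen_sound h3)).trans (ih' (Quot.eqvGen_sound h4))
  have h2 : Presheaf.IsSheaf (nisnevich k) (preS G.obj) :=
    (Presheaf.isSheaf_of_iso_iff (asIso (toPreS G.obj))).mp G.property
  have h3 : IsIso (toSheafify (nisnevich k) (preS G.obj)) := isIso_toSheafify _ h2
  have h4 : IsIso ((sheafToPresheaf (nisnevich k) (Type (u + 1))).map (toS G)) :=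
    inferInstanceAs (IsIso (toPreS G.obj ≫ toSheafify (nisnevich k) (preS G.obj)))
  exact isIso_of_reflects_iso (toS G) (sheafToPresheaf (nisnevich k) (Type (u + 1)))

variable (X : Over (Spec (CommRingCat.of k)))

/-- The section of `schemeSheaf X` given by a morphism. -/
def sectionOf {U : Sm k} (f : U.left ⟶ X.left) (hf : f ≫ X.hom = U.hom) :
    (schemeSheaf X).obj.obj (op U) :=
  ⟨Over.homMk f hf⟩

/-- The section of `S X` given by a morphism. -/
def classOf {U : Sm k} (f : U.left ⟶ X.left) (hf : f ≫ X.hom = U.hom) :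
    (S (schemeSheaf X)).obj.obj (op U) :=
  (toS (schemeSheaf X)).hom.app (op U) (sectionOf X f hf)

variable {X}

theorem sectionOf_surjective {U : Sm k} (a : (schemeSheaf X).obj.obj (op U)) :
    ∃ f hf, sectionOf X f hf = a :=
  ⟨a.down.left, Over.w a.down, rfl⟩

theorem comp_hom_eq {U V : Sm k} (e : V ⟶ U) {f : U.left ⟶ X.left} (hf : f ≫ X.hom = U.hom) :
    (e.left ≫ f) ≫ X.hom = V.hom := by
  rw [Category.assoc, hf, MorphismProperty.Over.w]

theorem map_classOf {U V : Sm k} (e : V ⟶ U) (f : U.left ⟶ X.left) (hf : f ≫ X.hom = U.hom) :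
    (S (schemeSheaf X)).obj.map e.op (classOf X f hf) =
      classOf X (e.left ≫ f) (comp_hom_eq e hf) :=
  (NatTrans.naturality_apply (toS (schemeSheaf X)).hom e.op (sectionOf X f hf)).symm

theorem classOf_congr {U : Sm k} {f g : U.left ⟶ X.left} (h : f = g) (hf : f ≫ X.hom = U.hom)
    (hg : g ≫ X.hom = U.hom) : classOf X f hf = classOf X g hg := by
  subst h
  rfl

theorem exists_classOf_eq {U : Sm k} (a : (S (schemeSheaf X)).obj.obj (op U)) (x : U.left) :
    ∃ (V : Sm k) (e : V ⟶ U) (f : V.left ⟶ X.left) (hf : f ≫ X.hom = V.hom), IsIntegral V.left ∧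
      Etale e.left ∧ SplitAt e.left x ∧ classOf X f hf = (S (schemeSheaf X)).obj.map e.op a := by
  have h := Presheaf.imageSieve_mem (nisnevich k)
    (toSheafify (nisnevich k) (preS (schemeSheaf X).obj)) (U := op U) a
  obtain ⟨V, e, ⟨t, ht⟩, hV, he, hx⟩ := exists_integral_of_mem_nisnevich h x
  obtain ⟨t, rfl⟩ := Quot.mk_surjective t
  obtain ⟨f, hf, rfl⟩ := sectionOf_surjective t
  exact ⟨V, e, f, hf, hV, he, hx, ht⟩

theorem classOf_eq_of_line {U : Sm k} (H : Line U.left ⟶ X.left)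
    (hH : H ≫ X.hom = (lineOver U).hom) (h0 h1) :
    classOf X ((zeroSection U).left ≫ H) h0 = classOf X ((oneSection U).left ≫ H) h1 := by
  refine congrArg ((toSheafify (nisnevich k) (preS (schemeSheaf X).obj)).app (op U))
    (Quot.sound ⟨sectionOf X (U := lineOver U) H hH, rfl, rfl⟩)

/-- Sections of a presheaf that agree in its sheafification agree locally, here through a chain of
homotopies. `rel_of_line` handles each link, and `Rel` is transitive over an integral scheme. -/
theorem exists_rel_of_classOf_eq [PerfectField k] [IsProper X.hom]
    (hX : topologicalKrullDim X.left = 1) {U : Sm k} {f g : U.left ⟶ X.left}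
    (hf : f ≫ X.hom = U.hom) (hg : g ≫ X.hom = U.hom) (h : classOf X f hf = classOf X g hg)
    (x : U.left) : ∃ (V : Sm k) (e : V ⟶ U), IsIntegral V.left ∧ Etale e.left ∧ SplitAt e.left x ∧
      Rel (s := X.hom) V.hom (e.left ≫ f) (e.left ≫ g) := by
  have h1 := Presheaf.equalizerSieve_mem (nisnevich k)
    (toSheafify (nisnevich k) (preS (schemeSheaf X).obj)) (X := op U) (Quot.mk _ (sectionOf X f hf))
    (Quot.mk _ (sectionOf X g hg)) h
  obtain ⟨V, e, ht, hV, he, hx⟩ := exists_integral_of_mem_nisnevich h1 x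
  refine ⟨V, e, hV, he, hx, ?_⟩
  replace ht := Quot.eqvGen_exact (a := sectionOf X (e.left ≫ f) (comp_hom_eq e hf))
    (b := sectionOf X (e.left ≫ g) (comp_hom_eq e hg)) ht
  have key : ∀ a b, Relation.EqvGen (Homotopic (schemeSheaf X).obj (op V)) a b →
      Rel (s := X.hom) V.hom a.down.left b.down.left := by
    intro a b hab
    induction hab with
    | rel a b h2 =>
      obtain ⟨c, rfl, rfl⟩ := h2
      obtain ⟨H, hH, rfl⟩ := sectionOf_surjective c
      exact rel_of_line (V := V.left) (t := V.hom) hX H hH (zeroSection V).left (oneSection V).left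
        (AffineSpace.homOfVector_over _ _) (AffineSpace.homOfVector_over _ _)
    | refl => exact .inl rfl
    | symm _ _ _ ih => exact ih.symm
    | trans _ _ _ _ _ ih ih' => exact Rel.trans (T := V.left) (t := V.hom) hX ih ih'
  exact key _ _ ht

end

/-! ### Connected classes give equal sections; comparison of representatives -/

section

theorem map_genericPoint_of_etale {V Y : Scheme.{u}} [IsIntegral V] [IsIntegral Y] (e : V ⟶ Y)
    [Etale e] : e (genericPoint V) = genericPoint Y := by
  have hopen : IsOpenMap e := e.isOpenMap
  have h1 : IsOpen (Set.range e) := hopen.isOpen_range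
  obtain ⟨v, hv⟩ : genericPoint Y ∈ Set.range e :=
    (genericPoint_specializes (e (genericPoint V))).mem_open h1 ⟨_, rfl⟩
  refine (Specializes.antisymm ?_ (genericPoint_specializes _)).eq
  rw [← hv]
  exact (genericPoint_specializes v).map e.continuous

variable {k : Type u} [Field k]

section Pull

variable {X : Scheme.{u}} {s : X ⟶ Spec (.of k)} [IsProper s] {T T' T'' : Scheme.{u}}
  {t : T ⟶ Spec (.of k)} {t' : T' ⟶ Spec (.of k)} {t'' : T'' ⟶ Spec (.of k)}

/-- Pullback of vertices along a morphism of `k`-schemes. -/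
def Vert.pull (v : Vert s t) (g : T' ⟶ T) (h : g ≫ t = t') : Vert s t' where
  c := v.c
  a := g ≫ v.a
  w := by rw [Category.assoc, v.w, h]

theorem Vert.pull_pull (v : Vert s t) (g : T' ⟶ T) (h : g ≫ t = t') (g' : T'' ⟶ T')
    (h' : g' ≫ t' = t'') (g'' : T'' ⟶ T) (hg : g' ≫ g = g'') (h'' : g'' ≫ t = t'') :
    (v.pull g h).pull g' h' = v.pull g'' h'' := by
  subst hg
  obtain ⟨c, a, w⟩ := v
  have key (a a' : T'' ⟶ Spec (.of c.chart.L)) (w w') (ha : a = a') :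
      (⟨c, a, w⟩ : Vert s t'') = ⟨c, a', w'⟩ := by
    subst ha
    rfl
  exact key _ _ _ _ (Category.assoc _ _ _).symm

theorem HasClass.pull {f : T ⟶ X} {v : Vert s t} (hv : HasClass f v) (g : T' ⟶ T)
    (h : g ≫ t = t') : HasClass (g ≫ f) (v.pull g h) := by
  subst h
  exact hv.map g

theorem Conn.pull {v w : Vert s t} (hv : Conn v w) (g : T' ⟶ T) (h : g ≫ t = t') :
    Conn (v.pull g h) (w.pull g h) := by
  subst h
  exact hv.map g

theorem Vert.pull_injective [PerfectField k] [IsIntegral T] [Nonempty T'] (g : T' ⟶ T)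
    (h : g ≫ t = t') {v w : Vert s t} (hvw : v.pull g h = w.pull g h) : v = w := by
  subst h
  exact Vert.map_injective g hvw

theorem exists_hasClass_of_comp_eq [IsIntegral T] (hT : LocallyNormal T) (f : T ⟶ X)
    (hf : f ≫ s = t)
    (h : IsClosed {f (genericPoint T)} ∨ IsRationalPoint s (f (genericPoint T))) :
    ∃ v : Vert s t, HasClass f v := by
  subst hf
  exact exists_hasClass hT f h

end Pull

/-- An étale map of integral schemes preserves the generic point, so the splitting `l` over the
generic point of `Y` is available over that of `V'`. -/
theorem exists_lift_functionField {Y V : Sm k} [IsIntegral Y.left] (e : V ⟶ Y)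
    (l : Spec (Y.left.residueField (genericPoint Y.left)) ⟶ V.left)
    (hl : l ≫ e.left = Y.left.fromSpecResidueField (genericPoint Y.left))
    {V' : Sm k} [IsIntegral V'.left] (e' : V' ⟶ Y) [Etale e'.left] :
    ∃ r : Spec V'.left.functionField ⟶ V.left, r ≫ e.left = genericInclusion V'.left ≫ e'.left := by
  let g : Spec (.of V'.left.functionField) ⟶ Y.left := genericInclusion V'.left ≫ e'.left
  obtain ⟨b, hb⟩ := exists_fac_of_field g (x := genericPoint Y.left) fun t ↦ by
    refine (Scheme.Hom.comp_apply _ _ _).trans ?_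
    rw [genericInclusion_apply, map_genericPoint_of_etale]
  exact ⟨Spec.map b ≫ l, by rw [Category.assoc, hl, hb]⟩

variable {X : Over (Spec (CommRingCat.of k))} [PerfectField k] [IsProper X.hom]

theorem classOf_eq_of_chart {U : Sm k} [IsIntegral U.left] (c : Adm X.hom)
    (f g : U.left ⟶ c.chart.C) (h : f ≫ c.chart.p = g ≫ c.chart.p)
    (hf : (f ≫ c.chart.ν) ≫ X.hom = U.hom) (hg : (g ≫ c.chart.ν) ≫ X.hom = U.hom) :
    classOf X (f ≫ c.chart.ν) hf = classOf X (g ≫ c.chart.ν) hg := by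
  refine eq_of_locally_eq _ fun x ↦ ?_
  obtain ⟨V, j, _, H, ⟨v, rfl⟩, h0, h1, hs⟩ := c.exists_local_homotopy f g h x
  refine ⟨openSubobject U j, openSubobjectHom U j, inferInstanceAs (Etale j),
    .of_isOpenImmersion j v, ?_⟩
  rw [map_classOf, map_classOf]
  have hH : H ≫ X.hom = (lineOver (openSubobject U j)).hom := by
    rw [hs, Category.assoc, hf]
    rfl
  have h2 := classOf_eq_of_line (U := openSubobject U j) H hH
    ((congrArg (· ≫ X.hom) h0).trans (comp_hom_eq (openSubobjectHom U j) hf))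
    ((congrArg (· ≫ X.hom) h1).trans (comp_hom_eq (openSubobjectHom U j) hg))
  exact (classOf_congr h0.symm _ _).trans (h2.trans (classOf_congr h1 _ _))

/-- An edge provides a morphism through `Spec M` having both vertices as classes. Along a chain this
needs a morphism at every intermediate vertex, whence the second conjunct. -/
theorem classOf_eq_of_conn {U : Sm k} [IsIntegral U.left] {v w : Vert X.hom U.hom} (h : Conn v w) :
    (∀ (f g : U.left ⟶ X.left), HasClass f v → HasClass g w → ∀ hf hg,
      classOf X f hf = classOf X g hg) ∧
      ((∃ f : U.left ⟶ X.left, HasClass f v) ↔ ∃ f : U.left ⟶ X.left, HasClass f w) := by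
  have key (v : Vert X.hom U.hom) (f g : U.left ⟶ X.left) (hfv : HasClass f v)
      (hgv : HasClass g v) (hf) (hg) : classOf X f hf = classOf X g hg := by
    obtain ⟨f', rfl, hf'⟩ := hfv
    obtain ⟨g', rfl, hg'⟩ := hgv
    exact classOf_eq_of_chart v.c f' g' (hf'.trans hg'.symm) hf hg
  induction h with
  | rel v w h =>
    obtain ⟨M, _, m, m', j, h1, h2, h3, -⟩ := h
    have hv : HasClass (j ≫ m ≫ v.c.chart.ν) v :=
      ⟨j ≫ m, Category.assoc _ _ _, (Category.assoc _ _ _).trans h2.symm⟩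
    have hw : HasClass (j ≫ m ≫ v.c.chart.ν) w :=
      ⟨j ≫ m', (Category.assoc _ _ _).trans (congrArg (j ≫ ·) h1.symm),
        (Category.assoc _ _ _).trans h3.symm⟩
    exact ⟨fun f g hfv hgw hf hg ↦ (key v f _ hfv hv hf hv.comp_eq).trans
      (key w _ g hw hgw hv.comp_eq hg), fun _ ↦ ⟨_, hw⟩, fun _ ↦ ⟨_, hv⟩⟩
  | refl v => exact ⟨key v, Iff.rfl⟩
  | symm v w _ ih => exact ⟨fun f g hf hg h h' ↦ (ih.1 g f hg hf h' h).symm, ih.2.symm⟩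
  | trans v w x _ _ ih ih' =>
    refine ⟨fun f g hfv hgx hf hg ↦ ?_, ih.2.trans ih'.2⟩
    obtain ⟨f', hf'⟩ := ih.2.mp ⟨f, hfv⟩
    exact (ih.1 f f' hfv hf' hf hf'.comp_eq).trans (ih'.1 f' g hf' hgx hf'.comp_eq hg)

/-- On the fibre product the two representatives have the same class, hence are related on a
Nisnevich neighbourhood of the point defined by the generic point of `V` and `r`. The splitting
there lifts the generic point of `V` to `W`. -/
theorem exists_rel_neighbourhood (hX : topologicalKrullDim X.left = 1) {Y V V' : Sm k}
    [IsIntegral V.left] (e : V ⟶ Y) (e' : V' ⟶ Y) [Etale e.left] [Etale e'.left]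
    (h : (S (schemeSheaf X)).obj.obj (op Y))
    (f : V.left ⟶ X.left) (hf : f ≫ X.hom = V.hom)
    (hfh : classOf X f hf = (S (schemeSheaf X)).obj.map e.op h)
    (f' : V'.left ⟶ X.left) (hf' : f' ≫ X.hom = V'.hom)
    (hfh' : classOf X f' hf' = (S (schemeSheaf X)).obj.map e'.op h)
    (r : Spec V.left.functionField ⟶ V'.left)
    (hr : r ≫ e'.left = genericInclusion V.left ≫ e.left) :
    ∃ (W : Sm k) (a : W ⟶ V) (a' : W ⟶ V') (q : Spec V.left.functionField ⟶ W.left),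
      IsIntegral W.left ∧ Etale a.left ∧ Etale a'.left ∧ a ≫ e = a' ≫ e' ∧
      q ≫ a.left = genericInclusion V.left ∧ q ≫ a'.left = r ∧
      Rel (s := X.hom) W.hom (a.left ≫ f) (a'.left ≫ f') := by
  let Z := etalePullback e e'
  let q₀ : Spec (.of V.left.functionField) ⟶ Z.left := pullback.lift (genericInclusion V.left) r hr.symm
  have hZ : classOf X ((etalePullbackFst e e').left ≫ f) (comp_hom_eq _ hf) =
      classOf X ((etalePullbackSnd e e').left ≫ f') (comp_hom_eq _ hf') := by
    rw [← map_classOf _ f hf, ← map_classOf _ f' hf', hfh, hfh', ← Functor.map_comp_apply,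
      ← Functor.map_comp_apply, ← op_comp, ← op_comp, etalePullback_condition]
  let x := q₀ default
  obtain ⟨b, hb⟩ := exists_fac_of_field q₀ (x := x) fun t ↦ by rw [Subsingleton.elim t default]
  obtain ⟨W, w, hW, _, hx, hrel⟩ := exists_rel_of_classOf_eq hX _ _ hZ x
  obtain ⟨l, hl⟩ := (splitAt_iff _ _).mp hx
  have hq : (Spec.map b ≫ l) ≫ w.left = q₀ := by rw [Category.assoc, hl, hb]
  refine ⟨W, w ≫ etalePullbackFst e e', w ≫ etalePullbackSnd e e', Spec.map b ≫ l, hW,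
    etale_left_comp _ _, etale_left_comp _ _, ?_, ?_, ?_, ?_⟩
  · rw [Category.assoc, Category.assoc, etalePullback_condition]
  · exact (Category.assoc _ _ _).symm.trans ((congrArg (· ≫ pullback.fst e.left e'.left) hq).trans
      (pullback.lift_fst _ _ _))
  · exact (Category.assoc _ _ _).symm.trans ((congrArg (· ≫ pullback.snd e.left e'.left) hq).trans
      (pullback.lift_snd _ _ _))
  · have e1 (g : W.left ⟶ Z.left) {B : Scheme.{u}} (g' : Z.left ⟶ B) (g'' : B ⟶ X.left) :
      g ≫ g' ≫ g'' = (g ≫ g') ≫ g'' := (Category.assoc _ _ _).symm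
    rw [e1, e1] at hrel
    exact hrel

end

/-! ### Sections of `S(X)` over an affine line -/

section

theorem genericInclusion_hom_ext {V Z : Scheme.{u}} [Z.IsSeparated] [IsIntegral V] {f g : V ⟶ Z}
    (h : genericInclusion V ≫ f = genericInclusion V ≫ g) : f = g :=
  ext_of_isDominant (genericInclusion V) h

variable {k : Type u} [Field k]

theorem exists_common_refinement {U V₀ V₁ : Sm k} (e₀ : V₀ ⟶ U) (e₁ : V₁ ⟶ U) [Etale e₀.left]
    [Etale e₁.left] (x : U.left) (h₀ : SplitAt e₀.left x) (h₁ : SplitAt e₁.left x) :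
    ∃ (W : Sm k) (p₀ : W ⟶ V₀) (p₁ : W ⟶ V₁), IsIntegral W.left ∧ p₀ ≫ e₀ = p₁ ≫ e₁ ∧
      Etale (p₀ ≫ e₀).left ∧ SplitAt (p₀ ≫ e₀).left x := by
  obtain ⟨y, rfl, hy⟩ := h₀
  obtain ⟨z, hz, hzi⟩ := SplitAt.etalePullbackSnd e₁ e₀ y h₁
  obtain ⟨W, j, hW, _, w, rfl⟩ := exists_integral_neighbourhood _ z
  refine ⟨W, j ≫ etalePullbackSnd e₁ e₀, j ≫ etalePullbackFst e₁ e₀, hW, ?_, ?_, ?_⟩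
  · rw [Category.assoc, Category.assoc, etalePullback_condition]
  · exact inferInstanceAs (Etale ((j.left ≫ (etalePullbackSnd e₁ e₀).left) ≫ e₀.left))
  · exact SplitAt.comp rfl hy (SplitAt.comp hz hzi (.of_isOpenImmersion j.left w))

variable {X : Over (Spec (CommRingCat.of k))} [PerfectField k] [IsProper X.hom]

instance isIntegral_lineOver (U : Sm k) [IsIntegral U.left] : IsIntegral (lineOver U).left :=
  inferInstanceAs (IsIntegral (Line U.left))

/-- Constants do not vary along the line (`eq_comp_of_line`). -/
theorem pull_zeroSection {U : Sm k} [IsIntegral U.left] (c : Vert X.hom (lineOver U).hom) :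
    c.pull (zeroSection U).left (MorphismProperty.Over.w (zeroSection U)) =
      c.pull (oneSection U).left (MorphismProperty.Over.w (oneSection U)) := by
  obtain ⟨c, a, w⟩ := c
  have h0 : (zeroSection U).left ≫ (Line U.left ↘ U.left) = 𝟙 U.left :=
    AffineSpace.homOfVector_over _ _
  have h1 : (oneSection U).left ≫ (Line U.left ↘ U.left) = 𝟙 U.left :=
    AffineSpace.homOfVector_over _ _
  have key := eq_comp_of_line (V := U.left) c.chart.π (t := U.hom) a w (zeroSection U).left h0
  have h2 : (zeroSection U).left ≫ a = (oneSection U).left ≫ a := by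
    conv_rhs => rw [key]
    exact ((Category.assoc _ _ _).symm.trans
      ((congrArg (· ≫ (zeroSection U).left ≫ a) h1).trans (Category.id_comp _))).symm
  have h3 (a a' : U.left ⟶ Spec (.of c.chart.L)) (w w') (ha : a = a') :
      (⟨c, a, w⟩ : Vert X.hom U.hom) = ⟨c, a', w'⟩ := by
    subst ha
    rfl
  exact h3 _ _ _ _ h2

/-- If the representative at the generic point is neither closed nor rational then the section
comes from a morphism to `X`. -/
theorem exists_classOf_of_rigid (hX : topologicalKrullDim X.left = 1) {Y V' : Sm k}
    [IsIntegral Y.left] [IsIntegral V'.left] (h : (S (schemeSheaf X)).obj.obj (op Y)) (e' : V' ⟶ Y)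
    [Etale e'.left] (hη : SplitAt e'.left (genericPoint Y.left))
    (f' : V'.left ⟶ X.left) (hf' : f' ≫ X.hom = V'.hom)
    (hfh' : classOf X f' hf' = (S (schemeSheaf X)).obj.map e'.op h)
    (hr : ¬ (IsClosed {f' (genericPoint V'.left)} ∨
      IsRationalPoint X.hom (f' (genericPoint V'.left)))) :
    ∃ (f : Y.left ⟶ X.left) (hf : f ≫ X.hom = Y.hom), classOf X f hf = h := by
  have : X.left.IsSeparated := isSeparated_of_isProper X.hom
  obtain ⟨l, hl⟩ := (splitAt_iff _ _).mp hη
  -- A class for `f'` on `W` would make its generic value closed or rational, so related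
  -- representatives are equal.
  have hrig {V : Sm k} [IsIntegral V.left] (e : V ⟶ Y) [Etale e.left] (f : V.left ⟶ X.left)
      (hf : f ≫ X.hom = V.hom) (hfh : classOf X f hf = (S (schemeSheaf X)).obj.map e.op h)
      (r : Spec V.left.functionField ⟶ V'.left)
      (hr : r ≫ e'.left = genericInclusion V.left ≫ e.left) :
      genericInclusion V.left ≫ f = r ≫ f' := by
    obtain ⟨W, a, a', q, _, _, _, haa, hqa, hqa', hrel⟩ :=
      exists_rel_neighbourhood hX e e' h f hf hfh f' hf' hfh' r hr
    obtain hrel | ⟨v, w, hv, hw, -⟩ := hrel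
    · rw [← hqa, Category.assoc, hrel, ← Category.assoc, hqa']
    · have h1 := HasClass.isClosed_or_isRationalPoint (T := W.left) hX hw (genericPoint W.left)
      rw [Scheme.Hom.comp_apply, map_genericPoint_of_etale (V := W.left) (Y := V'.left)] at h1
      exact absurd h1 ‹_›
  choose V e f hf hV he hx hfh using fun x : Y.left ↦ exists_classOf_eq h x
  have hcov : ∀ x : Y.left, ∃ i, ∃ y, (e i).left y = x := fun x ↦ ⟨x, (hx x).imp fun _ h ↦ h.1⟩
  -- Overlaps are covered by integral opens. On their generic points both representatives are
  -- rigidly determined by `f'`.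
  have hcompat (i j) : pullback.fst (e i).left (e j).left ≫ f i =
      pullback.snd (e i).left (e j).left ≫ f j := by
    have := he i
    have := he j
    let Z := etalePullback (e i) (e j)
    choose Z' z hZ' hz hzx using exists_integral_neighbourhood Z
    refine scheme_hom_ext (U := Z) Z' z (fun x ↦ ?_) (fun x ↦ ⟨x, hzx x⟩) fun x ↦ ?_
    · have := hz x
      infer_instance
    · have := hZ' x
      have := hz x
      have : Etale (z x).left := inferInstance
      have : Etale (z x ≫ etalePullbackFst (e i) (e j) ≫ e i).left :=
        inferInstanceAs (Etale ((z x).left ≫ (etalePullbackFst (e i) (e j)).left ≫ (e i).left))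
      obtain ⟨r, hr⟩ := exists_lift_functionField e' l hl
        (z x ≫ etalePullbackFst (e i) (e j) ≫ e i)
      have h1 := hrig (z x ≫ etalePullbackFst (e i) (e j) ≫ e i)
        ((z x ≫ etalePullbackFst (e i) (e j)).left ≫ f i) (comp_hom_eq _ (hf i)) (by
          rw [← map_classOf _ _ (hf i), hfh, ← Functor.map_comp_apply, ← op_comp, Category.assoc])
          r hr
      have h2 := hrig (z x ≫ etalePullbackFst (e i) (e j) ≫ e i)
        ((z x ≫ etalePullbackSnd (e i) (e j)).left ≫ f j) (comp_hom_eq _ (hf j)) (by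
          rw [← map_classOf _ _ (hf j), hfh, ← Functor.map_comp_apply, ← op_comp, Category.assoc,
            etalePullback_condition]) r hr
      have h3 := genericInclusion_hom_ext (h1.trans h2.symm)
      exact (Category.assoc _ _ _).symm.trans (h3.trans (Category.assoc _ _ _))
  obtain ⟨g, hg, -⟩ := (Presieve.isSheafFor_arrows_iff _ _).mp
    (sheafFor_scheme V e he hcov X.left) f (fun i j Z gi gj hij ↦
      pullback_glue _ _ _ _ (hcompat i j) gi gj hij)
  replace hg : ∀ i, (e i).left ≫ g = f i := hg
  have hgX : g ≫ X.hom = Y.hom := scheme_hom_ext V e he hcov fun i ↦ by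
    rw [← Category.assoc, hg, hf, MorphismProperty.Over.w]
  refine ⟨g, hgX, eq_of_locally_eq _ fun x ↦ ⟨V x, e x, he x, hx x, ?_⟩⟩
  rw [map_classOf, ← hfh]
  exact classOf_congr (hg x) _ _

/-- If the representative at the generic point is closed or rational then all representatives have
classes coming from a single vertex. -/
theorem exists_vert_of_not_rigid (hX : topologicalKrullDim X.left = 1) {Y V' : Sm k}
    [IsIntegral Y.left] [IsIntegral V'.left] (h : (S (schemeSheaf X)).obj.obj (op Y)) (e' : V' ⟶ Y)
    [Etale e'.left] (hη : SplitAt e'.left (genericPoint Y.left))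
    (f' : V'.left ⟶ X.left) (hf' : f' ≫ X.hom = V'.hom)
    (hfh' : classOf X f' hf' = (S (schemeSheaf X)).obj.map e'.op h)
    (hr : IsClosed {f' (genericPoint V'.left)} ∨
      IsRationalPoint X.hom (f' (genericPoint V'.left))) :
    ∃ c : Vert X.hom Y.hom, ∀ {V : Sm k} [IsIntegral V.left] (e : V ⟶ Y) [Etale e.left]
      (f : V.left ⟶ X.left) (hf : f ≫ X.hom = V.hom), classOf X f hf =
        (S (schemeSheaf X)).obj.map e.op h →
      ∃ d : Vert X.hom V.hom, HasClass f d ∧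
        Conn d (c.pull e.left (MorphismProperty.Over.w e)) := by
  obtain ⟨l, hl⟩ := (splitAt_iff _ _).mp hη
  obtain ⟨v, hv⟩ := exists_hasClass_of_comp_eq (locallyNormal_left V') f' hf' hr
  -- `V'` splits over the generic point of `Y`, so the vertex of `f'` restricts to the function
  -- field of `Y`, from where it extends by normality.
  obtain ⟨r, hr⟩ : ∃ r : Spec Y.left.functionField ⟶ V'.left,
      r ≫ e'.left = genericInclusion Y.left := by
    have : Etale (𝟙 Y : Y ⟶ Y).left := inferInstanceAs (Etale (𝟙 Y.left))
    obtain ⟨r, hr⟩ := exists_lift_functionField e' l hl (𝟙 Y)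
    exact ⟨r, hr.trans (Category.comp_id _)⟩
  have hrt : r ≫ V'.hom = genericInclusion Y.left ≫ Y.hom := by
    rw [← MorphismProperty.Over.w e', reassoc_of% hr]
  obtain ⟨c, hc⟩ := Vert.exists_extension (locallyNormal_left Y) (v.pull r hrt)
  have hcv : c.pull e'.left (MorphismProperty.Over.w e') = v := by
    refine Vert.pull_injective r hrt ?_
    rw [Vert.pull_pull _ _ _ _ _ (genericInclusion Y.left) hr rfl]
    exact hc
  refine ⟨c, fun {V} _ e _ f hf hfh ↦ ?_⟩
  obtain ⟨r', hr'⟩ := exists_lift_functionField e' l hl e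
  obtain ⟨W, a, a', q, _, _, _, haa, hqa, hqa', hrel⟩ :=
    exists_rel_neighbourhood hX e e' h f hf hfh f' hf' hfh' r' hr'
  have ha' : a'.left ≫ V'.hom = W.hom := MorphismProperty.Over.w a'
  have ha : a.left ≫ V.hom = W.hom := MorphismProperty.Over.w a
  have hva := hv.pull a'.left ha'
  obtain ⟨w, hw, hwc⟩ : ∃ w, HasClass (a.left ≫ f) w ∧ Conn w (v.pull a'.left ha') := by
    obtain hrel | ⟨w, w', hw, hw', hww⟩ := hrel
    · exact ⟨_, hrel ▸ hva, .refl _⟩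
    · exact ⟨w, hw, .trans _ _ _ hww (HasClass.conn (T := W.left) hX hw' hva)⟩
  have hcl := HasClass.isClosed_or_isRationalPoint (T := W.left) hX hw (genericPoint W.left)
  rw [Scheme.Hom.comp_apply, map_genericPoint_of_etale (V := W.left) (Y := V.left)] at hcl
  obtain ⟨d, hd⟩ := exists_hasClass_of_comp_eq (locallyNormal_left V) f hf hcl
  -- Connectedness is known only on the neighbourhood `W` of the generic point of `V`; normality of
  -- `V` spreads it out.
  refine ⟨d, hd, Conn.of_map_genericInclusion (locallyNormal_left V) ?_⟩
  have h1 : Conn (d.pull a.left ha) (v.pull a'.left ha') :=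
    .trans _ _ _ (HasClass.conn (T := W.left) hX (hd.pull a.left ha) hw) hwc
  have h2 : v.pull a'.left ha' = (c.pull e.left (MorphismProperty.Over.w e)).pull a.left ha := by
    rw [← hcv, Vert.pull_pull _ _ _ _ _ (a' ≫ e').left rfl (MorphismProperty.Over.w _),
      Vert.pull_pull _ _ _ _ _ (a' ≫ e').left (congrArg (·.left) haa)
        (MorphismProperty.Over.w _)]
  rw [h2] at h1
  have hqt : q ≫ W.hom = genericInclusion V.left ≫ V.hom := by rw [← ha, reassoc_of% hqa]
  have h3 := h1.pull q hqt
  rw [Vert.pull_pull _ _ _ _ _ (genericInclusion V.left) hqa rfl,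
    Vert.pull_pull _ _ _ _ _ (genericInclusion V.left) hqa rfl] at h3
  exact h3

/-- Either `h` comes from a morphism, which is itself a homotopy, or a single vertex over the line
governs all representatives, and its restrictions to `0` and `1` coincide. -/
theorem map_zeroSection_eq_of_isIntegral (hX : topologicalKrullDim X.left = 1) (U : Sm k)
    [IsIntegral U.left] (h : (S (schemeSheaf X)).obj.obj (op (lineOver U))) :
    (S (schemeSheaf X)).obj.map (zeroSection U).op h =
      (S (schemeSheaf X)).obj.map (oneSection U).op h := by
  obtain ⟨V', e', f', hf', _, _, hη, hfh'⟩ := exists_classOf_eq h (genericPoint _)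
  by_cases hr : IsClosed {f' (genericPoint V'.left)} ∨
      IsRationalPoint X.hom (f' (genericPoint V'.left))
  swap
  · obtain ⟨f, hf, rfl⟩ := exists_classOf_of_rigid hX h e' hη f' hf' hfh' hr
    rw [map_classOf, map_classOf]
    exact classOf_eq_of_line f hf _ _
  obtain ⟨c, hc⟩ := exists_vert_of_not_rigid hX h e' hη f' hf' hfh' hr
  refine eq_of_locally_eq _ fun x ↦ ?_
  obtain ⟨V₀, e₀, f₀, hf₀, _, _, hx₀, hfh₀⟩ := exists_classOf_eq h ((zeroSection U).left x)
  obtain ⟨V₁, e₁, f₁, hf₁, _, _, hx₁, hfh₁⟩ := exists_classOf_eq h ((oneSection U).left x)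
  obtain ⟨d₀, hd₀, hcd₀⟩ := hc e₀ f₀ hf₀ hfh₀
  obtain ⟨d₁, hd₁, hcd₁⟩ := hc e₁ f₁ hf₁ hfh₁
  obtain ⟨W, p₀, p₁, _, hp, hpe, hps⟩ := exists_common_refinement
    (etalePullbackSnd e₀ (zeroSection U)) (etalePullbackSnd e₁ (oneSection U)) x
    (.etalePullbackSnd _ _ _ hx₀) (.etalePullbackSnd _ _ _ hx₁)
  let t := p₀ ≫ etalePullbackSnd e₀ (zeroSection U)
  let q₀ := p₀ ≫ etalePullbackFst e₀ (zeroSection U)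
  let q₁ := p₁ ≫ etalePullbackFst e₁ (oneSection U)
  have hq₀ : q₀ ≫ e₀ = t ≫ zeroSection U := by
    simp only [q₀, t, Category.assoc, etalePullback_condition]
  have hq₁ : q₁ ≫ e₁ = t ≫ oneSection U := by
    simp only [q₁, t, hp, Category.assoc, etalePullback_condition]
  refine ⟨W, t, hpe, hps, ?_⟩
  have h₀ : (S (schemeSheaf X)).obj.map t.op ((S (schemeSheaf X)).obj.map (zeroSection U).op h) =
      classOf X (q₀.left ≫ f₀) (comp_hom_eq q₀ hf₀) := by
    rw [← map_classOf _ _ hf₀, hfh₀, ← Functor.map_comp_apply, ← Functor.map_comp_apply, ← op_comp,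
      ← op_comp, hq₀]
  have h₁ : (S (schemeSheaf X)).obj.map t.op ((S (schemeSheaf X)).obj.map (oneSection U).op h) =
      classOf X (q₁.left ≫ f₁) (comp_hom_eq q₁ hf₁) := by
    rw [← map_classOf _ _ hf₁, hfh₁, ← Functor.map_comp_apply, ← Functor.map_comp_apply, ← op_comp,
      ← op_comp, hq₁]
  rw [h₀, h₁]
  have hw₀ : q₀.left ≫ V₀.hom = W.hom := MorphismProperty.Over.w q₀
  have hw₁ : q₁.left ≫ V₁.hom = W.hom := MorphismProperty.Over.w q₁
  refine (classOf_eq_of_conn (v := d₀.pull q₀.left hw₀) (w := d₁.pull q₁.left hw₁) ?_).1 _ _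
    (hd₀.pull _ _) (hd₁.pull _ _) _ _
  -- Both pullbacks factor through `t`, followed by the zero or the one section, so
  -- `pull_zeroSection` identifies them.
  have key : (c.pull e₀.left (MorphismProperty.Over.w e₀)).pull q₀.left hw₀ =
      (c.pull e₁.left (MorphismProperty.Over.w e₁)).pull q₁.left hw₁ := by
    rw [Vert.pull_pull _ _ _ _ _ (t ≫ zeroSection U).left (congrArg (·.left) hq₀)
        (MorphismProperty.Over.w _),
      Vert.pull_pull _ _ _ _ _ (t ≫ oneSection U).left (congrArg (·.left) hq₁)
        (MorphismProperty.Over.w _)]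
    have e (σ : U ⟶ lineOver U) := Vert.pull_pull c σ.left (MorphismProperty.Over.w σ) t.left
      (MorphismProperty.Over.w t) (t ≫ σ).left rfl (MorphismProperty.Over.w _)
    exact (e _).symm.trans ((congrArg (Vert.pull · t.left _) (pull_zeroSection c)).trans (e _))
  have k₀ := hcd₀.pull q₀.left hw₀
  rw [key] at k₀
  exact .trans _ _ _ k₀ (.symm _ _ (hcd₁.pull q₁.left hw₁))

theorem map_zeroSection_eq (hX : topologicalKrullDim X.left = 1) (U : Sm k)
    (h : (S (schemeSheaf X)).obj.obj (op (lineOver U))) :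
    (S (schemeSheaf X)).obj.map (zeroSection U).op h =
      (S (schemeSheaf X)).obj.map (oneSection U).op h := by
  refine eq_of_locally_eq _ fun x ↦ ?_
  obtain ⟨V, j, _, _, v, rfl⟩ := exists_integral_neighbourhood U x
  refine ⟨V, j, inferInstance, .of_isOpenImmersion j.left v, ?_⟩
  rw [← Functor.map_comp_apply, ← Functor.map_comp_apply, ← op_comp, ← op_comp,
    ← zeroSection_naturality, ← oneSection_naturality, op_comp, op_comp, Functor.map_comp_apply,
    Functor.map_comp_apply]
  exact map_zeroSection_eq_of_isIntegral hX V _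

end

end A1Chain

end

theorem mainTheorem10 {k : Type u} [Field k] [PerfectField k]
    (X : Over (Spec (CommRingCat.of k))) [IsReduced X.left] [IsProper X.hom]
    (hX : topologicalKrullDim X.left = 1) :
    IsIso (A1Chain.toS (A1Chain.iterS (A1Chain.schemeSheaf X) 1) :
      A1Chain.iterS (A1Chain.schemeSheaf X) 1 ⟶ A1Chain.iterS (A1Chain.schemeSheaf X) 2) := by
  exact A1Chain.isIso_toS _ (A1Chain.map_zeroSection_eq hX)
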